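/- Let $n\ge 2$ be an integer and let $p,s,q,\theta$ be real numbers with $$1<p<n,\qquad 1\le s<q<p^\star:=\frac{np}{n-p},\qquad \frac{\theta}{p^\star}+\frac{1-\theta}{s}=\frac1q .$$ Write $\|\cdot\|_r$ for the $L^r$-norm on $\mathbb R^n$ and let $D^{p,s}(\mathbb R^n)$ be the closure of $C_c^\infty(\mathbb R^n)$ (real-valued functions) under the norm $\|\nabla u\|_p+\|u\|_s$. Let $$G=\inf\Big\{\frac{\|\nabla u\|_p^{\theta}\,\|u\|_s^{1-\theta}}{\|u\|_q}:\ u\in D^{p,s}(\mathbb R^n),\ u\ne 0\Big\}$$ be the sharp constant in the Gagliardo–Nirenberg–Sobolev inequality $G\|u\|_q\le\|\nabla u\|_p^\theta\|u\|_s^{1-\theta}$. Call $v\in D^{p,s}(\mathbb R^n)\setminus\{0\}$ optimal if equality holds for $v$ in this inequality. For $u\in D^{p,s}(\mathbb R^n)\setminus\{0\}$ define the deficit and the asymmetry of $u$ by $$\delta(u)=\frac{\|\nabla u\|_p^{\theta}\,\|u\|_s^{1-\theta}}{G\,\|u\|_q}-1,\qquad \lambda(u)=\inf\Big\{\frac{\|u-v\|_q^q}{\|u\|_q^q}:\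 v\text{ optimal},\ \|v\|_q=\|u\|_q\Big\},$$ where the infimum of the empty set is $+\infty$. Let $(u_h)_{h\in\mathbb N}$ be a sequence in $D^{p,s}(\mathbb R^n)\setminus\{0\}$ such that $\delta(u_h)\to 0$ as $h\to\infty$. Then $\lambda(u_h)\to 0$ as $h\to\infty$. -/

import Mathlib

open MeasureTheory Filter Topology
open scoped ENNReal ContDiff

namespace GNS

/-- Real valued smooth functions with compact support on `ℝⁿ`. -/
def IsTest {n : ℕ} (φ : EuclideanSpace ℝ (Fin n) → ℝ) : Prop :=
  ContDiff ℝ ∞ φ ∧ HasCompactSupport φ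

/-- `V` is a weak (distributional) gradient of `u` on `ℝⁿ`: `∫ φ V = -∫ u ∇φ` for every
test function `φ`, as an identity between vectors of `ℝⁿ`. -/
def HasWeakGradient {n : ℕ} (u : EuclideanSpace ℝ (Fin n) → ℝ)
    (V : EuclideanSpace ℝ (Fin n) → EuclideanSpace ℝ (Fin n)) : Prop :=
  LocallyIntegrable u ∧ LocallyIntegrable V ∧
    ∀ φ : EuclideanSpace ℝ (Fin n) → ℝ, IsTest φ →
      ∫ x, φ x • V x = -∫ x, u x • gradient φ x

/-- Weak gradients are unique up to null sets. -/
theorem HasWeakGradient.ae_eq {n : ℕ} {u : EuclideanSpace ℝ (Fin n) → ℝ}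
    {V W : EuclideanSpace ℝ (Fin n) → EuclideanSpace ℝ (Fin n)}
    (hV : HasWeakGradient u V) (hW : HasWeakGradient u W) : V =ᵐ[volume] W :=
  ae_eq_of_integral_contDiff_smul_eq hV.2.1 hW.2.1 fun φ h1 h2 =>
    (hV.2.2 φ ⟨h1, h2⟩).trans (hW.2.2 φ ⟨h1, h2⟩).symm

open Classical in
/-- The weak gradient `∇u` of `u` (a representative, unique up to null sets; it is `0` by
convention if `u` has no weak gradient). -/
noncomputable def weakGrad {n : ℕ} (u : EuclideanSpace ℝ (Fin n) → ℝ) :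
    EuclideanSpace ℝ (Fin n) → EuclideanSpace ℝ (Fin n) :=
  if h : ∃ V, HasWeakGradient u V then h.choose else 0

theorem HasWeakGradient.weakGrad_ae_eq {n : ℕ} {u : EuclideanSpace ℝ (Fin n) → ℝ}
    {V : EuclideanSpace ℝ (Fin n) → EuclideanSpace ℝ (Fin n)}
    (hV : HasWeakGradient u V) : weakGrad u =ᵐ[volume] V := by
  have h : ∃ V, HasWeakGradient u V := ⟨V, hV⟩
  have h2 : HasWeakGradient u (weakGrad u) := by
    rw [weakGrad, dif_pos h]
    exact h.choose_spec
  exact h2.ae_eq hV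

/-- The real number `‖f‖_r`, the `L^r` norm on `ℝⁿ` with respect to Lebesgue measure
(used for functions of finite `L^r` norm, and for a real exponent `r ≥ 1`). -/
noncomputable def lNorm {n : ℕ} {F : Type*} [NormedAddCommGroup F] (r : ℝ)
    (f : EuclideanSpace ℝ (Fin n) → F) : ℝ :=
  (eLpNorm f (ENNReal.ofReal r) volume).toReal

/-- Membership in `D^{p,s}(ℝⁿ)`, the closure of the test functions under the norm
`‖∇u‖_p + ‖u‖_s`. -/
def MemD {n : ℕ} (p s : ℝ) (u : EuclideanSpace ℝ (Fin n) → ℝ) : Prop :=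
  MemLp u (ENNReal.ofReal s) ∧
  (∃ V, HasWeakGradient u V) ∧
  MemLp (weakGrad u) (ENNReal.ofReal p) ∧
  ∃ φ : ℕ → EuclideanSpace ℝ (Fin n) → ℝ, (∀ k, IsTest (φ k)) ∧
    Tendsto (fun k => eLpNorm (fun x => gradient (φ k) x - weakGrad u x) (ENNReal.ofReal p) volume
      + eLpNorm (fun x => φ k x - u x) (ENNReal.ofReal s) volume) atTop (𝓝 0)

/-- The nonzero elements of `D^{p,s}(ℝⁿ)` (nonzero as classes modulo null sets). -/
def MemDNonzero {n : ℕ} (p s : ℝ) (u : EuclideanSpace ℝ (Fin n) → ℝ) : Prop :=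
  MemD p s u ∧ ¬ u =ᵐ[volume] 0

/-- The sharp constant `G` in `G ‖u‖_q ≤ ‖∇u‖_p^θ ‖u‖_s^(1-θ)`, that is, the infimum of
`‖∇u‖_p^θ ‖u‖_s^(1-θ) / ‖u‖_q` over the nonzero `u` in `D^{p,s}(ℝⁿ)`. -/
noncomputable def sharpConst (n : ℕ) (p s q θ : ℝ) : ℝ :=
  sInf {c : ℝ | ∃ u : EuclideanSpace ℝ (Fin n) → ℝ, MemDNonzero p s u ∧
    c = lNorm p (weakGrad u) ^ θ * lNorm s u ^ (1 - θ) / lNorm q u}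

/-- The deficit `δ(u)`. -/
noncomputable def deficit {n : ℕ} (p s q θ : ℝ) (u : EuclideanSpace ℝ (Fin n) → ℝ) : ℝ :=
  lNorm p (weakGrad u) ^ θ * lNorm s u ^ (1 - θ) / (sharpConst n p s q θ * lNorm q u) - 1

/-- `v` is optimal: a nonzero element of `D^{p,s}(ℝⁿ)` with equality in the sharp inequality. -/
def IsOptimal {n : ℕ} (p s q θ : ℝ) (v : EuclideanSpace ℝ (Fin n) → ℝ) : Prop :=
  MemDNonzero p s v ∧
    sharpConst n p s q θ * lNorm q v = lNorm p (weakGrad v) ^ θ * lNorm s v ^ (1 - θ)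

/-- The asymmetry `λ(u)`, the infimum of `‖u - v‖_q^q / ‖u‖_q^q` over the optimal `v` with
`‖v‖_q = ‖u‖_q`. It takes values in `[0, ∞]`, so that the infimum over the empty set is `∞`. -/
noncomputable def asymmetry {n : ℕ} (p s q θ : ℝ) (u : EuclideanSpace ℝ (Fin n) → ℝ) : ℝ≥0∞ :=
  ⨅ (v : EuclideanSpace ℝ (Fin n) → ℝ) (_ : IsOptimal p s q θ v)
    (_ : eLpNorm v (ENNReal.ofReal q) volume = eLpNorm u (ENNReal.ofReal q) volume),
    eLpNorm (fun x => u x - v x) (ENNReal.ofReal q) volume ^ q /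
      eLpNorm u (ENNReal.ofReal q) volume ^ q

end GNS

/-!
By dilating and multiplying by constants, and approximating in `D^{p,s}`, it suffices to treat a
sequence of test functions `φ k` with `‖φ k‖_s = ‖φ k‖_q = 1` and `‖∇φ k‖_p → D`, where `D ^ θ = G`:
the balance of the exponents makes the quotient invariant (`exists_normalization`). Such a sequence
is called minimizing (`IsMinimizing`), and the heart of the proof is that, up to translations, it
has a subsequence converging in `L^q` to an optimal function (`IsMinimizing.exists_optimal`). The
theorem follows by undoing the normalization (`asymmetry_le`). The compactness argument is the
concentration-compactness method, in an elementary form.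

*No vanishing.* Averaging over the cells of a grid of mesh `ε` changes a function by at most
`C ε ‖∇f‖_p` in `L^p`. If all averages were small, interpolation would make `‖f‖_q` small; hence
some cell carries an average bounded below (`exists_cellValue_ge`), and a translation moves it to
the origin. The same grid averages give local compactness in `L^p` (`exists_subseq_tendsto_local`),
so a subsequence converges locally to some `u ≠ 0`.

*No splitting.* With a cutoff `η` equal to `1` on a large ball, apply the sharp inequality to `η φ`
and to `(1 - η) φ`. Since `|η a| ^ r + |(1 - η) a| ^ r ≤ |a| ^ r` for `r ≥ 1`, the `p`-th and `s`-th
powers of the norms of the two pieces add up to at most those of the whole, up to an error that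
vanishes as the radius grows. As `θ q / p + (1 - θ) q / s > 1`, the inequality is strictly
superadditive, so one piece carries no `L^q` mass (`eq_zero_or_eq_zero_of_split`,
`not_split_sequence`). Nonvanishing excludes the inner piece from being trivial; hence the sequence
is tight in `L^q` (`IsMinimizing.tight`) and converges to `u` in `L^q`.

*The limit is optimal.* Midpoints of a minimizing sequence have `L^s` norm at most `1` and `L^q`
norm close to `1`, so the sharp inequality forces their gradients to have norm almost `D`. Uniform
convexity of `L^p` (`cauchy_of_midpoint_norms`) then shows that the gradients converge in `L^p`,
necessarily to the weak gradient of `u`. Together with `‖u‖_s ≤ 1` (Fatou) and `‖u‖_q = 1` this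
gives the equality for `u`, once `u` is known to be a limit of test functions in `D^{p,s}`, which
cutoffs provide (`IsMinimizing.isOptimal_limit`).
-/

namespace GNS

/-! ### Tools for `L^r` norms -/

section LrTools

variable {α F : Type*} [MeasurableSpace α] {μ : Measure α} [NormedAddCommGroup F]

theorem eLpNorm_ofReal_eq {r : ℝ} (hr : 0 < r) (f : α → F) :
    eLpNorm f (ENNReal.ofReal r) μ = (∫⁻ x, ‖f x‖ₑ ^ r ∂μ) ^ (1 / r) := by
  rw [eLpNorm_eq_lintegral_rpow_enorm_toReal (by simpa using hr) ENNReal.ofReal_ne_top,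
    ENNReal.toReal_ofReal hr.le]

theorem eLpNorm_ofReal_rpow {r : ℝ} (hr : 0 < r) (f : α → F) :
    eLpNorm f (ENNReal.ofReal r) μ ^ r = ∫⁻ x, ‖f x‖ₑ ^ r ∂μ := by
  rw [eLpNorm_ofReal_eq hr, ← ENNReal.rpow_mul, one_div_mul_cancel hr.ne', ENNReal.rpow_one]

theorem eLpNorm_interpolation {a b r t : ℝ} (ha : 0 < a) (hb : 0 < b) (hr : 0 < r)
    (ht0 : 0 ≤ t) (ht1 : t ≤ 1) (h : (1 - t) / a + t / b = 1 / r) {f : α → F}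
    (hf : AEStronglyMeasurable f μ) :
    eLpNorm f (ENNReal.ofReal r) μ ≤
      eLpNorm f (ENNReal.ofReal a) μ ^ (1 - t) * eLpNorm f (ENNReal.ofReal b) μ ^ t := by
  have h1 : (1 - t) * r / a + t * r / b = 1 := by
    have : (1 - t) * r / a + t * r / b = ((1 - t) / a + t / b) * r := by ring
    rw [this, h, one_div_mul_cancel hr.ne']
  have key := ENNReal.lintegral_mul_norm_pow_le (μ := μ) (f := fun x => ‖f x‖ₑ ^ a)
    (g := fun x => ‖f x‖ₑ ^ b) (hf.enorm.pow_const a) (hf.enorm.pow_const b)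
    (p := (1 - t) * r / a) (q := t * r / b)
    (by have := sub_nonneg.2 ht1; positivity) (by positivity) h1
  have e : ∀ x, (‖f x‖ₑ ^ a) ^ ((1 - t) * r / a) * (‖f x‖ₑ ^ b) ^ (t * r / b) = ‖f x‖ₑ ^ r := by
    intro x
    rw [← ENNReal.rpow_mul, ← ENNReal.rpow_mul, ← ENNReal.rpow_add_of_nonneg]
    · congr 1
      field_simp
      ring
    · have := sub_nonneg.2 ht1; positivity
    · positivity
  simp_rw [e] at key
  rw [eLpNorm_ofReal_eq hr, eLpNorm_ofReal_eq ha, eLpNorm_ofReal_eq hb, ← ENNReal.rpow_mul,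
    ← ENNReal.rpow_mul]
  calc _ ≤ _ := ENNReal.rpow_le_rpow key (by positivity)
    _ = _ := by
      rw [ENNReal.mul_rpow_of_nonneg _ _ (by positivity), ← ENNReal.rpow_mul, ← ENNReal.rpow_mul]
      congr 2 <;> field_simp

/-- Every exponent strictly between two others is an interpolation exponent, and the
interpolation weights are nondegenerate. -/
theorem exists_interpolation_weight {a b r : ℝ} (ha : 0 < a) (har : a < r) (hrb : r < b) :
    ∃ t : ℝ, 0 < t ∧ t < 1 ∧ (1 - t) / a + t / b = 1 / r := by
  have hr := ha.trans har
  have hb := hr.trans hrb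
  have h1 : 1 / r < 1 / a := one_div_lt_one_div_of_lt ha har
  have h2 : 1 / b < 1 / r := one_div_lt_one_div_of_lt hr hrb
  have h3 : 0 < 1 / a - 1 / b := by linarith
  refine ⟨(1 / a - 1 / r) / (1 / a - 1 / b), div_pos (by linarith) h3,
    (div_lt_one h3).2 (by linarith), ?_⟩
  have : ∀ t : ℝ, (1 - t) / a + t / b = 1 / a - t * (1 / a - 1 / b) := fun t => by ring
  rw [this, div_mul_cancel₀ _ h3.ne']
  ring

theorem rpow_add_rpow_one_sub_le {r η : ℝ} (hr : 1 ≤ r) (h0 : 0 ≤ η) (h1 : η ≤ 1) :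
    η ^ r + (1 - η) ^ r ≤ 1 := by
  have a := Real.rpow_le_rpow_of_exponent_ge' h0 h1 zero_le_one hr
  have b := Real.rpow_le_rpow_of_exponent_ge' (sub_nonneg.2 h1) (by linarith) zero_le_one hr
  rw [Real.rpow_one] at a b
  linarith

/-- Multiplying by a cutoff `η` and by `1 - η` splits `∫ |f|^r` superadditively, because
`η ^ r + (1 - η) ^ r ≤ 1`. -/
theorem eLpNorm_rpow_split_le [NormedSpace ℝ F] {r : ℝ} (hr : 1 ≤ r) {η : α → ℝ}
    (hη : Measurable η) (h0 : ∀ x, 0 ≤ η x) (h1 : ∀ x, η x ≤ 1) {f : α → F}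
    (hf : AEStronglyMeasurable f μ) :
    eLpNorm (fun x => η x • f x) (ENNReal.ofReal r) μ ^ r
      + eLpNorm (fun x => (1 - η x) • f x) (ENNReal.ofReal r) μ ^ r
      ≤ eLpNorm f (ENNReal.ofReal r) μ ^ r := by
  have hr0 : 0 < r := by linarith
  have hm : AEMeasurable (fun x => ‖η x • f x‖ₑ ^ r) μ :=
    (hη.aestronglyMeasurable.smul hf).enorm.pow_const r
  rw [eLpNorm_ofReal_rpow hr0, eLpNorm_ofReal_rpow hr0, eLpNorm_ofReal_rpow hr0,
    ← lintegral_add_left' hm]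
  refine lintegral_mono fun x => ?_
  have e : ∀ c : ℝ, 0 ≤ c → ‖c • f x‖ₑ ^ r = ENNReal.ofReal (c ^ r) * ‖f x‖ₑ ^ r := by
    intro c hc
    rw [enorm_smul, ENNReal.mul_rpow_of_nonneg _ _ hr0.le, Real.enorm_of_nonneg hc,
      ENNReal.ofReal_rpow_of_nonneg hc hr0.le]
  dsimp only
  rw [e _ (h0 x), e _ (sub_nonneg.2 (h1 x)), ← add_mul,
    ← ENNReal.ofReal_add (Real.rpow_nonneg (h0 x) _)
      (Real.rpow_nonneg (sub_nonneg.2 (h1 x)) _)]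
  refine mul_le_of_le_one_left' ?_
  exact ENNReal.ofReal_le_one.2 (rpow_add_rpow_one_sub_le hr (h0 x) (h1 x))

/-- A sequence that is Cauchy in `L^r` converges in `L^r` to any almost everywhere limit of one of
its subsequences. -/
theorem tendsto_eLpNorm_of_cauchy_of_ae {r : ℝ≥0∞} {f : ℕ → α → F} {u : α → F}
    (hf : ∀ k, AEStronglyMeasurable (f k) μ) {σ : ℕ → ℕ} (hσ : Tendsto σ atTop atTop)
    (hae : ∀ᵐ x ∂μ, Tendsto (fun k => f (σ k) x) atTop (𝓝 (u x)))
    (hc : ∀ ε : ℝ≥0∞, 0 < ε → ∃ N, ∀ k ≥ N, ∀ l ≥ N, eLpNorm (fun x => f k x - f l x) r μ ≤ ε) :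
    Tendsto (fun k => eLpNorm (fun x => f k x - u x) r μ) atTop (𝓝 0) := by
  rw [ENNReal.tendsto_nhds_zero]
  intro ε hε
  obtain ⟨N, hN⟩ := hc ε hε
  filter_upwards [eventually_ge_atTop N] with k hk
  refine Lp.eLpNorm_le_of_ae_tendsto (u := atTop) (f := fun l x => f k x - f (σ l) x) ?_
    (fun l => (hf k).sub (hf _)) ?_
  · filter_upwards [hσ.eventually_ge_atTop N] with l hl using hN k hk _ hl
  · filter_upwards [hae] with x hx using hx.const_sub _

end LrTools

/-! ### Uniform convexity of `L^p` -/

section UniformConvexity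

variable {F : Type*} [NormedAddCommGroup F] [InnerProductSpace ℝ F]

theorem norm_midpoint_rpow_le {p : ℝ} (hp : 1 < p) (a b : F) :
    ‖(2⁻¹ : ℝ) • (a + b)‖ ^ p ≤ (‖a‖ ^ p + ‖b‖ ^ p) / 2 := by
  have h1 : ‖(2⁻¹ : ℝ) • (a + b)‖ ≤ (2⁻¹ : ℝ) * ‖a‖ + (2⁻¹ : ℝ) * ‖b‖ := by
    rw [norm_smul, ← mul_add]
    simpa using norm_add_le a b
  have h2 := (strictConvexOn_rpow hp).convexOn.2 (norm_nonneg a) (norm_nonneg b)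
    (by norm_num : (0 : ℝ) ≤ 2⁻¹) (by norm_num : (0 : ℝ) ≤ 2⁻¹) (by norm_num)
  simp only [smul_eq_mul] at h2
  calc _ ≤ _ := Real.rpow_le_rpow (norm_nonneg _) h1 (by linarith)
    _ ≤ _ := h2
    _ = _ := by ring

theorem eq_of_norm_midpoint_rpow_eq {p : ℝ} (hp : 1 < p) {a b : F}
    (h : ‖(2⁻¹ : ℝ) • (a + b)‖ ^ p = (‖a‖ ^ p + ‖b‖ ^ p) / 2) : a = b := by
  have h1 : ‖(2⁻¹ : ℝ) • (a + b)‖ ≤ (2⁻¹ : ℝ) * ‖a‖ + (2⁻¹ : ℝ) * ‖b‖ := by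
    rw [norm_smul, ← mul_add]
    simpa using norm_add_le a b
  have h2 := Real.rpow_le_rpow (norm_nonneg _) h1 (by linarith : 0 ≤ p)
  have hab : ‖a‖ = ‖b‖ := by
    by_contra hne
    have h3 := (strictConvexOn_rpow hp).2 (norm_nonneg a) (norm_nonneg b) hne
      (by norm_num : (0 : ℝ) < 2⁻¹) (by norm_num : (0 : ℝ) < 2⁻¹) (by norm_num)
    simp only [smul_eq_mul] at h3
    linarith
  refine eq_of_norm_eq_of_norm_add_eq hab ?_
  have h3 : ‖(2⁻¹ : ℝ) • (a + b)‖ ^ p = ‖b‖ ^ p := by rw [h, hab]; ring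
  have h4 : ‖(2⁻¹ : ℝ) • (a + b)‖ = ‖b‖ :=
    (Real.rpow_left_inj (norm_nonneg _) (norm_nonneg _) (by linarith)).1 h3
  rw [norm_smul, norm_inv, Real.norm_two] at h4
  rw [hab]
  linarith

/-- A quantitative form of the strict convexity of `‖·‖ ^ p`: the distance of two vectors is
controlled by their convexity gap, up to an arbitrarily small multiple of their size. -/
theorem exists_convexity_modulus [FiniteDimensional ℝ F] {p : ℝ} (hp : 1 < p) {η : ℝ}
    (hη : 0 < η) :
    ∃ c : ℝ, 0 ≤ c ∧ ∀ a b : F, ‖a - b‖ ^ p ≤ η * (‖a‖ ^ p + ‖b‖ ^ p)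
      + c * ((‖a‖ ^ p + ‖b‖ ^ p) / 2 - ‖(2⁻¹ : ℝ) • (a + b)‖ ^ p) := by
  have hp0 : 0 < p := by linarith
  let g : F × F → ℝ := fun z => ‖z.1 - z.2‖ ^ p - η * (‖z.1‖ ^ p + ‖z.2‖ ^ p)
  let G : F × F → ℝ := fun z => (‖z.1‖ ^ p + ‖z.2‖ ^ p) / 2 - ‖(2⁻¹ : ℝ) • (z.1 + z.2)‖ ^ p
  have hg : Continuous g := by
    have : ∀ x : ℝ, x ≠ 0 ∨ 0 ≤ p := fun _ => Or.inr hp0.le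
    refine ((continuous_fst.sub continuous_snd).norm.rpow_const fun _ => Or.inr hp0.le).sub
      (continuous_const.mul ((continuous_fst.norm.rpow_const fun _ => Or.inr hp0.le).add
        (continuous_snd.norm.rpow_const fun _ => Or.inr hp0.le)))
  have hG : Continuous G :=
    (((continuous_fst.norm.rpow_const fun _ => Or.inr hp0.le).add
        (continuous_snd.norm.rpow_const fun _ => Or.inr hp0.le)).div_const 2).sub
      (((continuous_fst.add continuous_snd).const_smul (2⁻¹ : ℝ)).norm.rpow_const
        fun _ => Or.inr hp0.le)
  have hG0 : ∀ z, 0 ≤ G z := fun z => sub_nonneg.2 (norm_midpoint_rpow_le hp z.1 z.2)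
  let K : Set (F × F) := Metric.sphere 0 1 ∩ {z | 0 ≤ g z}
  have hK : IsCompact K :=
    (isCompact_sphere (0 : F × F) 1).inter_right (isClosed_le continuous_const hg)
  -- it is enough to bound `g` by a multiple of `G` on the unit sphere
  have main : ∃ c : ℝ, 0 ≤ c ∧ ∀ z ∈ Metric.sphere (0 : F × F) 1, g z ≤ c * G z := by
    rcases K.eq_empty_or_nonempty with hKe | hKn
    · refine ⟨0, le_rfl, fun z hz => ?_⟩
      have : z ∉ K := by simp [hKe]
      have h2 : ¬ 0 ≤ g z := fun h => this ⟨hz, h⟩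
      linarith
    · obtain ⟨z0, hz0, hmin⟩ := hK.exists_isMinOn hKn hG.continuousOn
      obtain ⟨z1, hz1, hmax⟩ := hK.exists_isMaxOn hKn hg.continuousOn
      have hpos : 0 < G z0 := by
        refine lt_of_le_of_ne (hG0 z0) fun h0 => ?_
        have hab : z0.1 = z0.2 := eq_of_norm_midpoint_rpow_eq hp (sub_eq_zero.1 h0.symm).symm
        have h1 : 0 ≤ g z0 := hz0.2
        have h2 : g z0 = - (η * (‖z0.1‖ ^ p + ‖z0.2‖ ^ p)) := by
          simp only [g, hab, sub_self, norm_zero, Real.zero_rpow hp0.ne', zero_sub]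
        have h3 : ‖z0.2‖ ^ p ≤ 0 := by
          have : 0 ≤ ‖z0.1‖ ^ p := by positivity
          by_contra! h4
          have : 0 < η * (‖z0.1‖ ^ p + ‖z0.2‖ ^ p) := by positivity
          linarith
        have h4 : z0.2 = 0 := by
          by_contra hne
          have : 0 < ‖z0.2‖ ^ p := by positivity
          linarith
        have h5 : z0 = 0 := Prod.ext (hab.trans h4) h4
        have := hz0.1
        simp [h5] at this
      have hM : 0 ≤ g z1 := hz1.2
      refine ⟨g z1 / G z0, by positivity, fun z hz => ?_⟩
      by_cases h : 0 ≤ g z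
      · have h1 : g z ≤ g z1 := hmax ⟨hz, h⟩
        have h2 : G z0 ≤ G z := hmin ⟨hz, h⟩
        calc g z ≤ g z1 := h1
          _ = g z1 / G z0 * G z0 := by field_simp
          _ ≤ _ := by gcongr
      · have := hG0 z
        have : 0 ≤ g z1 / G z0 * G z := by positivity
        linarith
  obtain ⟨c, hc, hcz⟩ := main
  refine ⟨c, hc, fun a b => ?_⟩
  by_cases hz : ((a, b) : F × F) = 0
  · obtain ⟨rfl, rfl⟩ := Prod.mk_eq_zero.1 hz
    simp [Real.zero_rpow hp0.ne']
  · set t := ‖((a, b) : F × F)‖ with ht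
    have htpos : 0 < t := norm_pos_iff.2 hz
    have h1 := hcz (t⁻¹ • (a, b)) (by
      rw [mem_sphere_zero_iff_norm, norm_smul, norm_inv, ← ht, Real.norm_of_nonneg htpos.le,
        inv_mul_cancel₀ htpos.ne'])
    have e1 : ∀ x : F, ‖t⁻¹ • x‖ ^ p = (t⁻¹) ^ p * ‖x‖ ^ p := by
      intro x
      rw [norm_smul, Real.norm_of_nonneg (by positivity), Real.mul_rpow (by positivity)
        (norm_nonneg _)]
    simp only [g, G, Prod.smul_mk, ← smul_sub, ← smul_add, smul_comm (2⁻¹ : ℝ) t⁻¹, e1] at h1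
    have h2 : 0 < (t⁻¹) ^ p := by positivity
    have h3 : (t⁻¹) ^ p * (‖a - b‖ ^ p) ≤ (t⁻¹) ^ p * (η * (‖a‖ ^ p + ‖b‖ ^ p)
      + c * ((‖a‖ ^ p + ‖b‖ ^ p) / 2 - ‖(2⁻¹ : ℝ) • (a + b)‖ ^ p)) := by
      linarith
    exact le_of_mul_le_mul_left h3 h2

/-- Uniform convexity of `L^p`, `1 < p < ∞`, for sequences: if the norms converge and the norms
of the midpoints do not drop, the sequence is Cauchy. -/
theorem cauchy_of_midpoint_norms [FiniteDimensional ℝ F] {α : Type*} [MeasurableSpace α]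
    {μ : Measure α} {p : ℝ} (hp : 1 < p)
    {f : ℕ → α → F} (hf : ∀ k, MemLp (f k) (ENNReal.ofReal p) μ) {D : ℝ}
    (hD : Tendsto (fun k => ∫ x, ‖f k x‖ ^ p ∂μ) atTop (𝓝 D))
    (hmid : ∀ ε > 0, ∃ N, ∀ m ≥ N, ∀ k ≥ N,
      D - ε ≤ ∫ x, ‖(2⁻¹ : ℝ) • (f m x + f k x)‖ ^ p ∂μ) :
    ∀ ε > 0, ∃ N, ∀ m ≥ N, ∀ k ≥ N, ∫ x, ‖f m x - f k x‖ ^ p ∂μ ≤ ε := by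
  intro ε hε
  have hp0 : 0 < p := by linarith
  have hint : ∀ g : α → F, MemLp g (ENNReal.ofReal p) μ → Integrable (fun x => ‖g x‖ ^ p) μ := by
    intro g hg
    simpa [ENNReal.toReal_ofReal hp0.le] using
      hg.integrable_norm_rpow (by simpa using hp0) ENNReal.ofReal_ne_top
  have hD0 : 0 ≤ D := ge_of_tendsto' hD fun k => integral_nonneg fun x => by positivity
  obtain ⟨c, hc, hcF⟩ := exists_convexity_modulus (F := F) hp
    (η := ε / (4 * (D + 1))) (by positivity)
  set η := ε / (4 * (D + 1)) with hηdef
  have hη : 0 < η := by positivity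
  set ε' := min 1 (ε / (4 * (c + 1))) with hε'
  have hε'0 : 0 < ε' := by positivity
  obtain ⟨N₁, h₁⟩ := hmid ε' hε'0
  obtain ⟨N₂, h₂⟩ := (Metric.tendsto_atTop.1 hD) ε' hε'0
  refine ⟨max N₁ N₂, fun m hm k hk => ?_⟩
  have hm1 := h₂ m (le_of_max_le_right hm)
  have hk1 := h₂ k (le_of_max_le_right hk)
  rw [Real.dist_eq, abs_lt] at hm1 hk1
  have hmk := h₁ m (le_of_max_le_left hm) k (le_of_max_le_left hk)
  have i1 := hint _ (hf m)
  have i2 := hint _ (hf k)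
  have i3 := hint _ (((hf m).add (hf k)).const_smul (2⁻¹ : ℝ))
  have i4 := hint _ ((hf m).sub (hf k))
  simp only [Pi.smul_apply, Pi.add_apply, Pi.sub_apply] at i3 i4
  have key : ∫ x, ‖f m x - f k x‖ ^ p ∂μ ≤
      η * ((∫ x, ‖f m x‖ ^ p ∂μ) + ∫ x, ‖f k x‖ ^ p ∂μ) +
      c * (((∫ x, ‖f m x‖ ^ p ∂μ) + ∫ x, ‖f k x‖ ^ p ∂μ) / 2
        - ∫ x, ‖(2⁻¹ : ℝ) • (f m x + f k x)‖ ^ p ∂μ) := by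
    have j1 : Integrable (fun x => η * (‖f m x‖ ^ p + ‖f k x‖ ^ p)) μ := (i1.add i2).const_mul η
    have j2 : Integrable (fun x => (‖f m x‖ ^ p + ‖f k x‖ ^ p) / 2) μ := (i1.add i2).div_const 2
    have j3 : Integrable (fun x => c * ((‖f m x‖ ^ p + ‖f k x‖ ^ p) / 2
        - ‖(2⁻¹ : ℝ) • (f m x + f k x)‖ ^ p)) μ := (j2.sub i3).const_mul c
    refine (integral_mono i4 (j1.add j3) fun x => hcF (f m x) (f k x)).trans_eq ?_
    simp only [Pi.add_apply]
    rw [integral_add j1 j3, integral_const_mul, integral_const_mul, integral_sub j2 i3,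
      integral_div, integral_add i1 i2]
  have b1 : η * ((∫ x, ‖f m x‖ ^ p ∂μ) + ∫ x, ‖f k x‖ ^ p ∂μ) ≤ ε / 2 := by
    have : (∫ x, ‖f m x‖ ^ p ∂μ) + ∫ x, ‖f k x‖ ^ p ∂μ ≤ 2 * (D + 1) := by
      have := min_le_left 1 (ε / (4 * (c + 1)))
      linarith
    calc _ ≤ η * (2 * (D + 1)) := by gcongr
      _ = ε / 2 := by rw [hηdef]; field_simp; ring
  have b2 : c * (((∫ x, ‖f m x‖ ^ p ∂μ) + ∫ x, ‖f k x‖ ^ p ∂μ) / 2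
        - ∫ x, ‖(2⁻¹ : ℝ) • (f m x + f k x)‖ ^ p ∂μ) ≤ ε / 2 := by
    calc _ ≤ c * (2 * ε') := by
          gcongr
          linarith
      _ ≤ c * (2 * (ε / (4 * (c + 1)))) := by
          gcongr
          exact min_le_right _ _
      _ = (c / (c + 1)) * (ε / 2) := by field_simp; ring
      _ ≤ 1 * (ε / 2) := by
          gcongr
          exact (div_le_one (by positivity)).2 (by linarith)
      _ = ε / 2 := one_mul _
  linarith

end UniformConvexity

/-! ### Test functions -/

/-- The Euclidean space `ℝⁿ`. -/
abbrev Eucl (n : ℕ) := EuclideanSpace ℝ (Fin n)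

section TestFunctions

variable {n : ℕ} {φ ψ : Eucl n → ℝ}

namespace IsTest

theorem differentiableAt (hφ : IsTest φ) (x : Eucl n) : DifferentiableAt ℝ φ x :=
  (hφ.1.differentiable (by simp)) x

theorem continuous (hφ : IsTest φ) : Continuous φ := hφ.1.continuous

theorem continuous_gradient (hφ : IsTest φ) : Continuous (gradient φ) :=
  (InnerProductSpace.toDual ℝ (Eucl n)).symm.continuous.comp (hφ.1.continuous_fderiv (by simp))

theorem hasCompactSupport_gradient (hφ : IsTest φ) : HasCompactSupport (gradient φ) :=
  (hφ.2.fderiv (𝕜 := ℝ)).comp_left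
    (g := (InnerProductSpace.toDual ℝ (Eucl n)).symm) (map_zero _)

theorem memLp (hφ : IsTest φ) (r : ℝ≥0∞) : MemLp φ r :=
  hφ.continuous.memLp_of_hasCompactSupport hφ.2

theorem aestronglyMeasurable (hφ : IsTest φ) : AEStronglyMeasurable φ volume :=
  hφ.continuous.aestronglyMeasurable

theorem memLp_gradient (hφ : IsTest φ) (r : ℝ≥0∞) : MemLp (gradient φ) r :=
  hφ.continuous_gradient.memLp_of_hasCompactSupport hφ.hasCompactSupport_gradient

theorem add (hφ : IsTest φ) (hψ : IsTest ψ) : IsTest (fun x => φ x + ψ x) :=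
  ⟨hφ.1.add hψ.1, hφ.2.add hψ.2⟩

theorem mul_left (hφ : IsTest φ) {η : Eucl n → ℝ} (hη : ContDiff ℝ ∞ η) :
    IsTest (fun x => η x * φ x) :=
  ⟨hη.mul hφ.1, hφ.2.mul_left⟩

theorem const_mul (hφ : IsTest φ) (c : ℝ) : IsTest (fun x => c * φ x) :=
  hφ.mul_left contDiff_const

theorem sub (hφ : IsTest φ) (hψ : IsTest ψ) : IsTest (fun x => φ x - ψ x) := by
  simpa [sub_eq_add_neg] using hφ.add (hψ.const_mul (-1))

theorem comp_affine (hφ : IsTest φ) {b : ℝ} (hb : b ≠ 0) (y : Eucl n) :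
    IsTest (fun x => φ (b • x + y)) :=
  ⟨hφ.1.comp ((contDiff_id.const_smul b).add contDiff_const),
    hφ.2.comp_homeomorph ((Homeomorph.smulOfNeZero b hb).trans (Homeomorph.addRight y))⟩

end IsTest

theorem gradient_fun_add (hφ : IsTest φ) (hψ : IsTest ψ) (x : Eucl n) :
    gradient (fun x => φ x + ψ x) x = gradient φ x + gradient ψ x := by
  simp only [gradient]
  rw [fderiv_fun_add (hφ.differentiableAt x) (hψ.differentiableAt x), map_add]

theorem gradient_mul_of_differentiableAt {η f : Eucl n → ℝ} {x : Eucl n}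
    (hη : DifferentiableAt ℝ η x) (hf : DifferentiableAt ℝ f x) :
    gradient (fun x => η x * f x) x = η x • gradient f x + f x • gradient η x := by
  simp only [gradient]
  rw [fderiv_fun_mul hη hf, map_add, map_smul, map_smul]

theorem gradient_fun_const_mul (hφ : IsTest φ) (c : ℝ) (x : Eucl n) :
    gradient (fun x => c * φ x) x = c • gradient φ x := by
  rw [gradient_mul_of_differentiableAt (differentiableAt_const c) (hφ.differentiableAt x)]
  simp [gradient]

theorem gradient_fun_sub (hφ : IsTest φ) (hψ : IsTest ψ) (x : Eucl n) :
    gradient (fun x => φ x - ψ x) x = gradient φ x - gradient ψ x := by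
  simp only [gradient]
  rw [fderiv_fun_sub (hφ.differentiableAt x) (hψ.differentiableAt x), map_sub]

theorem gradient_comp_affine (hφ : IsTest φ) (b : ℝ) (y x : Eucl n) :
    gradient (fun x => φ (b • x + y)) x = b • gradient φ (b • x + y) := by
  have h : HasFDerivAt (fun x : Eucl n => b • x + y) (b • ContinuousLinearMap.id ℝ (Eucl n)) x :=
    ((hasFDerivAt_id x).const_smul b).add_const y
  have h2 := ((hφ.differentiableAt (b • x + y)).hasFDerivAt).comp x h
  have h3 : fderiv ℝ (fun x => φ (b • x + y)) x = b • fderiv ℝ φ (b • x + y) := by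
    refine h2.fderiv.trans ?_
    ext v
    simp
  simp only [gradient]
  rw [h3, map_smul]

theorem norm_gradient (φ : Eucl n → ℝ) (x : Eucl n) : ‖gradient φ x‖ = ‖fderiv ℝ φ x‖ := by
  simp [gradient]

theorem IsTest.hasWeakGradient (hφ : IsTest φ) : HasWeakGradient φ (gradient φ) := by
  refine ⟨hφ.continuous.locallyIntegrable, hφ.continuous_gradient.locallyIntegrable,
    fun ψ hψ => ?_⟩
  have i1 : Integrable (fun x => ψ x • gradient φ x) :=
    (hψ.continuous.smul hφ.continuous_gradient).integrable_of_hasCompactSupport hψ.2.smul_right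
  have i2 : Integrable (fun x => φ x • gradient ψ x) :=
    (hφ.continuous.smul hψ.continuous_gradient).integrable_of_hasCompactSupport hφ.2.smul_right
  have i3 : Integrable (fun x => ψ x * φ x) :=
    (hψ.continuous.mul hφ.continuous).integrable_of_hasCompactSupport hψ.2.mul_right
  refine ext_inner_right ℝ fun v => ?_
  have j1 : Integrable fun x => ψ x * fderiv ℝ φ x v := by
    simpa [real_inner_smul_left, inner_gradient_left] using i1.inner_const (𝕜 := ℝ) v
  have j2 : Integrable fun x => fderiv ℝ ψ x v * φ x := by
    simpa [real_inner_smul_left, inner_gradient_left, mul_comm] using i2.inner_const (𝕜 := ℝ) v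
  have key := integral_mul_fderiv_eq_neg_fderiv_mul_of_integrable (v := v) j2 j1 i3
    (fun x _ => hψ.differentiableAt x) (fun x _ => hφ.differentiableAt x)
  rw [inner_neg_left, real_inner_comm, real_inner_comm v (∫ x, φ x • gradient ψ x),
    ← integral_inner i1, ← integral_inner i2]
  simpa [inner_smul_right, inner_gradient_right, mul_comm] using key

/-- The Sobolev inequality for test functions. -/
theorem exists_sobolev_const {p : ℝ} (hp : 1 < p) (hpn : p < n) :
    ∃ C : NNReal, ∀ φ : Eucl n → ℝ, IsTest φ →
      eLpNorm φ (ENNReal.ofReal (n * p / (n - p))) volume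
        ≤ C * eLpNorm (gradient φ) (ENNReal.ofReal p) volume := by
  have hp0 : 0 < p := by linarith
  have hn0 : (0 : ℝ) < n := by linarith
  have hnp : 0 < n - p := by linarith
  refine ⟨SNormLESNormFDerivOfEqConst ℝ (volume : Measure (Eucl n)) (p.toNNReal : ℝ),
    fun φ hφ => ?_⟩
  have h := eLpNorm_le_eLpNorm_fderiv_of_eq (E := Eucl n) (μ := volume) (u := φ)
    (hφ.1.of_le (by simp)) hφ.2
    (p := p.toNNReal) (p' := (n * p / (n - p)).toNNReal)
    (by rw [← NNReal.coe_le_coe, Real.coe_toNNReal _ hp0.le]; exact hp.le)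
    (by simpa using hn0) (by
      rw [NNReal.coe_inv, Real.coe_toNNReal _ hp0.le, Real.coe_toNNReal _ (by positivity)]
      simp
      field_simp)
  calc _ ≤ _ := h
    _ = _ := by
      congr 1
      exact eLpNorm_congr_norm_ae (Eventually.of_forall fun x => (norm_gradient φ x).symm)

end TestFunctions

/-! ### The space `D^{p,s}` as a closure -/

section Closure

variable {n : ℕ}

theorem tendsto_integral_smul_of_eLpNorm {F : Type*} [NormedAddCommGroup F] [NormedSpace ℝ F]
    {r : ℝ≥0∞} (hr : 1 ≤ r) {f : ℕ → Eucl n → F} {g : Eucl n → F}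
    (hf : ∀ k, MemLp (f k) r) (hg : MemLp g r)
    (h : Tendsto (fun k => eLpNorm (fun x => f k x - g x) r volume) atTop (𝓝 0))
    {ψ : Eucl n → ℝ} (hψ : Continuous ψ) (hψc : HasCompactSupport ψ) :
    Tendsto (fun k => ∫ x, ψ x • f k x) atTop (𝓝 (∫ x, ψ x • g x)) := by
  have hc : ENNReal.HolderConjugate r (ENNReal.conjExponent r) :=
    ENNReal.HolderConjugate.conjExponent hr
  have hc' := hc.symm
  have hψL : MemLp ψ (ENNReal.conjExponent r) := hψ.memLp_of_hasCompactSupport hψc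
  have hi : ∀ w : Eucl n → F, MemLp w r → Integrable (fun x => ψ x • w x) := fun w hw =>
    memLp_one_iff_integrable.1 (hw.smul hψL)
  refine tendsto_integral_of_L1' _ (hi g hg).1 (Eventually.of_forall fun k => hi _ (hf k)) ?_
  have hub : ∀ k, eLpNorm ((fun x => ψ x • f k x) - fun x => ψ x • g x) 1 volume
      ≤ eLpNorm ψ (ENNReal.conjExponent r) volume * eLpNorm (fun x => f k x - g x) r volume := by
    intro k
    have e : ((fun x => ψ x • f k x) - fun x => ψ x • g x) = ψ • (fun x => f k x - g x) := by
      ext x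
      simp [smul_sub]
    rw [e]
    exact eLpNorm_smul_le_mul_eLpNorm ((hf k).sub hg).1 hψL.1
  refine tendsto_of_tendsto_of_tendsto_of_le_of_le tendsto_const_nhds ?_
    (fun _ => bot_le) hub
  have := ENNReal.Tendsto.const_mul (a := eLpNorm ψ (ENNReal.conjExponent r) volume) h
    (Or.inr hψL.2.ne)
  simpa using this

theorem HasWeakGradient.of_tendsto {p s : ℝ} (hp : 1 ≤ p) (hs : 1 ≤ s)
    {u : Eucl n → ℝ} {V : Eucl n → Eucl n} (hu : MemLp u (ENNReal.ofReal s))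
    (hV : MemLp V (ENNReal.ofReal p)) {φ : ℕ → Eucl n → ℝ} (hφ : ∀ k, IsTest (φ k))
    (hφV : Tendsto (fun k => eLpNorm (fun x => gradient (φ k) x - V x) (ENNReal.ofReal p) volume)
      atTop (𝓝 0))
    (hφu : Tendsto (fun k => eLpNorm (fun x => φ k x - u x) (ENNReal.ofReal s) volume)
      atTop (𝓝 0)) : HasWeakGradient u V := by
  have hp' : 1 ≤ ENNReal.ofReal p := ENNReal.one_le_ofReal.2 hp
  have hs' : 1 ≤ ENNReal.ofReal s := ENNReal.one_le_ofReal.2 hs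
  refine ⟨hu.locallyIntegrable hs', hV.locallyIntegrable hp', fun ψ hψ => ?_⟩
  have l1 := tendsto_integral_smul_of_eLpNorm hp' (fun k => (hφ k).memLp_gradient _) hV hφV
    hψ.continuous hψ.2
  have l2 : Tendsto (fun k => ∫ x, φ k x • gradient ψ x) atTop (𝓝 (∫ x, u x • gradient ψ x)) := by
    have hi : ∀ w : Eucl n → ℝ, MemLp w (ENNReal.ofReal s) →
        Integrable (fun x => w x • gradient ψ x) := fun w hw =>
      (hw.locallyIntegrable hs').integrable_smul_right_of_hasCompactSupport
        hψ.continuous_gradient hψ.hasCompactSupport_gradient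
    have hloc : ∀ v : Eucl n, Tendsto (fun k => ∫ x, inner ℝ v (φ k x • gradient ψ x)) atTop
        (𝓝 (∫ x, inner ℝ v (u x • gradient ψ x))) := by
      intro v
      have h := tendsto_integral_smul_of_eLpNorm hs' (fun k => (hφ k).memLp _) hu hφu
        (ψ := fun x => inner ℝ v (gradient ψ x))
        (continuous_const.inner hψ.continuous_gradient)
        (hψ.hasCompactSupport_gradient.comp_left (g := fun w => inner ℝ v w)
          (inner_zero_right v))
      simpa [inner_smul_right, mul_comm] using h
    have hn : ∀ v : Eucl n, Tendsto (fun k => inner ℝ v (∫ x, φ k x • gradient ψ x)) atTop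
        (𝓝 (inner ℝ v (∫ x, u x • gradient ψ x))) := by
      intro v
      have h := hloc v
      rw [integral_inner (hi u hu)] at h
      refine h.congr fun k => ?_
      rw [integral_inner (hi _ ((hφ k).memLp _))]
    rw [(EuclideanSpace.equiv (Fin n) ℝ).toHomeomorph.isInducing.tendsto_nhds_iff, tendsto_pi_nhds]
    intro i
    simpa [EuclideanSpace.inner_single_left] using hn (EuclideanSpace.single i 1)
  have e : ∀ k, ∫ x, ψ x • gradient (φ k) x = -∫ x, φ k x • gradient ψ x :=
    fun k => (hφ k).hasWeakGradient.2.2 ψ hψ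
  exact tendsto_nhds_unique l1 (l2.neg.congr fun k => (e k).symm)

/-- A limit of test functions in the norm of `D^{p,s}` belongs to `D^{p,s}`, and its weak gradient
is the limit of the gradients. -/
theorem MemD.of_tendsto {p s : ℝ} (hp : 1 ≤ p) (hs : 1 ≤ s)
    {u : Eucl n → ℝ} {V : Eucl n → Eucl n} (hu : MemLp u (ENNReal.ofReal s))
    (hV : MemLp V (ENNReal.ofReal p)) {φ : ℕ → Eucl n → ℝ} (hφ : ∀ k, IsTest (φ k))
    (hφV : Tendsto (fun k => eLpNorm (fun x => gradient (φ k) x - V x) (ENNReal.ofReal p) volume)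
      atTop (𝓝 0))
    (hφu : Tendsto (fun k => eLpNorm (fun x => φ k x - u x) (ENNReal.ofReal s) volume)
      atTop (𝓝 0)) : MemD p s u ∧ weakGrad u =ᵐ[volume] V := by
  have h := HasWeakGradient.of_tendsto hp hs hu hV hφ hφV hφu
  have hVa := h.weakGrad_ae_eq
  refine ⟨⟨hu, ⟨V, h⟩, (memLp_congr_ae hVa).2 hV, φ, hφ, ?_⟩, hVa⟩
  have : ∀ k, eLpNorm (fun x => gradient (φ k) x - weakGrad u x) (ENNReal.ofReal p) volume
      = eLpNorm (fun x => gradient (φ k) x - V x) (ENNReal.ofReal p) volume := fun k =>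
    eLpNorm_congr_ae (by filter_upwards [hVa] with x hx; rw [hx])
  simp_rw [this]
  simpa using hφV.add hφu

theorem MemD.exists_approx {p s : ℝ} {u : Eucl n → ℝ} (hu : MemD p s u) :
    ∃ φ : ℕ → Eucl n → ℝ, (∀ k, IsTest (φ k)) ∧
      Tendsto (fun k => eLpNorm (fun x => gradient (φ k) x - weakGrad u x)
        (ENNReal.ofReal p) volume) atTop (𝓝 0) ∧
      Tendsto (fun k => eLpNorm (fun x => φ k x - u x) (ENNReal.ofReal s) volume)
        atTop (𝓝 0) := by
  obtain ⟨-, -, -, φ, hφ, h⟩ := hu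
  exact ⟨φ, hφ, tendsto_of_tendsto_of_tendsto_of_le_of_le tendsto_const_nhds h
      (fun _ => bot_le) fun k => le_self_add,
    tendsto_of_tendsto_of_tendsto_of_le_of_le tendsto_const_nhds h
      (fun _ => bot_le) fun k => le_add_self⟩

theorem IsTest.memD {p s : ℝ} (hp : 1 ≤ p) (hs : 1 ≤ s) {φ : Eucl n → ℝ} (hφ : IsTest φ) :
    MemD p s φ ∧ weakGrad φ =ᵐ[volume] gradient φ :=
  MemD.of_tendsto hp hs (hφ.memLp _) (hφ.memLp_gradient _) (fun _ : ℕ => hφ) (by simp) (by simp)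

theorem lNorm_congr_ae {F : Type*} [NormedAddCommGroup F] {r : ℝ} {f g : Eucl n → F}
    (h : f =ᵐ[volume] g) : lNorm r f = lNorm r g := by
  rw [lNorm, lNorm, eLpNorm_congr_ae h]

theorem lNorm_nonneg {F : Type*} [NormedAddCommGroup F] {r : ℝ} (f : Eucl n → F) :
    0 ≤ lNorm r f := ENNReal.toReal_nonneg

theorem sharpConst_nonneg {p s q θ : ℝ} : 0 ≤ sharpConst n p s q θ :=
  Real.sInf_nonneg (by
    rintro c ⟨u, -, rfl⟩
    exact div_nonneg (mul_nonneg (Real.rpow_nonneg (lNorm_nonneg _) _)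
      (Real.rpow_nonneg (lNorm_nonneg _) _)) (lNorm_nonneg _))

theorem sharpConst_mul_lNorm_le {p s q θ : ℝ} {u : Eucl n → ℝ} (hu : MemD p s u) :
    sharpConst n p s q θ * lNorm q u ≤ lNorm p (weakGrad u) ^ θ * lNorm s u ^ (1 - θ) := by
  have h0 : 0 ≤ lNorm p (weakGrad u) ^ θ * lNorm s u ^ (1 - θ) :=
    mul_nonneg (Real.rpow_nonneg (lNorm_nonneg _) _) (Real.rpow_nonneg (lNorm_nonneg _) _)
  rcases (lNorm_nonneg (r := q) u).eq_or_lt with hq | hq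
  · rw [← hq, mul_zero]
    exact h0
  · rw [← le_div_iff₀ hq]
    refine csInf_le ⟨0, ?_⟩ ⟨u, ⟨hu, fun h => ?_⟩, rfl⟩
    · rintro c ⟨u, -, rfl⟩
      exact div_nonneg (mul_nonneg (Real.rpow_nonneg (lNorm_nonneg _) _)
        (Real.rpow_nonneg (lNorm_nonneg _) _)) (lNorm_nonneg _)
    · rw [lNorm_congr_ae h, lNorm] at hq
      simp at hq

theorem IsTest.sharpConst_mul_lNorm_le {p s q θ : ℝ} (hp : 1 ≤ p) (hs : 1 ≤ s)
    {φ : Eucl n → ℝ} (hφ : IsTest φ) :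
    sharpConst n p s q θ * lNorm q φ ≤ lNorm p (gradient φ) ^ θ * lNorm s φ ^ (1 - θ) := by
  have h := hφ.memD hp hs
  rw [← lNorm_congr_ae h.2]
  exact GNS.sharpConst_mul_lNorm_le h.1

/-- Approximation in `D^{p,s}` forces, by the Sobolev inequality and interpolation, approximation
in `L^{p*}` and in every intermediate `L^q`. -/
theorem tendsto_eLpNorm_of_approx {p s : ℝ} (hp : 1 < p) (hpn : p < n) (hs : 1 ≤ s)
    {u : Eucl n → ℝ} {V : Eucl n → Eucl n} (hu : MemLp u (ENNReal.ofReal s))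
    (hV : MemLp V (ENNReal.ofReal p)) {φ : ℕ → Eucl n → ℝ} (hφ : ∀ k, IsTest (φ k))
    (hφV : Tendsto (fun k => eLpNorm (fun x => gradient (φ k) x - V x) (ENNReal.ofReal p) volume)
      atTop (𝓝 0))
    (hφu : Tendsto (fun k => eLpNorm (fun x => φ k x - u x) (ENNReal.ofReal s) volume)
      atTop (𝓝 0)) :
    MemLp u (ENNReal.ofReal (n * p / (n - p))) ∧
      Tendsto (fun k => eLpNorm (fun x => φ k x - u x) (ENNReal.ofReal (n * p / (n - p))) volume)
      atTop (𝓝 0) := by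
  obtain ⟨C, hC⟩ := exists_sobolev_const hp hpn
  have hs' : ENNReal.ofReal s ≠ 0 := by simp; linarith
  obtain ⟨σ, hσ, hae⟩ := (tendstoInMeasure_of_tendsto_eLpNorm hs'
    (fun k => (hφ k).aestronglyMeasurable) hu.1 hφu).exists_seq_tendsto_ae
  have hlim := tendsto_eLpNorm_of_cauchy_of_ae (r := ENNReal.ofReal (n * p / (n - p)))
    (fun k => (hφ k).aestronglyMeasurable) hσ.tendsto_atTop hae (by
      intro ε hε
      have h2 : Tendsto (fun k => C * eLpNorm (fun x => gradient (φ k) x - V x)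
          (ENNReal.ofReal p) volume) atTop (𝓝 0) := by
        simpa using ENNReal.Tendsto.const_mul (a := (C : ℝ≥0∞)) hφV (Or.inr (by simp))
      obtain ⟨N, hN⟩ := eventually_atTop.1
        ((ENNReal.tendsto_nhds_zero.1 h2) (ε / 2) (ENNReal.half_pos hε.ne'))
      refine ⟨N, fun k hk l hl => ?_⟩
      have hp' : 1 ≤ ENNReal.ofReal p := ENNReal.one_le_ofReal.2 hp.le
      calc _ ≤ C * eLpNorm (gradient fun x => φ k x - φ l x) (ENNReal.ofReal p) volume :=
            hC _ ((hφ k).sub (hφ l))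
        _ = C * eLpNorm ((fun x => gradient (φ k) x - V x) - fun x => gradient (φ l) x - V x)
              (ENNReal.ofReal p) volume := by
            congr 2
            ext1 x
            rw [gradient_fun_sub (hφ k) (hφ l)]
            simp
        _ ≤ C * (eLpNorm (fun x => gradient (φ k) x - V x) (ENNReal.ofReal p) volume +
              eLpNorm (fun x => gradient (φ l) x - V x) (ENNReal.ofReal p) volume) := by
            gcongr
            exact eLpNorm_sub_le (((hφ k).memLp_gradient _).sub hV).1
              (((hφ l).memLp_gradient _).sub hV).1 hp'
        _ ≤ ε / 2 + ε / 2 := by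
            rw [mul_add]
            exact add_le_add (hN k hk) (hN l hl)
        _ = ε := ENNReal.add_halves ε)
  refine ⟨?_, hlim⟩
  obtain ⟨k, hk⟩ := ((ENNReal.tendsto_nhds_zero.1 hlim) 1 one_pos).exists
  have h3 : MemLp (fun x => φ k x - u x) (ENNReal.ofReal (n * p / (n - p))) :=
    ⟨(hφ k).aestronglyMeasurable.sub hu.1, hk.trans_lt (by simp)⟩
  have h4 := ((hφ k).memLp (ENNReal.ofReal (n * p / (n - p)))).sub h3
  exact (memLp_congr_ae (Eventually.of_forall fun x => by simp)).1 h4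

/-- Interpolation of convergence: convergence in `L^a` and boundedness in `L^b`, in either order of
the exponents, give convergence in every exponent strictly in between. -/
theorem tendsto_eLpNorm_interpolation {α F ι : Type*} [MeasurableSpace α] {μ : Measure α}
    [NormedAddCommGroup F] {l : Filter ι} {a b r t : ℝ} (ha : 0 < a) (hb : 0 < b) (hr : 0 < r)
    (ht0 : 0 ≤ t) (ht1 : t < 1) (h : (1 - t) / a + t / b = 1 / r) {f : ι → α → F}
    (hf : ∀ k, AEStronglyMeasurable (f k) μ)
    (hfa : Tendsto (fun k => eLpNorm (f k) (ENNReal.ofReal a) μ) l (𝓝 0)) {C : ℝ≥0∞}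
    (hC : C ≠ ⊤) (hfb : ∀ᶠ k in l, eLpNorm (f k) (ENNReal.ofReal b) μ ≤ C) :
    Tendsto (fun k => eLpNorm (f k) (ENNReal.ofReal r) μ) l (𝓝 0) := by
  have h1 : Tendsto (fun k => eLpNorm (f k) (ENNReal.ofReal a) μ ^ (1 - t) * C ^ t) l (𝓝 0) := by
    have h2 := (hfa.ennrpow_const (1 - t))
    rw [ENNReal.zero_rpow_of_pos (by linarith)] at h2
    simpa using ENNReal.Tendsto.mul_const h2 (b := C ^ t)
      (Or.inr (ENNReal.rpow_ne_top_of_nonneg ht0 hC))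
  refine tendsto_of_tendsto_of_tendsto_of_le_of_le' tendsto_const_nhds h1
    (Eventually.of_forall fun _ => bot_le) ?_
  filter_upwards [hfb] with k hk
  exact (eLpNorm_interpolation ha hb hr ht0 ht1.le h (hf k)).trans (by gcongr)

/-- Approximation in `D^{p,s}` is approximation in the intermediate `L^q`. -/
theorem tendsto_eLpNorm_intermediate_of_approx {p s q : ℝ} (hp : 1 < p) (hpn : p < n) (hs : 1 ≤ s)
    (hsq : s < q) (hq : q < n * p / (n - p))
    {u : Eucl n → ℝ} {V : Eucl n → Eucl n} (hu : MemLp u (ENNReal.ofReal s))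
    (hV : MemLp V (ENNReal.ofReal p)) {φ : ℕ → Eucl n → ℝ} (hφ : ∀ k, IsTest (φ k))
    (hφV : Tendsto (fun k => eLpNorm (fun x => gradient (φ k) x - V x) (ENNReal.ofReal p) volume)
      atTop (𝓝 0))
    (hφu : Tendsto (fun k => eLpNorm (fun x => φ k x - u x) (ENNReal.ofReal s) volume)
      atTop (𝓝 0)) :
    MemLp u (ENNReal.ofReal q) ∧
      Tendsto (fun k => eLpNorm (fun x => φ k x - u x) (ENNReal.ofReal q) volume)
      atTop (𝓝 0) := by
  obtain ⟨h1, h2⟩ := tendsto_eLpNorm_of_approx hp hpn hs hu hV hφ hφV hφu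
  have hs0 : 0 < s := by linarith
  obtain ⟨t, ht0, ht1, ht⟩ := exists_interpolation_weight hs0 hsq hq
  have hlim := tendsto_eLpNorm_interpolation hs0 (by linarith) (by linarith) ht0.le ht1 ht
    (fun k => (hφ k).aestronglyMeasurable.sub hu.1) hφu ENNReal.one_ne_top
    ((ENNReal.tendsto_nhds_zero.1 h2) 1 one_pos)
  refine ⟨?_, hlim⟩
  refine ⟨hu.1, (eLpNorm_interpolation hs0 (by linarith) (by linarith) ht0.le ht1.le ht
    hu.1).trans_lt ?_⟩
  exact ENNReal.mul_lt_top (ENNReal.rpow_lt_top_of_nonneg (by linarith) hu.2.ne)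
    (ENNReal.rpow_lt_top_of_nonneg (by linarith) h1.2.ne)

end Closure

/-! ### Averages over the cells of a cubic grid -/

section Cells

variable {n : ℕ}

/-- The index of the half-open cube of the grid of mesh `ε` that contains `x`. -/
noncomputable def cellIndex (ε : ℝ) (x : Eucl n) : Fin n → ℤ := fun i => ⌊x i / ε⌋

/-- The half-open cube of side `ε` with index `k`, that is `∏ [ε kᵢ, ε (kᵢ + 1))`. -/
def cell (ε : ℝ) (k : Fin n → ℤ) : Set (Eucl n) := {x | cellIndex ε x = k}

theorem measurable_cellIndex (ε : ℝ) : Measurable (cellIndex (n := n) ε) := by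
  refine measurable_pi_lambda _ fun i => Int.measurable_floor.comp ?_
  exact (Measurable.div_const (by fun_prop) ε)

theorem measurableSet_cell (ε : ℝ) (k : Fin n → ℤ) : MeasurableSet (cell ε k) :=
  measurable_cellIndex ε (measurableSet_singleton k)

theorem mem_cell_iff {ε : ℝ} (hε : 0 < ε) {k : Fin n → ℤ} {x : Eucl n} :
    x ∈ cell ε k ↔ ∀ i, x i ∈ Set.Ico (ε * k i) (ε * (k i + 1)) := by
  simp only [cell, cellIndex, Set.mem_ofPred_eq, funext_iff, Int.floor_eq_iff, Set.mem_Ico,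
    le_div_iff₀ hε, div_lt_iff₀ hε, mul_comm ε]

theorem volume_cell {ε : ℝ} (hε : 0 < ε) (k : Fin n → ℤ) :
    volume (cell ε k) = ENNReal.ofReal (ε ^ n) := by
  have h : cell ε k = (MeasurableEquiv.toLp 2 (Fin n → ℝ)).symm ⁻¹'
      (Set.univ.pi fun i => Set.Ico (ε * k i) (ε * (k i + 1))) := by
    ext x
    rw [mem_cell_iff hε]
    simp
  rw [h, (EuclideanSpace.volume_preserving_symm_measurableEquiv_toLp (Fin n)).measure_preimage
    (MeasurableSet.univ_pi fun i => measurableSet_Ico).nullMeasurableSet, volume_pi_pi]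
  simp [mul_add, ENNReal.ofReal_pow hε.le]

theorem dist_le_of_cellIndex_eq {ε : ℝ} (hε : 0 < ε) {x y : Eucl n}
    (h : cellIndex ε x = cellIndex ε y) : ‖y - x‖ ≤ n * ε := by
  have hx := (mem_cell_iff hε).1 (rfl : x ∈ cell ε (cellIndex ε x))
  have hy := (mem_cell_iff hε).1 (h.symm : y ∈ cell ε (cellIndex ε x))
  have h1 : ∀ i, ‖(y - x) i‖ ^ 2 ≤ ε ^ 2 := by
    intro i
    have := hx i
    have := hy i
    simp only [Set.mem_Ico] at *
    rw [Real.norm_eq_abs, sq_abs]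
    refine sq_le_sq' ?_ ?_ <;> simp only [PiLp.sub_apply] <;> linarith
  rw [EuclideanSpace.norm_eq]
  refine Real.sqrt_le_iff.2 ⟨by positivity, ?_⟩
  calc _ ≤ ∑ _i : Fin n, ε ^ 2 := Finset.sum_le_sum fun i _ => h1 i
    _ = n * ε ^ 2 := by simp
    _ ≤ (n : ℝ) ^ 2 * ε ^ 2 := by
        gcongr
        exact_mod_cast Nat.le_self_pow two_ne_zero n
    _ = _ := by ring

/-- The average of `f` over the cube with index `k`. -/
noncomputable def cellValue (ε : ℝ) (f : Eucl n → ℝ) (k : Fin n → ℤ) : ℝ :=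
  (ε ^ n)⁻¹ * ∫ y in cell ε k, f y

/-- The step function whose value on each cube of the grid is the average of `f`. -/
noncomputable def cellAverage (ε : ℝ) (f : Eucl n → ℝ) (x : Eucl n) : ℝ :=
  cellValue ε f (cellIndex ε x)

theorem measurable_cellAverage (ε : ℝ) (f : Eucl n → ℝ) : Measurable (cellAverage ε f) :=
  (measurable_of_countable _).comp (measurable_cellIndex ε)

/-- Jensen's inequality for the power `r ≥ 1`. -/
theorem lintegral_enorm_rpow_le {α F : Type*} [MeasurableSpace α] {μ : Measure α}
    [IsProbabilityMeasure μ] [NormedAddCommGroup F] {r : ℝ} (hr : 1 ≤ r) {f : α → F}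
    (hf : AEStronglyMeasurable f μ) :
    (∫⁻ x, ‖f x‖ₑ ∂μ) ^ r ≤ ∫⁻ x, ‖f x‖ₑ ^ r ∂μ := by
  have h := eLpNorm_le_eLpNorm_of_exponent_le (ENNReal.one_le_ofReal.2 hr) hf
  rw [eLpNorm_one_eq_lintegral_enorm] at h
  calc _ ≤ eLpNorm f (ENNReal.ofReal r) μ ^ r := by gcongr
    _ = _ := eLpNorm_ofReal_rpow (by linarith) f

/-- Jensen's inequality for the average over a cube. -/
theorem enorm_cellValue_rpow_le {ε : ℝ} (hε : 0 < ε) {r : ℝ} (hr : 1 ≤ r) {f : Eucl n → ℝ}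
    (hf : AEStronglyMeasurable f volume) (k : Fin n → ℤ) :
    ‖cellValue ε f k‖ₑ ^ r ≤ (ENNReal.ofReal (ε ^ n))⁻¹ * ∫⁻ y in cell ε k, ‖f y‖ₑ ^ r := by
  have hv : 0 < ε ^ n := by positivity
  have hP : IsProbabilityMeasure
      ((ENNReal.ofReal (ε ^ n))⁻¹ • (volume : Measure (Eucl n)).restrict (cell ε k)) :=
    ⟨by simp [volume_cell hε, ENNReal.inv_mul_cancel (ENNReal.ofReal_pos.2 hv).ne'
      ENNReal.ofReal_ne_top]⟩
  have h := lintegral_enorm_rpow_le hr (hf.restrict (s := cell ε k) |>.smul_measure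
    (ENNReal.ofReal (ε ^ n))⁻¹)
  rw [lintegral_smul_measure, lintegral_smul_measure] at h
  refine le_trans ?_ h
  gcongr
  rw [cellValue, enorm_mul, Real.enorm_of_nonneg (by positivity), ENNReal.ofReal_inv_of_pos hv,
    smul_eq_mul]
  gcongr
  exact enorm_integral_le_lintegral_enorm _

theorem lintegral_cell_average {ε : ℝ} (hε : 0 < ε) {F : Eucl n → Eucl n → ℝ≥0∞}
    (hF : Measurable (Function.uncurry F)) :
    ∫⁻ x, (ENNReal.ofReal (ε ^ n))⁻¹ * ∫⁻ y in cell ε (cellIndex ε x), F x y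
      = ∫⁻ y, (ENNReal.ofReal (ε ^ n))⁻¹ * ∫⁻ x in cell ε (cellIndex ε y), F x y := by
  have hv : (ENNReal.ofReal (ε ^ n))⁻¹ ≠ ⊤ := by
    have : 0 < ε ^ n := by positivity
    simpa using this
  have hS : MeasurableSet {z : Eucl n × Eucl n | cellIndex ε z.1 = cellIndex ε z.2} :=
    measurableSet_eq_fun ((measurable_cellIndex ε).comp measurable_fst)
      ((measurable_cellIndex ε).comp measurable_snd)
  rw [lintegral_const_mul' _ _ hv, lintegral_const_mul' _ _ hv]
  congr 1
  have e1 : ∀ x, ∫⁻ y in cell ε (cellIndex ε x), F x y = ∫⁻ y,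
      {z : Eucl n × Eucl n | cellIndex ε z.1 = cellIndex ε z.2}.indicator
        (Function.uncurry F) (x, y) := by
    intro x
    rw [← lintegral_indicator (measurableSet_cell _ _)]
    refine lintegral_congr fun y => ?_
    simp [Set.indicator, cell, Function.uncurry, eq_comm]
  have e2 : ∀ y, ∫⁻ x in cell ε (cellIndex ε y), F x y = ∫⁻ x,
      {z : Eucl n × Eucl n | cellIndex ε z.1 = cellIndex ε z.2}.indicator
        (Function.uncurry F) (x, y) := by
    intro y
    rw [← lintegral_indicator (measurableSet_cell _ _)]
    refine lintegral_congr fun x => ?_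
    by_cases h : cellIndex ε x = cellIndex ε y <;>
      simp [Set.indicator, cell, Function.uncurry, h]
  simp_rw [e1, e2]
  exact lintegral_lintegral_swap (hF.indicator hS).aemeasurable

/-- Averaging over the cubes of the grid is a contraction of `L^r`. -/
theorem eLpNorm_cellAverage_le {ε : ℝ} (hε : 0 < ε) {r : ℝ} (hr : 1 ≤ r) {f : Eucl n → ℝ}
    (hf : Continuous f) :
    eLpNorm (cellAverage ε f) (ENNReal.ofReal r) volume
      ≤ eLpNorm f (ENNReal.ofReal r) volume := by
  have hr0 : 0 < r := by linarith
  have hv : 0 < ε ^ n := by positivity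
  rw [← ENNReal.rpow_le_rpow_iff hr0, eLpNorm_ofReal_rpow hr0, eLpNorm_ofReal_rpow hr0]
  calc _ ≤ ∫⁻ x, (ENNReal.ofReal (ε ^ n))⁻¹ * ∫⁻ y in cell ε (cellIndex ε x), ‖f y‖ₑ ^ r :=
        lintegral_mono fun x => enorm_cellValue_rpow_le hε hr hf.aestronglyMeasurable _
    _ = ∫⁻ y, (ENNReal.ofReal (ε ^ n))⁻¹ * ∫⁻ _x in cell ε (cellIndex ε y), ‖f y‖ₑ ^ r :=
        lintegral_cell_average hε (F := fun _ y => ‖f y‖ₑ ^ r)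
          ((hf.measurable.comp measurable_snd).enorm.pow_const r)
    _ = _ := by
        refine lintegral_congr fun y => ?_
        rw [setLIntegral_const, volume_cell hε, mul_comm (‖f y‖ₑ ^ r), ← mul_assoc,
          ENNReal.inv_mul_cancel (by simpa using hv) ENNReal.ofReal_ne_top, one_mul]

/-- Translations move a test function in `L^p` by at most the length of the translation times the
norm of the gradient. -/
theorem lintegral_translate_sub_le {p : ℝ} (hp : 1 ≤ p) {φ : Eucl n → ℝ} (hφ : IsTest φ)
    (h : Eucl n) :
    ∫⁻ x, ‖φ (x + h) - φ x‖ₑ ^ p ≤ ‖h‖ₑ ^ p * ∫⁻ x, ‖gradient φ x‖ₑ ^ p := by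
  have hp0 : 0 < p := by linarith
  have hP : IsProbabilityMeasure ((volume : Measure ℝ).restrict (Set.Ioc 0 1)) := ⟨by simp⟩
  have hcg := hφ.continuous_gradient
  have hpt : ∀ x, ‖φ (x + h) - φ x‖ₑ ^ p ≤
      ∫⁻ t in Set.Ioc (0 : ℝ) 1, ‖h‖ₑ ^ p * ‖gradient φ (x + t • h)‖ₑ ^ p := by
    intro x
    have hc : Continuous fun t : ℝ => inner ℝ (gradient φ (x + t • h)) h := by fun_prop
    have hd : ∀ t ∈ Set.uIcc (0 : ℝ) 1, HasDerivAt (fun t : ℝ => φ (x + t • h))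
        (inner ℝ (gradient φ (x + t • h)) h) t := by
      intro t _
      have h1 : HasDerivAt (fun t : ℝ => x + t • h) h t := by
        simpa using ((hasDerivAt_id t).smul_const h).const_add x
      have h2 := ((hφ.differentiableAt (x + t • h)).hasFDerivAt).comp_hasDerivAt t h1
      rw [inner_gradient_left]
      exact h2
    have hI := intervalIntegral.integral_eq_sub_of_hasDerivAt hd (hc.intervalIntegrable 0 1)
    simp only [one_smul, zero_smul, add_zero] at hI
    rw [← hI, intervalIntegral.integral_of_le zero_le_one]
    calc _ ≤ (∫⁻ t in Set.Ioc (0 : ℝ) 1, ‖inner ℝ (gradient φ (x + t • h)) h‖ₑ) ^ p := by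
          gcongr
          exact enorm_integral_le_lintegral_enorm _
      _ ≤ ∫⁻ t in Set.Ioc (0 : ℝ) 1, ‖inner ℝ (gradient φ (x + t • h)) h‖ₑ ^ p :=
          lintegral_enorm_rpow_le hp hc.aestronglyMeasurable
      _ ≤ _ := by
          refine lintegral_mono fun t => ?_
          rw [← ENNReal.mul_rpow_of_nonneg _ _ hp0.le]
          gcongr
          rw [mul_comm, ← enorm_norm h, ← enorm_norm (gradient φ _), ← enorm_mul,
            enorm_le_iff_norm_le, norm_mul, norm_norm, norm_norm]
          exact norm_inner_le_norm _ _
  calc _ ≤ ∫⁻ x, ∫⁻ t in Set.Ioc (0 : ℝ) 1, ‖h‖ₑ ^ p * ‖gradient φ (x + t • h)‖ₑ ^ p :=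
        lintegral_mono hpt
    _ = ∫⁻ t in Set.Ioc (0 : ℝ) 1, ∫⁻ x, ‖h‖ₑ ^ p * ‖gradient φ (x + t • h)‖ₑ ^ p := by
        refine lintegral_lintegral_swap (Measurable.aemeasurable ?_)
        have : Measurable fun z : Eucl n × ℝ => gradient φ (z.1 + z.2 • h) :=
          (hcg.comp (by fun_prop : Continuous fun z : Eucl n × ℝ => z.1 + z.2 • h)).measurable
        exact (this.enorm.pow_const p).const_mul _
    _ = ∫⁻ _t in Set.Ioc (0 : ℝ) 1, ‖h‖ₑ ^ p * ∫⁻ x, ‖gradient φ x‖ₑ ^ p := by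
        refine lintegral_congr fun t => ?_
        rw [lintegral_const_mul' _ _ (by simp [hp0.le]),
          lintegral_add_right_eq_self (fun x => ‖gradient φ x‖ₑ ^ p)]
    _ = _ := by simp

/-- A Poincaré inequality on the grid: cube averages of mesh `ε` approximate a test function in
`L^p` with error `O(ε ‖∇φ‖_p)`. -/
theorem exists_cellAverage_const (n : ℕ) {p : ℝ} (hp : 1 ≤ p) :
    ∃ C : ℝ≥0∞, C ≠ ⊤ ∧ ∀ ε : ℝ, 0 < ε → ∀ φ : Eucl n → ℝ, IsTest φ →
      eLpNorm (fun x => φ x - cellAverage ε φ x) (ENNReal.ofReal p) volume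
        ≤ C * ENNReal.ofReal ε * eLpNorm (gradient φ) (ENNReal.ofReal p) volume := by
  have hp0 : 0 < p := by linarith
  set B : ℝ≥0∞ := ENNReal.ofReal ((n : ℝ) ^ n) * volume (Metric.ball (0 : Eucl n) 1) with hB
  have hBt : B ≠ ⊤ := ENNReal.mul_ne_top ENNReal.ofReal_ne_top measure_ball_lt_top.ne
  refine ⟨B ^ (1 / p) * n, ENNReal.mul_ne_top (ENNReal.rpow_ne_top_of_nonneg (by positivity) hBt)
    (by simp), fun ε hε φ hφ => ?_⟩
  have hv : 0 < ε ^ n := by positivity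
  have hv0 : ENNReal.ofReal (ε ^ n) ≠ 0 := by simpa using hv
  have hi : ∀ k, IntegrableOn φ (cell ε k) := fun k =>
    (memLp_one_iff_integrable.1 (hφ.memLp 1)).integrableOn
  have hpt : ∀ x, ‖φ x - cellAverage ε φ x‖ₑ ^ p ≤ (ENNReal.ofReal (ε ^ n))⁻¹ *
      ∫⁻ h in Metric.closedBall (0 : Eucl n) (n * ε), ‖φ (x + h) - φ x‖ₑ ^ p := by
    intro x
    have e : φ x - cellAverage ε φ x = cellValue ε (fun y => φ x - φ y) (cellIndex ε x) := by
      rw [cellAverage, cellValue, cellValue, integral_sub _ (hi _)]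
      · rw [setIntegral_const, measureReal_def, volume_cell hε, ENNReal.toReal_ofReal hv.le,
          smul_eq_mul, mul_sub, inv_mul_cancel_left₀ hv.ne']
      · exact integrableOn_const (by simp [volume_cell hε])
    rw [e]
    refine (enorm_cellValue_rpow_le hε hp
      (continuous_const.sub hφ.continuous).aestronglyMeasurable _).trans ?_
    refine mul_le_mul' le_rfl ?_
    rw [← lintegral_indicator (measurableSet_cell _ _),
      ← lintegral_indicator Metric.isClosed_closedBall.measurableSet,
      ← lintegral_add_left_eq_self _ x]
    refine lintegral_mono fun h => ?_
    by_cases hh : x + h ∈ cell ε (cellIndex ε x)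
    · have h1 := dist_le_of_cellIndex_eq hε (x := x) (y := x + h) (Eq.symm hh)
      rw [add_sub_cancel_left] at h1
      rw [Set.indicator_of_mem hh, Set.indicator_of_mem (by simpa using h1), ← enorm_neg]
      simp
    · rw [Set.indicator_of_notMem hh]
      exact bot_le
  rw [← ENNReal.rpow_le_rpow_iff hp0, eLpNorm_ofReal_rpow hp0,
    ENNReal.mul_rpow_of_nonneg _ _ hp0.le, eLpNorm_ofReal_rpow hp0]
  calc _ ≤ ∫⁻ x, (ENNReal.ofReal (ε ^ n))⁻¹ *
      ∫⁻ h in Metric.closedBall (0 : Eucl n) (n * ε), ‖φ (x + h) - φ x‖ₑ ^ p := lintegral_mono hpt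
    _ = (ENNReal.ofReal (ε ^ n))⁻¹ *
      ∫⁻ h in Metric.closedBall (0 : Eucl n) (n * ε), ∫⁻ x, ‖φ (x + h) - φ x‖ₑ ^ p := by
        rw [lintegral_const_mul' _ _ (by simpa using hv), lintegral_lintegral_swap]
        have : Measurable fun z : Eucl n × Eucl n => φ (z.1 + z.2) - φ z.1 :=
          ((hφ.continuous.comp (continuous_fst.add continuous_snd)).sub
            (hφ.continuous.comp continuous_fst)).measurable
        exact (this.enorm.pow_const p).aemeasurable
    _ ≤ (ENNReal.ofReal (ε ^ n))⁻¹ * ∫⁻ _h in Metric.closedBall (0 : Eucl n) (n * ε),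
        ENNReal.ofReal (n * ε) ^ p * ∫⁻ x, ‖gradient φ x‖ₑ ^ p := by
        refine mul_le_mul' le_rfl (setLIntegral_mono measurable_const fun h hh => ?_)
        refine (lintegral_translate_sub_le hp hφ h).trans ?_
        gcongr
        rw [← ofReal_norm]
        exact ENNReal.ofReal_le_ofReal (by simpa using hh)
    _ = B * ENNReal.ofReal (n * ε) ^ p * ∫⁻ x, ‖gradient φ x‖ₑ ^ p := by
        have hne : 0 ≤ (n : ℝ) * ε := by positivity
        rw [setLIntegral_const, Measure.addHaar_closedBall _ _ hne, finrank_euclideanSpace_fin,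
          mul_pow, ENNReal.ofReal_mul (p := (n : ℝ) ^ n) (by positivity), hB]
        have h1 := ENNReal.inv_mul_cancel hv0 ENNReal.ofReal_ne_top
        calc _ = ((ENNReal.ofReal (ε ^ n))⁻¹ * ENNReal.ofReal (ε ^ n)) *
              (ENNReal.ofReal ((n : ℝ) ^ n) * volume (Metric.ball (0 : Eucl n) 1) *
              ENNReal.ofReal (n * ε) ^ p * ∫⁻ x, ‖gradient φ x‖ₑ ^ p) := by ring
          _ = _ := by rw [h1, one_mul]
    _ = _ := by
        rw [ENNReal.mul_rpow_of_nonneg _ _ hp0.le, ENNReal.mul_rpow_of_nonneg _ _ hp0.le,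
          ← ENNReal.rpow_mul, one_div_mul_cancel hp0.ne', ENNReal.rpow_one,
          ENNReal.ofReal_mul (by positivity), ENNReal.ofReal_natCast,
          ENNReal.mul_rpow_of_nonneg _ _ hp0.le]
        ring

end Cells

/-! ### Nonvanishing and local compactness -/

section Compactness

variable {n : ℕ}

/-- A small bound on a function and a bound on its `L^s` norm make its `L^q` norm small, `s < q`. -/
theorem eLpNorm_le_of_bound {α : Type*} [MeasurableSpace α] {μ : Measure α} {s q : ℝ} (hs : 0 < s)
    (hsq : s < q) {f : α → ℝ} (hf : AEStronglyMeasurable f μ) {c : ℝ≥0∞} (hc : ∀ x, ‖f x‖ₑ ≤ c) :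
    eLpNorm f (ENNReal.ofReal q) μ ^ q ≤ c ^ (q - s) * eLpNorm f (ENNReal.ofReal s) μ ^ s := by
  rw [eLpNorm_ofReal_rpow (by linarith), eLpNorm_ofReal_rpow hs,
    ← lintegral_const_mul'' _ (hf.enorm.pow_const s)]
  refine lintegral_mono fun x => ?_
  calc ‖f x‖ₑ ^ q = ‖f x‖ₑ ^ (q - s) * ‖f x‖ₑ ^ s := by
        rw [← ENNReal.rpow_add_of_nonneg _ _ (by linarith) hs.le, sub_add_cancel]
    _ ≤ _ := by
        gcongr
        exact hc x

/-- Vanishing: if all averages over the cubes of finer and finer grids tend to `0`, the `L^q` norms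
tend to `0`. -/
theorem tendsto_eLpNorm_of_cellValue_tendsto {p s q : ℝ} (hp : 1 < p) (hpn : p < n) (hs : 1 ≤ s)
    (hsq : s < q) (hq : q < n * p / (n - p)) {M : ℝ≥0∞} (hM : M ≠ ⊤) {φ : ℕ → Eucl n → ℝ}
    (hφ : ∀ m, IsTest (φ m))
    (hA : ∀ m, eLpNorm (gradient (φ m)) (ENNReal.ofReal p) volume ≤ M)
    (hS : ∀ m, eLpNorm (φ m) (ENNReal.ofReal s) volume ≤ M)
    (hc : ∀ m : ℕ, ∀ k, |cellValue (1 / ((m : ℝ) + 1)) (φ m) k| ≤ 1 / ((m : ℝ) + 1)) :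
    Tendsto (fun m => eLpNorm (φ m) (ENNReal.ofReal q) volume) atTop (𝓝 0) := by
  obtain ⟨K, hK, hKφ⟩ := exists_cellAverage_const n hp.le
  obtain ⟨C, hC⟩ := exists_sobolev_const hp hpn
  have hp0 : 0 < p := by linarith
  have hs0 : 0 < s := by linarith
  have hq0 : 0 < q := by linarith
  have hnp : 0 < (n : ℝ) - p := by linarith
  have hps : p < n * p / (n - p) := by
    rw [lt_div_iff₀ hnp]
    nlinarith
  have hε : ∀ m : ℕ, 0 < 1 / ((m : ℝ) + 1) := fun m => by positivity
  have hε0 : Tendsto (fun m : ℕ => ENNReal.ofReal (1 / ((m : ℝ) + 1))) atTop (𝓝 0) := by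
    have := ENNReal.tendsto_ofReal (tendsto_one_div_add_atTop_nhds_zero_nat (𝕜 := ℝ))
    simpa using this
  set f : ℕ → Eucl n → ℝ := fun m x => φ m x - cellAverage (1 / ((m : ℝ) + 1)) (φ m) x with hf
  set g : ℕ → Eucl n → ℝ := fun m => cellAverage (1 / ((m : ℝ) + 1)) (φ m) with hg
  have hgm : ∀ m, AEStronglyMeasurable (g m) volume := fun m =>
    (measurable_cellAverage _ _).aestronglyMeasurable
  have hfm : ∀ m, AEStronglyMeasurable (f m) volume := fun m =>
    (hφ m).aestronglyMeasurable.sub (hgm m)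
  have hfr : ∀ r : ℝ, 1 ≤ r → ∀ m, eLpNorm (f m) (ENNReal.ofReal r) volume ≤
      2 * eLpNorm (φ m) (ENNReal.ofReal r) volume := by
    intro r hr m
    refine (eLpNorm_sub_le (hφ m).aestronglyMeasurable (hgm m)
      (ENNReal.one_le_ofReal.2 hr)).trans ?_
    rw [two_mul]
    gcongr
    exact eLpNorm_cellAverage_le (hε m) hr (hφ m).continuous
  have hfp : Tendsto (fun m => eLpNorm (f m) (ENNReal.ofReal p) volume) atTop (𝓝 0) := by
    have h1 : Tendsto (fun m : ℕ => K * ENNReal.ofReal (1 / ((m : ℝ) + 1)) * M) atTop (𝓝 0) := by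
      have h2 := ENNReal.Tendsto.mul_const (b := M)
        (ENNReal.Tendsto.const_mul (a := K) hε0 (Or.inr hK)) (Or.inr hM)
      simpa using h2
    refine tendsto_of_tendsto_of_tendsto_of_le_of_le tendsto_const_nhds h1
      (fun _ => bot_le) fun m => ?_
    exact (hKφ _ (hε m) _ (hφ m)).trans (by gcongr; exact hA m)
  have hfs : ∀ m, eLpNorm (f m) (ENNReal.ofReal s) volume ≤ 2 * M := fun m =>
    (hfr s hs m).trans (by gcongr; exact hS m)
  have hfps : ∀ m, eLpNorm (f m) (ENNReal.ofReal (n * p / (n - p))) volume ≤ 2 * (C * M) :=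
    fun m => (hfr _ (by linarith) m).trans (by
      gcongr
      exact (hC _ (hφ m)).trans (by gcongr; exact hA m))
  have h2M : 2 * M ≠ ⊤ := ENNReal.mul_ne_top (by simp) hM
  have h2CM : 2 * (C * M) ≠ ⊤ := ENNReal.mul_ne_top (by simp) (ENNReal.mul_ne_top (by simp) hM)
  have hfq : Tendsto (fun m => eLpNorm (f m) (ENNReal.ofReal q) volume) atTop (𝓝 0) := by
    rcases lt_trichotomy q p with h | h | h
    · obtain ⟨t, ht0, ht1, ht⟩ := exists_interpolation_weight hs0 hsq h
      exact tendsto_eLpNorm_interpolation hp0 hs0 hq0 (t := 1 - t) (by linarith) (by linarith)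
        (by rw [← ht]; ring) hfm hfp h2M (Eventually.of_forall hfs)
    · rwa [h]
    · obtain ⟨t, ht0, ht1, ht⟩ := exists_interpolation_weight hp0 h hq
      exact tendsto_eLpNorm_interpolation hp0 (by linarith) hq0 ht0.le ht1
        ht hfm hfp h2CM (Eventually.of_forall hfps)
  have hgq : Tendsto (fun m => eLpNorm (g m) (ENNReal.ofReal q) volume) atTop (𝓝 0) := by
    have h1 : Tendsto (fun m : ℕ => (ENNReal.ofReal (1 / ((m : ℝ) + 1)) ^ (q - s) * M ^ s) ^ (1 / q))
        atTop (𝓝 0) := by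
      have h2 := hε0.ennrpow_const (q - s)
      rw [ENNReal.zero_rpow_of_pos (by linarith)] at h2
      have h3 := (ENNReal.Tendsto.mul_const (b := M ^ s) h2
        (Or.inr (ENNReal.rpow_ne_top_of_nonneg hs0.le hM))).ennrpow_const (1 / q)
      rwa [zero_mul, ENNReal.zero_rpow_of_pos (by positivity)] at h3
    refine tendsto_of_tendsto_of_tendsto_of_le_of_le tendsto_const_nhds h1
      (fun _ => bot_le) fun m => ?_
    rw [one_div q, ENNReal.le_rpow_inv_iff hq0]
    refine (eLpNorm_le_of_bound hs0 hsq (hgm m) (c := ENNReal.ofReal (1 / ((m : ℝ) + 1)))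
      fun x => ?_).trans ?_
    · rw [← ofReal_norm]
      exact ENNReal.ofReal_le_ofReal (hc m _)
    · gcongr
      exact (eLpNorm_cellAverage_le (hε m) hs (hφ m).continuous).trans (hS m)
  have hsum := hfq.add hgq
  rw [add_zero] at hsum
  refine tendsto_of_tendsto_of_tendsto_of_le_of_le tendsto_const_nhds hsum
    (fun _ => bot_le) fun m => ?_
  have e : φ m = f m + g m := by
    ext x
    simp [hf, hg]
  calc eLpNorm (φ m) (ENNReal.ofReal q) volume = eLpNorm (f m + g m) (ENNReal.ofReal q) volume := by
        rw [← e]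
    _ ≤ _ := eLpNorm_add_le (hfm m) (hgm m) (ENNReal.one_le_ofReal.2 (by linarith))

/-- Nonvanishing: test functions with bounded norms and with `‖φ‖_q = 1` have a substantial average
over some cube, of a fixed size. -/
theorem exists_cellValue_ge {p s q : ℝ} (hp : 1 < p) (hpn : p < n) (hs : 1 ≤ s)
    (hsq : s < q) (hq : q < n * p / (n - p)) {M : ℝ≥0∞} (hM : M ≠ ⊤) :
    ∃ ε : ℝ, 0 < ε ∧ ∃ c : ℝ, 0 < c ∧ ∀ φ : Eucl n → ℝ, IsTest φ →
      eLpNorm (gradient φ) (ENNReal.ofReal p) volume ≤ M →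
      eLpNorm φ (ENNReal.ofReal s) volume ≤ M → eLpNorm φ (ENNReal.ofReal q) volume = 1 →
      ∃ k, c ≤ |cellValue ε φ k| := by
  by_contra! H
  have hε : ∀ m : ℕ, 0 < 1 / ((m : ℝ) + 1) := fun m => by positivity
  choose φ hφ hA hS hQ hc using fun m : ℕ => H _ (hε m) _ (hε m)
  have h := tendsto_eLpNorm_of_cellValue_tendsto hp hpn hs hsq hq hM hφ hA hS
    fun m k => (hc m k).le
  simp only [hQ] at h
  exact zero_ne_one (tendsto_nhds_unique h tendsto_const_nhds)

/-- A bounded family of grid averages has a subsequence along which all of them converge. -/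
theorem exists_subseq_cellValue_tendsto {s : ℝ} (hs : 1 ≤ s) {M : ℝ≥0∞} (hM : M ≠ ⊤)
    {φ : ℕ → Eucl n → ℝ} (hφ : ∀ m, IsTest (φ m))
    (hS : ∀ m, eLpNorm (φ m) (ENNReal.ofReal s) volume ≤ M) :
    ∃ (a : ℕ → (Fin n → ℤ) → ℝ) (b : ℕ → ℝ) (σ : ℕ → ℕ), StrictMono σ ∧
      (∀ (m : ℕ) k j, |cellValue (1 / ((m : ℝ) + 1)) (φ j) k| ≤ b m) ∧
      ∀ (m : ℕ) k, Tendsto (fun j => cellValue (1 / ((m : ℝ) + 1)) (φ (σ j)) k) atTop (𝓝 (a m k)) := by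
  have hs0 : 0 < s := by linarith
  have hε : ∀ m : ℕ, 0 < 1 / ((m : ℝ) + 1) := fun m => by positivity
  set B : ℕ → ℝ≥0∞ := fun m => ((ENNReal.ofReal ((1 / ((m : ℝ) + 1)) ^ n))⁻¹ * M ^ s) ^ (1 / s)
    with hB
  have hBt : ∀ m, B m ≠ ⊤ := by
    intro m
    refine ENNReal.rpow_ne_top_of_nonneg (by positivity) (ENNReal.mul_ne_top ?_
      (ENNReal.rpow_ne_top_of_nonneg hs0.le hM))
    have : 0 < (1 / ((m : ℝ) + 1)) ^ n := pow_pos (hε m) n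
    exact ENNReal.inv_ne_top.2 (ENNReal.ofReal_pos.2 this).ne'
  have hb : ∀ (m : ℕ) k j, |cellValue (1 / ((m : ℝ) + 1)) (φ j) k| ≤ (B m).toReal := by
    intro m k j
    rw [← Real.norm_eq_abs, ← toReal_enorm]
    refine ENNReal.toReal_mono (hBt m) ?_
    simp only [hB]
    rw [one_div s, ENNReal.le_rpow_inv_iff hs0]
    refine (enorm_cellValue_rpow_le (hε m) hs (hφ j).aestronglyMeasurable k).trans ?_
    gcongr
    calc _ ≤ ∫⁻ y, ‖φ j y‖ₑ ^ s := setLIntegral_le_lintegral _ _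
      _ = eLpNorm (φ j) (ENNReal.ofReal s) volume ^ s := (eLpNorm_ofReal_rpow hs0 _).symm
      _ ≤ M ^ s := by
        gcongr
        exact hS j
  have hK : IsCompact (Set.univ.pi fun i : ℕ × (Fin n → ℤ) =>
      Set.Icc (-(B i.1).toReal) (B i.1).toReal) :=
    isCompact_univ_pi fun _ => isCompact_Icc
  obtain ⟨a, -, σ, hσ, hlim⟩ := hK.tendsto_subseq
    (x := fun j i => cellValue (1 / ((i.1 : ℝ) + 1)) (φ j) i.2)
    fun j i _ => abs_le.1 (hb i.1 i.2 j)
  rw [tendsto_pi_nhds] at hlim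
  exact ⟨fun m k => a (m, k), fun m => (B m).toReal, σ, hσ, hb, fun m k => hlim (m, k)⟩

/-- A Rellich theorem: test functions bounded in `L^s`, with gradients bounded in `L^p`, have a
subsequence that converges almost everywhere and in `L^p` on every ball. -/
theorem exists_subseq_tendsto_local {p s : ℝ} (hp : 1 ≤ p) (hs : 1 ≤ s) {M : ℝ≥0∞} (hM : M ≠ ⊤)
    {φ : ℕ → Eucl n → ℝ} (hφ : ∀ m, IsTest (φ m))
    (hA : ∀ m, eLpNorm (gradient (φ m)) (ENNReal.ofReal p) volume ≤ M)
    (hS : ∀ m, eLpNorm (φ m) (ENNReal.ofReal s) volume ≤ M) :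
    ∃ (u : Eucl n → ℝ) (σ : ℕ → ℕ), Measurable u ∧ StrictMono σ ∧
      (∀ᵐ x, Tendsto (fun j => φ (σ j) x) atTop (𝓝 (u x))) ∧
      ∀ R : ℕ, Tendsto (fun j => eLpNorm (fun x => φ (σ j) x - u x) (ENNReal.ofReal p)
        (volume.restrict (Metric.closedBall 0 R))) atTop (𝓝 0) := by
  obtain ⟨K, hK, hKφ⟩ := exists_cellAverage_const n hp
  obtain ⟨a, b, σ, hσ, hb, ha⟩ := exists_subseq_cellValue_tendsto hs hM hφ hS
  have hp0 : 0 < p := by linarith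
  have hp1 : 1 ≤ ENNReal.ofReal p := ENNReal.one_le_ofReal.2 hp
  have hε : ∀ m : ℕ, 0 < 1 / ((m : ℝ) + 1) := fun m => by positivity
  have hε0 : Tendsto (fun m : ℕ => K * ENNReal.ofReal (1 / ((m : ℝ) + 1)) * M) atTop (𝓝 0) := by
    have h1 := ENNReal.tendsto_ofReal (tendsto_one_div_add_atTop_nhds_zero_nat (𝕜 := ℝ))
    rw [ENNReal.ofReal_zero] at h1
    have h2 := ENNReal.Tendsto.mul_const (b := M)
      (ENNReal.Tendsto.const_mul (a := K) h1 (Or.inr hK)) (Or.inr hM)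
    simpa using h2
  -- the step functions of mesh `1 / (m + 1)` converge on balls, by dominated convergence
  have hstep : ∀ m R : ℕ, Tendsto (fun j => eLpNorm (fun x =>
      cellAverage (1 / ((m : ℝ) + 1)) (φ (σ j)) x - a m (cellIndex (1 / ((m : ℝ) + 1)) x))
      (ENNReal.ofReal p) (volume.restrict (Metric.closedBall 0 R))) atTop (𝓝 0) := by
    intro m R
    have hmeas : ∀ j, Measurable fun x =>
        cellAverage (1 / ((m : ℝ) + 1)) (φ (σ j)) x - a m (cellIndex (1 / ((m : ℝ) + 1)) x) :=
      fun j => (measurable_cellAverage _ _).sub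
        ((measurable_of_countable (a m)).comp (measurable_cellIndex _))
    have hab : ∀ k, |a m k| ≤ b m := fun k =>
      le_of_tendsto (ha m k).abs (Eventually.of_forall fun j => hb m k _)
    have h1 : Tendsto (fun j => ∫⁻ x in Metric.closedBall (0 : Eucl n) R,
        ‖cellAverage (1 / ((m : ℝ) + 1)) (φ (σ j)) x - a m (cellIndex (1 / ((m : ℝ) + 1)) x)‖ₑ ^ p)
        atTop (𝓝 (∫⁻ x in Metric.closedBall (0 : Eucl n) R, 0)) := by
      refine tendsto_lintegral_of_dominated_convergence
        (fun _ => ENNReal.ofReal (2 * b m) ^ p) (fun j => ((hmeas j).enorm.pow_const p))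
        (fun j => Eventually.of_forall fun x => ?_) ?_ (Eventually.of_forall fun x => ?_)
      · dsimp only
        gcongr
        rw [← ofReal_norm]
        refine ENNReal.ofReal_le_ofReal ((norm_sub_le _ _).trans ?_)
        rw [two_mul]
        exact add_le_add (hb m _ _) (hab _)
      · rw [setLIntegral_const]
        exact ENNReal.mul_ne_top (ENNReal.rpow_ne_top_of_nonneg hp0.le ENNReal.ofReal_ne_top)
          measure_closedBall_lt_top.ne
      · have h2 := ((ha m (cellIndex (1 / ((m : ℝ) + 1)) x)).sub_const
          (a m (cellIndex (1 / ((m : ℝ) + 1)) x))).enorm.ennrpow_const p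
        simpa [cellAverage, ENNReal.zero_rpow_of_pos hp0] using h2
    have h3 := h1.ennrpow_const (1 / p)
    simp only [lintegral_zero] at h3
    rw [ENNReal.zero_rpow_of_pos (by positivity)] at h3
    exact h3.congr fun j => (eLpNorm_ofReal_eq hp0 _).symm
  -- hence the sequence is Cauchy on balls
  have hcauchy : ∀ R : ℕ, ∀ δ : ℝ≥0∞, 0 < δ → ∃ N, ∀ k ≥ N, ∀ l ≥ N,
      eLpNorm (fun x => φ (σ k) x - φ (σ l) x) (ENNReal.ofReal p)
        (volume.restrict (Metric.closedBall 0 R)) ≤ δ := by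
    intro R δ hδ
    have hδ4 : 0 < δ / 4 := ENNReal.div_pos hδ.ne' (by simp)
    obtain ⟨m, hm⟩ := ((ENNReal.tendsto_nhds_zero.1 hε0) (δ / 4) hδ4).exists
    obtain ⟨N, hN⟩ := eventually_atTop.1 ((ENNReal.tendsto_nhds_zero.1 (hstep m R)) (δ / 4) hδ4)
    have hone : ∀ k ≥ N, eLpNorm (fun x => φ (σ k) x - a m (cellIndex (1 / ((m : ℝ) + 1)) x))
        (ENNReal.ofReal p) (volume.restrict (Metric.closedBall 0 R)) ≤ δ / 4 + δ / 4 := by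
      intro k hk
      have e : (fun x => φ (σ k) x - a m (cellIndex (1 / ((m : ℝ) + 1)) x)) =
          (fun x => φ (σ k) x - cellAverage (1 / ((m : ℝ) + 1)) (φ (σ k)) x) +
          fun x => cellAverage (1 / ((m : ℝ) + 1)) (φ (σ k)) x
            - a m (cellIndex (1 / ((m : ℝ) + 1)) x) := by
        ext x
        simp
      rw [e]
      refine (eLpNorm_add_le ((hφ _).continuous.measurable.sub
        (measurable_cellAverage _ _)).aestronglyMeasurable
        ((measurable_cellAverage _ _).sub ((measurable_of_countable (a m)).comp
          (measurable_cellIndex _))).aestronglyMeasurable hp1).trans (add_le_add ?_ (hN k hk))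
      refine (eLpNorm_mono_measure _ Measure.restrict_le_self).trans ?_
      refine (hKφ _ (hε m) _ (hφ _)).trans (le_trans ?_ hm)
      gcongr
      exact hA _
    refine ⟨N, fun k hk l hl => ?_⟩
    have e : (fun x => φ (σ k) x - φ (σ l) x) =
        (fun x => φ (σ k) x - a m (cellIndex (1 / ((m : ℝ) + 1)) x)) -
        fun x => φ (σ l) x - a m (cellIndex (1 / ((m : ℝ) + 1)) x) := by
      ext x
      simp
    have hmeas : ∀ k, AEStronglyMeasurable
        (fun x => φ (σ k) x - a m (cellIndex (1 / ((m : ℝ) + 1)) x))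
        (volume.restrict (Metric.closedBall 0 R)) := fun k =>
      ((hφ _).continuous.measurable.sub ((measurable_of_countable (a m)).comp
          (measurable_cellIndex _))).aestronglyMeasurable
    rw [e]
    refine (eLpNorm_sub_le (hmeas k) (hmeas l) hp1).trans
      ((add_le_add (hone k hk) (hone l hl)).trans_eq ?_)
    rw [← two_mul, ← two_mul, ← mul_assoc]
    norm_num
    exact ENNReal.mul_div_cancel (by simp) (by simp)
  -- a further subsequence converges so fast on larger and larger balls that it converges a.e.
  have hfast : ∀ j : ℕ, ∀ᶠ N in atTop, ∀ k ≥ N, ∀ l ≥ N,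
      eLpNorm (fun x => φ (σ k) x - φ (σ l) x) (ENNReal.ofReal p)
        (volume.restrict (Metric.closedBall 0 j)) ≤ (2⁻¹ : ℝ≥0∞) ^ (j + 1) := by
    intro j
    obtain ⟨N, hN⟩ := hcauchy j ((2⁻¹ : ℝ≥0∞) ^ (j + 1)) (by
      exact ENNReal.pow_pos (by simp) _)
    filter_upwards [eventually_ge_atTop N] with N' hN' k hk l hl using
      hN k (hN'.trans hk) l (hN'.trans hl)
  obtain ⟨τ, hτ, hτf⟩ := extraction_forall_of_eventually hfast
  have hae : ∀ R : ℕ, ∀ᵐ x ∂(volume.restrict (Metric.closedBall (0 : Eucl n) R)),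
      ∃ l : ℝ, Tendsto (fun j => φ (σ (τ j)) x) atTop (𝓝 l) := by
    intro R
    have h := Lp.ae_tendsto_of_cauchy_eLpNorm (μ := volume.restrict (Metric.closedBall (0 : Eucl n) R))
      (f := fun j => φ (σ (τ (j + R)))) (B := fun j => (2⁻¹ : ℝ≥0∞) ^ j)
      (fun j => (hφ _).continuous.aestronglyMeasurable) hp1
      (by simp [ENNReal.tsum_geometric]) (by
        intro N k l hk hl
        refine lt_of_le_of_lt ?_ (b := (2⁻¹ : ℝ≥0∞) ^ (N + R + 1)) ?_
        · refine (eLpNorm_mono_measure _ (Measure.restrict_mono (Metric.closedBall_subset_closedBall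
            (by simp : (R : ℝ) ≤ ((N + R : ℕ) : ℝ))) le_rfl)).trans
            (hτf (N + R) _ (hτ.monotone (by omega)) _ (hτ.monotone (by omega)))
        · rw [← ENNReal.inv_pow, ← ENNReal.inv_pow, ENNReal.inv_lt_inv]
          exact_mod_cast Nat.pow_lt_pow_right (by norm_num) (by omega : N < N + R + 1))
    filter_upwards [h] with x hx
    obtain ⟨l, hl⟩ := hx
    exact ⟨l, (tendsto_add_atTop_iff_nat (f := fun j => φ (σ (τ j)) x) R).1 hl⟩
  have hae' : ∀ᵐ x : Eucl n, ∃ l : ℝ, Tendsto (fun j => φ (σ (τ j)) x) atTop (𝓝 l) := by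
    have h := (ae_restrict_iUnion_iff (fun R : ℕ => Metric.closedBall (0 : Eucl n) R) _).2 hae
    rwa [Metric.iUnion_closedBall_nat, Measure.restrict_univ] at h
  obtain ⟨u, hu, hulim⟩ := measurable_limit_of_tendsto_metrizable_ae
    (fun j => (hφ (σ (τ j))).continuous.aemeasurable) hae'
  refine ⟨u, σ ∘ τ, hu, hσ.comp hτ, hulim, fun R => ?_⟩
  refine tendsto_eLpNorm_of_cauchy_of_ae (f := fun j => φ (σ (τ j))) (σ := id)
    (fun j => (hφ _).continuous.aestronglyMeasurable) tendsto_id (ae_restrict_of_ae hulim) ?_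
  intro δ hδ
  obtain ⟨N, hN⟩ := hcauchy R δ hδ
  exact ⟨N, fun k hk l hl => hN _ (hk.trans (hτ.id_le k)) _ (hl.trans (hτ.id_le l))⟩

end Compactness

/-! ### Cutoffs and tails -/

section Cutoffs

variable {n : ℕ}

/-- A smooth function with values in `[0, 1]`, equal to `1` on the ball of radius `R` and to `0`
outside the ball of radius `2R`; all of them are dilations of the same function. -/
noncomputable def cutoff (R : ℝ) (x : Eucl n) : ℝ :=
  (⟨1, 2, one_pos, one_lt_two⟩ : ContDiffBump (0 : Eucl n)) (R⁻¹ • x + 0)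

theorem isTest_bump : IsTest (⟨1, 2, one_pos, one_lt_two⟩ : ContDiffBump (0 : Eucl n)) :=
  ⟨ContDiffBump.contDiff _, ContDiffBump.hasCompactSupport _⟩

theorem isTest_cutoff {R : ℝ} (hR : 0 < R) : IsTest (cutoff (n := n) R) :=
  isTest_bump.comp_affine (inv_pos.2 hR).ne' 0

theorem cutoff_nonneg (R : ℝ) (x : Eucl n) : 0 ≤ cutoff R x := ContDiffBump.nonneg _

theorem cutoff_le_one (R : ℝ) (x : Eucl n) : cutoff R x ≤ 1 := ContDiffBump.le_one _

theorem cutoff_eq_one {R : ℝ} (hR : 0 < R) {x : Eucl n} (hx : ‖x‖ ≤ R) : cutoff R x = 1 := by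
  refine ContDiffBump.one_of_mem_closedBall _ ?_
  rw [mem_closedBall_zero_iff, add_zero, norm_smul, Real.norm_of_nonneg (by positivity),
    inv_mul_le_iff₀ hR]
  simpa using hx

theorem cutoff_eq_zero {R : ℝ} (hR : 0 < R) {x : Eucl n} (hx : 2 * R ≤ ‖x‖) : cutoff R x = 0 := by
  refine ContDiffBump.zero_of_le_dist _ ?_
  rw [dist_zero_right, add_zero, norm_smul, Real.norm_of_nonneg (by positivity),
    le_inv_mul_iff₀ hR, mul_comm]
  exact hx

theorem gradient_cutoff_eq_zero {R : ℝ} (hR : 0 < R) {x : Eucl n} (hx : ‖x‖ < R ∨ 2 * R < ‖x‖) :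
    gradient (cutoff R) x = 0 := by
  rcases hx with hx | hx
  · have : cutoff R =ᶠ[𝓝 x] fun _ => (1 : ℝ) := by
      filter_upwards [(isOpen_lt continuous_norm continuous_const).mem_nhds hx] with y hy
      exact cutoff_eq_one hR (le_of_lt hy)
    rw [this.gradient_eq, gradient_fun_const]
  · have : cutoff R =ᶠ[𝓝 x] fun _ => (0 : ℝ) := by
      filter_upwards [(isOpen_lt continuous_const continuous_norm).mem_nhds hx] with y hy
      exact cutoff_eq_zero hR (le_of_lt hy)
    rw [this.gradient_eq, gradient_fun_const]

theorem exists_gradient_cutoff_bound (n : ℕ) :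
    ∃ M : ℝ, 0 ≤ M ∧ ∀ R : ℝ, 0 < R → ∀ x : Eucl n, ‖gradient (cutoff R) x‖ ≤ M / R := by
  have hb := isTest_bump (n := n)
  obtain ⟨M, hM⟩ := hb.continuous_gradient.bounded_above_of_compact_support
    hb.hasCompactSupport_gradient
  refine ⟨M, (norm_nonneg _).trans (hM 0), fun R hR x => ?_⟩
  have : gradient (cutoff R) x = _ := gradient_comp_affine hb R⁻¹ 0 x
  rw [this, norm_smul, Real.norm_of_nonneg (by positivity), div_eq_inv_mul]
  gcongr
  exact hM _

/-- The closed annulus of radii `R` and `2R`, which carries the gradient of `cutoff R`. -/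
def annulus (n : ℕ) (R : ℝ) : Set (Eucl n) := {x | R ≤ ‖x‖ ∧ ‖x‖ ≤ 2 * R}

/-- The complement of the open ball of radius `R`. -/
def tailSet (n : ℕ) (R : ℝ) : Set (Eucl n) := {x | R ≤ ‖x‖}

theorem measurableSet_annulus (R : ℝ) : MeasurableSet (annulus n R) :=
  (measurableSet_le measurable_const measurable_norm).inter
    (measurableSet_le measurable_norm measurable_const)

theorem measurableSet_tailSet (R : ℝ) : MeasurableSet (tailSet n R) :=
  measurableSet_le measurable_const measurable_norm

theorem annulus_subset_tailSet (R : ℝ) : annulus n R ⊆ tailSet n R := fun _ hx => hx.1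

theorem annulus_subset_closedBall (R : ℝ) :
    annulus n R ⊆ Metric.closedBall 0 (2 * R) := fun x hx => by
  simpa using hx.2

theorem eLpNorm_restrict_mono {F : Type*} [NormedAddCommGroup F] {S T : Set (Eucl n)} (h : S ⊆ T)
    (f : Eucl n → F) (r : ℝ≥0∞) :
    eLpNorm f r (volume.restrict S) ≤ eLpNorm f r (volume.restrict T) :=
  eLpNorm_mono_measure _ (Measure.restrict_mono h le_rfl)

/-- Multiplication by the gradient of a cutoff is controlled on the annulus. -/
theorem exists_eLpNorm_smul_gradient_cutoff_le (n : ℕ) :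
    ∃ M : ℝ, 0 ≤ M ∧ ∀ R : ℝ, 0 < R → ∀ (r : ℝ≥0∞) (w : Eucl n → ℝ),
      eLpNorm (fun x => w x • gradient (cutoff R) x) r volume ≤
        ENNReal.ofReal (M / R) * eLpNorm w r (volume.restrict (annulus n R)) := by
  obtain ⟨M, hM, hMR⟩ := exists_gradient_cutoff_bound n
  refine ⟨M, hM, fun R hR r w => ?_⟩
  rw [← eLpNorm_indicator_eq_eLpNorm_restrict (measurableSet_annulus R)]
  refine eLpNorm_le_mul_eLpNorm_of_ae_le_mul (Eventually.of_forall fun x => ?_) r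
  by_cases hx : x ∈ annulus n R
  · rw [Set.indicator_of_mem hx, norm_smul, mul_comm]
    gcongr
    exact hMR R hR x
  · have : ‖x‖ < R ∨ 2 * R < ‖x‖ := by
      by_contra! h
      exact hx ⟨h.1, h.2⟩
    rw [gradient_cutoff_eq_zero hR this, smul_zero, norm_zero]
    have := div_nonneg hM hR.le
    positivity

/-- Hölder's inequality on the annulus: since `‖∇η_R‖_n` does not depend on `R`, multiplication by
`∇η_R` maps `L^{p*}` to `L^p` with a uniform bound. -/
theorem exists_eLpNorm_smul_gradient_cutoff_le_tail {p : ℝ} (hp : 1 < p) (hpn : p < n) :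
    ∃ C : ℝ≥0∞, C ≠ ⊤ ∧ ∀ R : ℝ, 0 < R → ∀ w : Eucl n → ℝ, AEStronglyMeasurable w volume →
      eLpNorm (fun x => w x • gradient (cutoff R) x) (ENNReal.ofReal p) volume ≤
        C * eLpNorm w (ENNReal.ofReal (n * p / (n - p))) (volume.restrict (tailSet n R)) := by
  obtain ⟨M, hM, hMR⟩ := exists_eLpNorm_smul_gradient_cutoff_le n
  have hp0 : 0 < p := by linarith
  have hn0 : (0 : ℝ) < n := by linarith
  have hnp : 0 < (n : ℝ) - p := by linarith
  have hps : p ≤ n * p / (n - p) := by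
    rw [le_div_iff₀ hnp]
    nlinarith
  set v : ℝ≥0∞ := volume (Metric.ball (0 : Eucl n) 1) with hv
  have hvt : v ≠ ⊤ := measure_ball_lt_top.ne
  refine ⟨ENNReal.ofReal (2 * M) * v ^ (1 / (n : ℝ)), ENNReal.mul_ne_top ENNReal.ofReal_ne_top
    (ENNReal.rpow_ne_top_of_nonneg (by positivity) hvt), fun R hR w hw => ?_⟩
  refine (hMR R hR _ w).trans ?_
  have h1 := eLpNorm_le_eLpNorm_mul_rpow_measure_univ (ENNReal.ofReal_le_ofReal hps)
    (hw.restrict (s := annulus n R))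
  rw [ENNReal.toReal_ofReal hp0.le, ENNReal.toReal_ofReal (by positivity),
    Measure.restrict_apply_univ] at h1
  have he : 1 / p - 1 / (n * p / (n - p)) = 1 / (n : ℝ) := by
    field_simp
    ring
  rw [he] at h1
  have h2 : volume (annulus n R) ^ (1 / (n : ℝ)) ≤ ENNReal.ofReal (2 * R) * v ^ (1 / (n : ℝ)) := by
    calc _ ≤ volume (Metric.closedBall (0 : Eucl n) (2 * R)) ^ (1 / (n : ℝ)) := by
          gcongr
          exact annulus_subset_closedBall R
      _ = _ := by
          rw [Measure.addHaar_closedBall _ _ (by positivity), finrank_euclideanSpace_fin,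
            ENNReal.mul_rpow_of_nonneg _ _ (by positivity), ENNReal.ofReal_pow (by positivity),
            ← ENNReal.rpow_natCast, ← ENNReal.rpow_mul, mul_one_div_cancel hn0.ne',
            ENNReal.rpow_one]
  calc _ ≤ ENNReal.ofReal (M / R) * (eLpNorm w (ENNReal.ofReal (n * p / (n - p)))
        (volume.restrict (tailSet n R)) * (ENNReal.ofReal (2 * R) * v ^ (1 / (n : ℝ)))) := by
        refine mul_le_mul' le_rfl (h1.trans (mul_le_mul' ?_ h2))
        exact eLpNorm_restrict_mono (annulus_subset_tailSet R) _ _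
    _ = (ENNReal.ofReal (M / R) * ENNReal.ofReal (2 * R)) * v ^ (1 / (n : ℝ)) *
        eLpNorm w (ENNReal.ofReal (n * p / (n - p))) (volume.restrict (tailSet n R)) := by ring
    _ = _ := by
        rw [← ENNReal.ofReal_mul (by positivity)]
        congr 3
        field_simp

/-- The tails of an `L^r` function vanish at infinity. -/
theorem tendsto_eLpNorm_tail {F : Type*} [NormedAddCommGroup F] {r : ℝ} (hr : 0 < r)
    {f : Eucl n → F} (hf : MemLp f (ENNReal.ofReal r)) :
    Tendsto (fun R : ℕ => eLpNorm f (ENNReal.ofReal r) (volume.restrict (tailSet n R))) atTop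
      (𝓝 0) := by
  have h1 : Tendsto (fun R : ℕ => ∫⁻ x, (tailSet n R).indicator (fun x => ‖f x‖ₑ ^ r) x) atTop
      (𝓝 (∫⁻ _x : Eucl n, 0)) := by
    refine tendsto_lintegral_of_dominated_convergence' (fun x => ‖f x‖ₑ ^ r)
      (fun R => (hf.1.enorm.pow_const r).indicator (measurableSet_tailSet _))
      (fun R => Eventually.of_forall fun x => Set.indicator_le_self _ _ x) ?_
      (Eventually.of_forall fun x => ?_)
    · rw [← eLpNorm_ofReal_rpow hr]
      exact ENNReal.rpow_ne_top_of_nonneg hr.le hf.2.ne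
    · refine tendsto_const_nhds.congr' ?_
      obtain ⟨N, hN⟩ := exists_nat_gt ‖x‖
      filter_upwards [eventually_ge_atTop N] with R hR
      rw [Set.indicator_of_notMem]
      simp only [tailSet, Set.mem_ofPred_eq, not_le]
      exact hN.trans_le (by exact_mod_cast hR)
  have h2 := h1.ennrpow_const (1 / r)
  rw [lintegral_zero, ENNReal.zero_rpow_of_pos (by positivity)] at h2
  refine h2.congr fun R => ?_
  rw [lintegral_indicator (measurableSet_tailSet _), eLpNorm_ofReal_eq hr]

/-- A norm is at most the sum of the norms inside and outside of a ball. -/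
theorem eLpNorm_le_ball_add_tail {F : Type*} [NormedAddCommGroup F] {r : ℝ≥0∞} (hr : 1 ≤ r)
    {f : Eucl n → F} (hf : AEStronglyMeasurable f volume) (R : ℝ) :
    eLpNorm f r volume ≤ eLpNorm f r (volume.restrict (Metric.closedBall 0 R)) +
      eLpNorm f r (volume.restrict (tailSet n R)) := by
  rw [← eLpNorm_indicator_eq_eLpNorm_restrict Metric.isClosed_closedBall.measurableSet,
    ← eLpNorm_indicator_eq_eLpNorm_restrict (measurableSet_tailSet R)]
  calc _ ≤ eLpNorm (fun x => ‖(Metric.closedBall (0 : Eucl n) R).indicator f x‖ +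
        ‖(tailSet n R).indicator f x‖) r volume := by
        refine eLpNorm_mono_real fun x => ?_
        rcases le_total ‖x‖ R with h | h
        · rw [Set.indicator_of_mem (by simpa using h : x ∈ Metric.closedBall 0 R)]
          linarith [norm_nonneg ((tailSet n R).indicator f x)]
        · rw [Set.indicator_of_mem (show x ∈ tailSet n R from h)]
          linarith [norm_nonneg ((Metric.closedBall (0 : Eucl n) R).indicator f x)]
    _ ≤ _ := by
        refine (eLpNorm_add_le (hf.indicator Metric.isClosed_closedBall.measurableSet).norm
          (hf.indicator (measurableSet_tailSet R)).norm hr).trans_eq ?_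
        rw [eLpNorm_norm, eLpNorm_norm]

/-- The two pieces of a cut function carry the whole `L^q` norm, except for the annulus. -/
theorem eLpNorm_rpow_le_cutoff_add {q : ℝ} (hq : 0 < q) {R : ℝ} (hR : 0 < R) {f : Eucl n → ℝ}
    (hf : AEStronglyMeasurable f volume) :
    eLpNorm f (ENNReal.ofReal q) volume ^ q ≤
      eLpNorm (fun x => cutoff R x * f x) (ENNReal.ofReal q) volume ^ q
      + eLpNorm (fun x => (1 - cutoff R x) * f x) (ENNReal.ofReal q) volume ^ q
      + eLpNorm f (ENNReal.ofReal q) (volume.restrict (annulus n R)) ^ q := by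
  have hc := (isTest_cutoff (n := n) hR).continuous
  have m1 : AEMeasurable (fun x => ‖cutoff R x * f x‖ₑ ^ q) volume :=
    (hc.aestronglyMeasurable.mul hf).enorm.pow_const q
  have m2 : AEMeasurable (fun x => ‖(1 - cutoff R x) * f x‖ₑ ^ q) volume :=
    ((continuous_const.sub hc).aestronglyMeasurable.mul hf).enorm.pow_const q
  have m12 : AEMeasurable (fun x => ‖cutoff R x * f x‖ₑ ^ q + ‖(1 - cutoff R x) * f x‖ₑ ^ q)
    volume := m1.add m2
  rw [eLpNorm_ofReal_rpow hq, eLpNorm_ofReal_rpow hq, eLpNorm_ofReal_rpow hq,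
    eLpNorm_ofReal_rpow hq, ← lintegral_indicator (measurableSet_annulus R),
    ← lintegral_add_left' m1, ← lintegral_add_left' m12]
  refine lintegral_mono fun x => ?_
  by_cases h1 : ‖x‖ < R
  · rw [cutoff_eq_one hR h1.le, one_mul, add_assoc]
    exact le_self_add
  · by_cases h2 : 2 * R < ‖x‖
    · rw [cutoff_eq_zero hR h2.le, sub_zero, one_mul]
      exact le_trans le_add_self le_self_add
    · rw [Set.indicator_of_mem (show x ∈ annulus n R from ⟨not_lt.1 h1, not_lt.1 h2⟩)]
      exact le_add_self

theorem gradient_cutoff_mul {R : ℝ} (hR : 0 < R) {φ : Eucl n → ℝ} (hφ : IsTest φ) (x : Eucl n) :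
    gradient (fun x => cutoff R x * φ x) x =
      cutoff R x • gradient φ x + φ x • gradient (cutoff R) x :=
  gradient_mul_of_differentiableAt ((isTest_cutoff hR).differentiableAt x) (hφ.differentiableAt x)

theorem gradient_one_sub_cutoff_mul {R : ℝ} (hR : 0 < R) {φ : Eucl n → ℝ} (hφ : IsTest φ)
    (x : Eucl n) : gradient (fun x => (1 - cutoff R x) * φ x) x =
      (1 - cutoff R x) • gradient φ x - φ x • gradient (cutoff R) x := by
  have h : (fun x => (1 - cutoff R x) * φ x) = fun x => φ x - cutoff R x * φ x := by
    ext x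
    ring
  rw [h, gradient_fun_sub hφ (hφ.mul_left (isTest_cutoff hR).1), gradient_cutoff_mul hR hφ,
    sub_smul, one_smul]
  abel

end Cutoffs

/-! ### Real-valued norms -/

section RealNorms

variable {n : ℕ} {F : Type*} [NormedAddCommGroup F] {r : ℝ} {f g : Eucl n → F}

theorem ofReal_lNorm (hf : MemLp f (ENNReal.ofReal r)) :
    ENNReal.ofReal (lNorm r f) = eLpNorm f (ENNReal.ofReal r) volume :=
  ENNReal.ofReal_toReal hf.2.ne

theorem lNorm_add_le (hr : 1 ≤ r) (hf : MemLp f (ENNReal.ofReal r))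
    (hg : MemLp g (ENNReal.ofReal r)) : lNorm r (fun x => f x + g x) ≤ lNorm r f + lNorm r g := by
  rw [lNorm, lNorm, lNorm, ← ENNReal.toReal_add hf.2.ne hg.2.ne]
  exact ENNReal.toReal_mono (ENNReal.add_ne_top.2 ⟨hf.2.ne, hg.2.ne⟩)
    (eLpNorm_add_le hf.1 hg.1 (ENNReal.one_le_ofReal.2 hr))

theorem lNorm_sub_comm (f g : Eucl n → F) :
    lNorm r (fun x => f x - g x) = lNorm r (fun x => g x - f x) := by
  rw [lNorm, lNorm]
  congr 1
  exact eLpNorm_sub_comm f g _ _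

theorem lNorm_sub_le (hr : 1 ≤ r) (hf : MemLp f (ENNReal.ofReal r))
    (hg : MemLp g (ENNReal.ofReal r)) : lNorm r (fun x => f x - g x) ≤ lNorm r f + lNorm r g := by
  rw [lNorm, lNorm, lNorm, ← ENNReal.toReal_add hf.2.ne hg.2.ne]
  exact ENNReal.toReal_mono (ENNReal.add_ne_top.2 ⟨hf.2.ne, hg.2.ne⟩)
    (eLpNorm_sub_le hf.1 hg.1 (ENNReal.one_le_ofReal.2 hr))

theorem abs_lNorm_sub_lNorm_le (hr : 1 ≤ r) (hf : MemLp f (ENNReal.ofReal r))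
    (hg : MemLp g (ENNReal.ofReal r)) : |lNorm r f - lNorm r g| ≤ lNorm r (fun x => f x - g x) := by
  have h1 := lNorm_add_le hr (hf.sub hg) hg
  have h2 := lNorm_add_le hr (hg.sub hf) hf
  simp only [Pi.sub_apply, sub_add_cancel] at h1 h2
  have e1 : lNorm r (f - g) = lNorm r (fun x => f x - g x) := rfl
  have e2 : lNorm r (g - f) = lNorm r (fun x => g x - f x) := rfl
  have e3 := lNorm_sub_comm (r := r) f g
  rw [abs_le]
  constructor <;> linarith

theorem tendsto_lNorm_of_tendsto_eLpNorm {ι : Type*} {l : Filter ι} (hr : 1 ≤ r)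
    {f : ι → Eucl n → F} (hf : ∀ k, MemLp (f k) (ENNReal.ofReal r))
    (hg : MemLp g (ENNReal.ofReal r))
    (h : Tendsto (fun k => eLpNorm (fun x => f k x - g x) (ENNReal.ofReal r) volume) l (𝓝 0)) :
    Tendsto (fun k => lNorm r (f k)) l (𝓝 (lNorm r g)) := by
  have h1 : Tendsto (fun k => lNorm r (fun x => f k x - g x)) l (𝓝 0) := by
    have := (ENNReal.tendsto_toReal ENNReal.zero_ne_top).comp h
    rwa [ENNReal.toReal_zero] at this
  rw [tendsto_iff_dist_tendsto_zero]
  refine squeeze_zero (fun _ => dist_nonneg) (fun k => ?_) h1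
  rw [Real.dist_eq]
  exact abs_lNorm_sub_lNorm_le hr (hf k) hg

theorem lNorm_const_smul [NormedSpace ℝ F] (c : ℝ) (f : Eucl n → F) :
    lNorm r (fun x => c • f x) = |c| * lNorm r f := by
  have := eLpNorm_const_smul (p := ENNReal.ofReal r) (μ := volume) c f
  rw [lNorm, lNorm]
  change (eLpNorm (c • f) _ _).toReal = _
  rw [this, ENNReal.toReal_mul]
  simp

theorem lNorm_const_mul (c : ℝ) (f : Eucl n → ℝ) :
    lNorm r (fun x => c * f x) = |c| * lNorm r f :=
  lNorm_const_smul c f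

theorem integral_norm_rpow_eq_lNorm (hr : 0 < r) (hf : MemLp f (ENNReal.ofReal r)) :
    ∫ x, ‖f x‖ ^ r = lNorm r f ^ r := by
  rw [lNorm, ENNReal.toReal_rpow, eLpNorm_ofReal_rpow hr,
    integral_eq_lintegral_of_nonneg_ae (Eventually.of_forall fun x => by positivity)
      (hf.1.norm.aemeasurable.pow_const r).aestronglyMeasurable]
  congr 1
  refine lintegral_congr fun x => ?_
  rw [← ofReal_norm, ENNReal.ofReal_rpow_of_nonneg (norm_nonneg _) hr.le]

theorem lNorm_rpow_split_le [NormedSpace ℝ F] (hr : 1 ≤ r) {η : Eucl n → ℝ}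
    (hη : Measurable η) (h0 : ∀ x, 0 ≤ η x) (h1 : ∀ x, η x ≤ 1) (hf : MemLp f (ENNReal.ofReal r)) :
    lNorm r (fun x => η x • f x) ^ r + lNorm r (fun x => (1 - η x) • f x) ^ r ≤ lNorm r f ^ r := by
  have h := eLpNorm_rpow_split_le hr hη h0 h1 hf.1
  have ht : eLpNorm f (ENNReal.ofReal r) volume ^ r ≠ ⊤ :=
    ENNReal.rpow_ne_top_of_nonneg (by linarith) hf.2.ne
  rw [lNorm, lNorm, lNorm, ENNReal.toReal_rpow, ENNReal.toReal_rpow, ENNReal.toReal_rpow,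
    ← ENNReal.toReal_add (ne_top_of_le_ne_top ht (le_self_add.trans h))
      (ne_top_of_le_ne_top ht (le_add_self.trans h))]
  exact ENNReal.toReal_mono ht h

end RealNorms

/-! ### Tightness of minimizing sequences -/

/-- The admissible exponents of the Gagliardo–Nirenberg–Sobolev inequality. -/
structure Admissible (n : ℕ) (p s q θ : ℝ) : Prop where
  one_lt_p : 1 < p
  p_lt_n : p < n
  one_le_s : 1 ≤ s
  s_lt_q : s < q
  q_lt : q < n * p / (n - p)
  balance : θ / (n * p / (n - p)) + (1 - θ) / s = 1 / q

namespace Admissible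

variable {n : ℕ} {p s q θ : ℝ}

theorem p_pos (h : Admissible n p s q θ) : 0 < p := by linarith [h.one_lt_p]

theorem s_pos (h : Admissible n p s q θ) : 0 < s := by linarith [h.one_le_s]

theorem q_pos (h : Admissible n p s q θ) : 0 < q := by linarith [h.s_pos, h.s_lt_q]

theorem one_lt_q (h : Admissible n p s q θ) : 1 < q := by linarith [h.one_le_s, h.s_lt_q]

theorem n_pos (h : Admissible n p s q θ) : (0 : ℝ) < n := by linarith [h.p_pos, h.p_lt_n]

theorem theta_mem (h : Admissible n p s q θ) : 0 < θ ∧ θ < 1 := by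
  have hps : 0 < n * p / (n - p) := h.q_pos.trans h.q_lt
  have h1 : 1 / q < 1 / s := one_div_lt_one_div_of_lt h.s_pos h.s_lt_q
  have h2 : 1 / (n * p / (n - p)) < 1 / q := one_div_lt_one_div_of_lt h.q_pos h.q_lt
  have hb : θ * (1 / (n * p / (n - p))) + (1 - θ) * (1 / s) = 1 / q := by
    rw [mul_one_div, mul_one_div]
    exact h.balance
  constructor
  · by_contra! hθ
    nlinarith
  · by_contra! hθ
    nlinarith

/-- The exponent that makes the inequality strictly superadditive. -/
theorem one_lt_exponent (h : Admissible n p s q θ) : 1 < θ * q / p + (1 - θ) * q / s := by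
  have hq := h.q_pos
  have hp := h.p_pos
  have hn := h.n_pos
  have hnp : 0 < (n : ℝ) - p := by linarith [h.p_lt_n]
  have e : θ * q / p + (1 - θ) * q / s = 1 + q * θ / n := by
    have h1 : θ / p = θ / (n * p / (n - p)) + θ / n := by
      field_simp
      ring
    calc _ = q * (θ / p + (1 - θ) / s) := by ring
      _ = q * (1 / q + θ / n) := by rw [h1, ← h.balance]; ring
      _ = _ := by field_simp
  rw [e]
  have := h.theta_mem.1
  have : 0 < q * θ / n := by positivity
  linarith

end Admissible

/-- The strict superadditivity that excludes splitting: if both pieces satisfy the sharp inequality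
with the constant of the whole, one of them is trivial. -/
theorem eq_zero_or_eq_zero_of_split {n : ℕ} {p s q θ : ℝ} (h : Admissible n p s q θ) {G D : ℝ}
    (hG : 0 < G) (hD : 0 < D) (hDG : D ^ θ = G) {a₁ a₂ s₁ s₂ y₁ y₂ : ℝ} (ha₁ : 0 ≤ a₁)
    (ha₂ : 0 ≤ a₂) (hs₁ : 0 ≤ s₁) (hs₂ : 0 ≤ s₂) (hy₁ : 0 ≤ y₁) (hy₂ : 0 ≤ y₂)
    (hA : a₁ ^ p + a₂ ^ p ≤ D ^ p) (hS : s₁ ^ s + s₂ ^ s ≤ 1) (hY : 1 ≤ y₁ ^ q + y₂ ^ q)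
    (h₁ : G * y₁ ≤ a₁ ^ θ * s₁ ^ (1 - θ)) (h₂ : G * y₂ ≤ a₂ ^ θ * s₂ ^ (1 - θ)) :
    y₁ = 0 ∨ y₂ = 0 := by
  have hp := h.p_pos
  have hs := h.s_pos
  have hq := h.q_pos
  obtain ⟨hθ0, hθ1⟩ := h.theta_mem
  have hθ1' : 0 < 1 - θ := by linarith
  set α := θ * q / p with hα
  set β := (1 - θ) * q / s with hβ
  have hαβ : 1 < α + β := h.one_lt_exponent
  have hα0 : 0 < α := by positivity
  have hβ0 : 0 < β := by positivity
  -- `T` is the weighted arithmetic mean of the shares of the gradient norm and of the `L^s` norm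
  let T : ℝ → ℝ → ℝ := fun a b => (α * (a ^ p / D ^ p) + β * b ^ s) / (α + β)
  have key : ∀ a b y : ℝ, 0 ≤ a → 0 ≤ b → 0 ≤ y → G * y ≤ a ^ θ * b ^ (1 - θ) →
      0 ≤ T a b ∧ y ^ q ≤ T a b ^ (α + β) := by
    intro a b y ha hb hy hGy
    have hT : 0 ≤ T a b := by positivity
    refine ⟨hT, ?_⟩
    have e0 : y ≤ (a / D) ^ θ * b ^ (1 - θ) := by
      rw [Real.div_rpow ha hD.le, hDG, div_mul_eq_mul_div, le_div_iff₀ hG]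
      linarith
    have e1 : y ^ q ≤ (a / D) ^ (θ * q) * b ^ ((1 - θ) * q) := by
      calc y ^ q ≤ ((a / D) ^ θ * b ^ (1 - θ)) ^ q := Real.rpow_le_rpow hy e0 hq.le
        _ = _ := by
          rw [Real.mul_rpow (by positivity) (by positivity), ← Real.rpow_mul (by positivity),
            ← Real.rpow_mul hb]
    have e2 := Real.geom_mean_le_arith_mean2_weighted (w₁ := α / (α + β)) (w₂ := β / (α + β))
      (p₁ := (a / D) ^ p) (p₂ := b ^ s) (by positivity) (by positivity) (by positivity)
      (by positivity) (by field_simp)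
    have e3 : α / (α + β) * (a / D) ^ p + β / (α + β) * b ^ s = T a b := by
      simp only [T]
      rw [Real.div_rpow ha hD.le]
      field_simp
    rw [e3] at e2
    refine e1.trans ?_
    calc (a / D) ^ (θ * q) * b ^ ((1 - θ) * q)
        = (((a / D) ^ p) ^ (α / (α + β)) * (b ^ s) ^ (β / (α + β))) ^ (α + β) := by
          rw [Real.mul_rpow (by positivity) (by positivity), ← Real.rpow_mul (by positivity),
            ← Real.rpow_mul (by positivity), ← Real.rpow_mul hb, ← Real.rpow_mul hb]
          congr 2
          · field_simp
            rw [hα]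
            field_simp
          · field_simp
            rw [hβ]
            field_simp
      _ ≤ _ := Real.rpow_le_rpow (by positivity) e2 (by linarith)
  obtain ⟨t₁, k₁⟩ := key a₁ s₁ y₁ ha₁ hs₁ hy₁ h₁
  obtain ⟨t₂, k₂⟩ := key a₂ s₂ y₂ ha₂ hs₂ hy₂ h₂
  have hsum : T a₁ s₁ + T a₂ s₂ ≤ 1 := by
    have e : T a₁ s₁ + T a₂ s₂ =
        (α * ((a₁ ^ p + a₂ ^ p) / D ^ p) + β * (s₁ ^ s + s₂ ^ s)) / (α + β) := by
      simp only [T]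
      ring
    rw [e, div_le_one (by positivity)]
    have : (a₁ ^ p + a₂ ^ p) / D ^ p ≤ 1 := (div_le_one (by positivity)).2 hA
    nlinarith
  by_contra! hne
  have p₁ : 0 < y₁ := lt_of_le_of_ne hy₁ hne.1.symm
  have p₂ : 0 < y₂ := lt_of_le_of_ne hy₂ hne.2.symm
  have strict : ∀ t y : ℝ, 0 ≤ t → 0 < y → y ^ q ≤ t ^ (α + β) → 0 < t := by
    intro t y ht hy hty
    refine lt_of_le_of_ne ht fun h0 => ?_
    rw [← h0, Real.zero_rpow (by linarith)] at hty
    have : 0 < y ^ q := by positivity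
    linarith
  have q₁ := strict _ _ t₁ p₁ k₁
  have q₂ := strict _ _ t₂ p₂ k₂
  have l₁ := Real.rpow_lt_rpow_of_exponent_gt q₁ (by linarith) hαβ
  have l₂ := Real.rpow_lt_rpow_of_exponent_gt q₂ (by linarith) hαβ
  rw [Real.rpow_one] at l₁ l₂
  linarith

/-- A minimizing sequence of test functions for the sharp inequality, normalized in `L^s` and in
`L^q`; `D` is the limit of the gradient norms. -/
structure IsMinimizing {n : ℕ} (p s q θ D : ℝ) (φ : ℕ → Eucl n → ℝ) : Prop where
  isTest : ∀ k, IsTest (φ k)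
  lNorm_s : ∀ k, lNorm s (φ k) = 1
  lNorm_q : ∀ k, lNorm q (φ k) = 1
  tendsto : Tendsto (fun k => lNorm p (gradient (φ k))) atTop (𝓝 D)
  rpow_eq : D ^ θ = sharpConst n p s q θ

section Tightness

variable {n : ℕ} {p s q θ D : ℝ} {φ : ℕ → Eucl n → ℝ} {u : Eucl n → ℝ}

theorem IsMinimizing.nonneg (hm : IsMinimizing p s q θ D φ) : 0 ≤ D :=
  ge_of_tendsto' hm.tendsto fun _ => lNorm_nonneg _

theorem IsMinimizing.pos (hθ : 0 < θ) (hm : IsMinimizing p s q θ D φ)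
    (hG : 0 < sharpConst n p s q θ) : 0 < D := by
  refine lt_of_le_of_ne hm.nonneg fun h => ?_
  have := hm.rpow_eq
  rw [← h, Real.zero_rpow hθ.ne'] at this
  exact hG.ne this

theorem IsMinimizing.comp (hm : IsMinimizing p s q θ D φ) {σ : ℕ → ℕ} (hσ : StrictMono σ) :
    IsMinimizing p s q θ D (fun k => φ (σ k)) :=
  ⟨fun _ => hm.isTest _, fun _ => hm.lNorm_s _, fun _ => hm.lNorm_q _,
    hm.tendsto.comp hσ.tendsto_atTop, hm.rpow_eq⟩

theorem exists_ball_eLpNorm_ne_zero {r : ℝ≥0∞} (hr : r ≠ 0) (hum : AEStronglyMeasurable u volume)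
    (hu : ¬ u =ᵐ[volume] 0) :
    ∃ R : ℕ, eLpNorm u r (volume.restrict (Metric.closedBall 0 R)) ≠ 0 := by
  by_contra! h
  refine hu ?_
  have h1 : ∀ R : ℕ, ∀ᵐ x ∂(volume.restrict (Metric.closedBall (0 : Eucl n) R)), u x = 0 :=
    fun R => (eLpNorm_eq_zero_iff hum.restrict hr).1 (h R)
  have h2 := (ae_restrict_iUnion_iff (fun R : ℕ => Metric.closedBall (0 : Eucl n) R) _).2 h1
  rwa [Metric.iUnion_closedBall_nat, Measure.restrict_univ] at h2

/-- A local `L^r` limit of norm at least `c₀` on a ball is approached by functions of norm at least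
`c₀ / 2`. -/
theorem eventually_half_le_eLpNorm {r : ℝ≥0∞} (hr : 1 ≤ r) {μ : Measure (Eucl n)}
    (hφ : ∀ k, AEStronglyMeasurable (φ k) μ) (hu : AEStronglyMeasurable u μ)
    (hut : eLpNorm u r μ ≠ ⊤) (hu0 : eLpNorm u r μ ≠ 0)
    (h : Tendsto (fun k => eLpNorm (fun x => φ k x - u x) r μ) atTop (𝓝 0)) :
    ∀ᶠ k in atTop, eLpNorm u r μ / 2 ≤ eLpNorm (φ k) r μ := by
  filter_upwards [(ENNReal.tendsto_nhds_zero.1 h) (eLpNorm u r μ / 2) (ENNReal.half_pos hu0)]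
    with k hk
  have h1 : eLpNorm u r μ ≤ eLpNorm (φ k) r μ + eLpNorm (fun x => φ k x - u x) r μ := by
    have := eLpNorm_sub_le (p := r) (hφ k) ((hφ k).sub hu) hr
    rwa [sub_sub_cancel] at this
  have h2 : eLpNorm u r μ / 2 + eLpNorm u r μ / 2 ≤ eLpNorm (φ k) r μ + eLpNorm u r μ / 2 := by
    rw [ENNReal.add_halves]
    exact h1.trans (by gcongr)
  exact (ENNReal.add_le_add_iff_right (ENNReal.div_ne_top hut (by simp))).1 h2

/-- Local convergence controls `φ ∇η_R` and the norm on the annulus along the sequence by the tails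
of the limit. -/
theorem eventually_annulus_le (h : Admissible n p s q θ) (hφ : ∀ k, IsTest (φ k))
    (hum : AEStronglyMeasurable u volume) {C : ℝ≥0∞}
    (hC : ∀ R : ℝ, 0 < R → ∀ w : Eucl n → ℝ, AEStronglyMeasurable w volume →
      eLpNorm (fun x => w x • gradient (cutoff R) x) (ENNReal.ofReal p) volume ≤
        C * eLpNorm w (ENNReal.ofReal (n * p / (n - p))) (volume.restrict (tailSet n R)))
    (hlocp : ∀ R : ℕ, Tendsto (fun k => eLpNorm (fun x => φ k x - u x) (ENNReal.ofReal p)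
        (volume.restrict (Metric.closedBall 0 R))) atTop (𝓝 0))
    (hlocq : ∀ R : ℕ, Tendsto (fun k => eLpNorm (fun x => φ k x - u x) (ENNReal.ofReal q)
        (volume.restrict (Metric.closedBall 0 R))) atTop (𝓝 0))
    {R : ℕ} (hR : 0 < R) {δ : ℝ≥0∞} (hδ : 0 < δ) :
    ∀ᶠ k in atTop,
      eLpNorm (fun x => φ k x • gradient (cutoff R) x) (ENNReal.ofReal p) volume ≤
        C * eLpNorm u (ENNReal.ofReal (n * p / (n - p))) (volume.restrict (tailSet n R)) + δ ∧
      eLpNorm (φ k) (ENNReal.ofReal q) (volume.restrict (annulus n R)) ≤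
        eLpNorm u (ENNReal.ofReal q) (volume.restrict (tailSet n R)) + δ := by
  have hR' : (0 : ℝ) < R := by exact_mod_cast hR
  obtain ⟨M, -, hM⟩ := exists_eLpNorm_smul_gradient_cutoff_le n
  have hcut := (isTest_cutoff (n := n) hR').continuous_gradient
  have hann : annulus n R ⊆ Metric.closedBall 0 ((2 * R : ℕ) : ℝ) := by
    push_cast
    exact annulus_subset_closedBall _
  have h1 : Tendsto (fun k => ENNReal.ofReal (M / R) * eLpNorm (fun x => φ k x - u x)
      (ENNReal.ofReal p) (volume.restrict (Metric.closedBall 0 ((2 * R : ℕ) : ℝ)))) atTop (𝓝 0) := by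
    simpa using ENNReal.Tendsto.const_mul (a := ENNReal.ofReal (M / R)) (hlocp (2 * R))
      (Or.inr ENNReal.ofReal_ne_top)
  filter_upwards [(ENNReal.tendsto_nhds_zero.1 h1) δ hδ,
    (ENNReal.tendsto_nhds_zero.1 (hlocq (2 * R))) δ hδ] with k hk1 hk2
  constructor
  · have e : (fun x => φ k x • gradient (cutoff R) x) = (fun x => u x • gradient (cutoff R) x) +
        fun x => (φ k x - u x) • gradient (cutoff R) x := by
      ext1 x
      simp [sub_smul]
    rw [e]
    refine (eLpNorm_add_le (hum.smul hcut.aestronglyMeasurable)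
      (((hφ k).aestronglyMeasurable.sub hum).smul hcut.aestronglyMeasurable)
      (ENNReal.one_le_ofReal.2 h.one_lt_p.le)).trans (add_le_add (hC R hR' u hum) ?_)
    refine (hM R hR' _ _).trans (le_trans ?_ hk1)
    gcongr
    exact eLpNorm_restrict_mono hann _ _
  · have e : φ k = u + fun x => φ k x - u x := by
      ext1 x
      simp
    calc eLpNorm (φ k) (ENNReal.ofReal q) (volume.restrict (annulus n R))
        = eLpNorm (u + fun x => φ k x - u x) (ENNReal.ofReal q)
          (volume.restrict (annulus n R)) := by rw [← e]
      _ ≤ _ := eLpNorm_add_le hum.restrict ((hφ k).aestronglyMeasurable.sub hum).restrict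
          (ENNReal.one_le_ofReal.2 h.one_lt_q.le)
      _ ≤ _ := add_le_add (eLpNorm_restrict_mono (annulus_subset_tailSet _) _ _)
          ((eLpNorm_restrict_mono hann _ _).trans hk2)

/-- The inequalities between the norms of the two pieces of a cut test function. -/
theorem split_inequalities (h : Admissible n p s q θ) {f : Eucl n → ℝ} (hf : IsTest f)
    (hs1 : lNorm s f = 1) (hq1 : lNorm q f = 1) {R : ℝ} (hR : 0 < R) {E₀ F₀ : ℝ≥0∞}
    (hE : E₀ ≠ ⊤) (hF : F₀ ≠ ⊤)
    (hE₀ : eLpNorm (fun x => f x • gradient (cutoff R) x) (ENNReal.ofReal p) volume ≤ E₀)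
    (hF₀ : eLpNorm f (ENNReal.ofReal q) (volume.restrict (annulus n R)) ≤ F₀) :
    ∃ a₁ a₂ s₁ s₂ y₁ y₂ : ℝ, 0 ≤ a₁ ∧ 0 ≤ a₂ ∧ 0 ≤ s₁ ∧ 0 ≤ s₂ ∧ 0 ≤ y₁ ∧ 0 ≤ y₂ ∧
      a₁ ^ p + a₂ ^ p ≤ lNorm p (gradient f) ^ p ∧ s₁ ^ s + s₂ ^ s ≤ 1 ∧
      1 ≤ y₁ ^ q + y₂ ^ q + F₀.toReal ^ q ∧ y₁ ^ q + y₂ ^ q ≤ 1 ∧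
      sharpConst n p s q θ * y₁ ≤ (a₁ + E₀.toReal) ^ θ * s₁ ^ (1 - θ) ∧
      sharpConst n p s q θ * y₂ ≤ (a₂ + E₀.toReal) ^ θ * s₂ ^ (1 - θ) ∧
      eLpNorm f (ENNReal.ofReal q) (volume.restrict (Metric.closedBall 0 R))
        ≤ ENNReal.ofReal y₁ ∧
      eLpNorm f (ENNReal.ofReal q) (volume.restrict (tailSet n (2 * R))) ≤ ENNReal.ofReal y₂ := by
  have hη := isTest_cutoff (n := n) hR
  have hp1 := h.one_lt_p.le
  obtain ⟨hθ0, hθ1⟩ := h.theta_mem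
  have t1 : IsTest (fun x => cutoff R x * f x) := hf.mul_left hη.1
  have t2 : IsTest (fun x => (1 - cutoff R x) * f x) := hf.mul_left (contDiff_const.sub hη.1)
  have hfg : MemLp (fun x => f x • gradient (cutoff R) x) (ENNReal.ofReal p) :=
    (hf.continuous.smul hη.continuous_gradient).memLp_of_hasCompactSupport hf.2.smul_right
  have g1 : MemLp (fun x => cutoff R x • gradient f x) (ENNReal.ofReal p) :=
    (hη.continuous.smul hf.continuous_gradient).memLp_of_hasCompactSupport hη.2.smul_right
  have g2 : MemLp (fun x => (1 - cutoff R x) • gradient f x) (ENNReal.ofReal p) :=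
    ((continuous_const.sub hη.continuous).smul hf.continuous_gradient).memLp_of_hasCompactSupport
      hf.hasCompactSupport_gradient.smul_left
  have hEr : lNorm p (fun x => f x • gradient (cutoff R) x) ≤ E₀.toReal :=
    ENNReal.toReal_mono hE hE₀
  have b1 : lNorm p (gradient fun x => cutoff R x * f x) ≤
      lNorm p (fun x => cutoff R x • gradient f x) + E₀.toReal := by
    have e : (gradient fun x => cutoff R x * f x) = _ :=
      funext fun x => gradient_cutoff_mul hR hf x
    rw [e]
    exact (lNorm_add_le hp1 g1 hfg).trans (by gcongr)
  have b2 : lNorm p (gradient fun x => (1 - cutoff R x) * f x) ≤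
      lNorm p (fun x => (1 - cutoff R x) • gradient f x) + E₀.toReal := by
    have e : (gradient fun x => (1 - cutoff R x) * f x) = _ :=
      funext fun x => gradient_one_sub_cutoff_mul hR hf x
    rw [e]
    exact (lNorm_sub_le hp1 g2 hfg).trans (by gcongr)
  have hη01 := hη.continuous.measurable
  refine ⟨lNorm p fun x => cutoff R x • gradient f x,
    lNorm p fun x => (1 - cutoff R x) • gradient f x,
    lNorm s fun x => cutoff R x * f x, lNorm s fun x => (1 - cutoff R x) * f x,
    lNorm q fun x => cutoff R x * f x, lNorm q fun x => (1 - cutoff R x) * f x,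
    lNorm_nonneg _, lNorm_nonneg _, lNorm_nonneg _, lNorm_nonneg _, lNorm_nonneg _, lNorm_nonneg _,
    lNorm_rpow_split_le hp1 hη01 (cutoff_nonneg R) (cutoff_le_one R) (hf.memLp_gradient _),
    ?_, ?_, ?_, ?_, ?_, ?_, ?_⟩
  · have := lNorm_rpow_split_le h.one_le_s hη01 (cutoff_nonneg R) (cutoff_le_one R) (hf.memLp _)
    rwa [hs1, Real.one_rpow] at this
  · have h1 := eLpNorm_rpow_le_cutoff_add h.q_pos hR hf.aestronglyMeasurable
    have h2 := h1.trans (add_le_add_right (ENNReal.rpow_le_rpow hF₀ h.q_pos.le) _)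
    have n1 := ENNReal.rpow_ne_top_of_nonneg h.q_pos.le (t1.memLp (ENNReal.ofReal q)).2.ne
    have n2 := ENNReal.rpow_ne_top_of_nonneg h.q_pos.le (t2.memLp (ENNReal.ofReal q)).2.ne
    have n3 := ENNReal.rpow_ne_top_of_nonneg h.q_pos.le hF
    have h3 := ENNReal.toReal_mono (ENNReal.add_ne_top.2 ⟨ENNReal.add_ne_top.2 ⟨n1, n2⟩, n3⟩) h2
    rw [ENNReal.toReal_add (ENNReal.add_ne_top.2 ⟨n1, n2⟩) n3, ENNReal.toReal_add n1 n2,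
      ← ENNReal.toReal_rpow, ← ENNReal.toReal_rpow, ← ENNReal.toReal_rpow,
      ← ENNReal.toReal_rpow] at h3
    have h4 : (eLpNorm f (ENNReal.ofReal q) volume).toReal = 1 := hq1
    rwa [h4, Real.one_rpow] at h3
  · have := lNorm_rpow_split_le h.one_lt_q.le hη01 (cutoff_nonneg R) (cutoff_le_one R)
      (hf.memLp _)
    rwa [hq1, Real.one_rpow] at this
  · refine (t1.sharpConst_mul_lNorm_le hp1 h.one_le_s).trans ?_
    exact mul_le_mul_of_nonneg_right (Real.rpow_le_rpow (lNorm_nonneg _) b1 hθ0.le)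
      (Real.rpow_nonneg (lNorm_nonneg _) _)
  · refine (t2.sharpConst_mul_lNorm_le hp1 h.one_le_s).trans ?_
    exact mul_le_mul_of_nonneg_right (Real.rpow_le_rpow (lNorm_nonneg _) b2 hθ0.le)
      (Real.rpow_nonneg (lNorm_nonneg _) _)
  · rw [ofReal_lNorm (t1.memLp _)]
    refine LE.le.trans (b := eLpNorm (fun x => cutoff R x * f x) (ENNReal.ofReal q)
      (volume.restrict (Metric.closedBall 0 R))) (le_of_eq ?_)
      (eLpNorm_mono_measure _ Measure.restrict_le_self)
    refine eLpNorm_congr_ae ?_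
    filter_upwards [ae_restrict_mem Metric.isClosed_closedBall.measurableSet] with x hx
    rw [cutoff_eq_one hR (by simpa using hx), one_mul]
  · rw [ofReal_lNorm (t2.memLp _)]
    refine LE.le.trans (b := eLpNorm (fun x => (1 - cutoff R x) * f x) (ENNReal.ofReal q)
      (volume.restrict (tailSet n (2 * R)))) (le_of_eq ?_)
      (eLpNorm_mono_measure _ Measure.restrict_le_self)
    refine eLpNorm_congr_ae ?_
    filter_upwards [ae_restrict_mem (measurableSet_tailSet _)] with x hx
    rw [cutoff_eq_zero hR hx, sub_zero, one_mul]

end Tightness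

section Minimizing

variable {n : ℕ} {p s q θ D : ℝ} {φ : ℕ → Eucl n → ℝ} {u : Eucl n → ℝ}

theorem le_of_rpow_add_rpow_le {r x y M : ℝ} (hr : 0 < r) (hx : 0 ≤ x) (hy : 0 ≤ y) (hM : 0 ≤ M)
    (h : x ^ r + y ^ r ≤ M ^ r) : x ≤ M ∧ y ≤ M := by
  have h1 : 0 ≤ x ^ r := by positivity
  have h2 : 0 ≤ y ^ r := by positivity
  exact ⟨(Real.rpow_le_rpow_iff hx hM hr).1 (by linarith),
    (Real.rpow_le_rpow_iff hy hM hr).1 (by linarith)⟩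

/-- The limiting form of `eq_zero_or_eq_zero_of_split`: pieces that satisfy the inequalities up to
vanishing errors cannot both stay away from `0`. -/
theorem not_split_sequence (h : Admissible n p s q θ) {G : ℝ} (hG : 0 < G) (hD : 0 < D)
    (hDG : D ^ θ = G) {a₁ a₂ s₁ s₂ y₁ y₂ A E F : ℕ → ℝ} (ha₁ : ∀ j, 0 ≤ a₁ j)
    (ha₂ : ∀ j, 0 ≤ a₂ j) (hs₁ : ∀ j, 0 ≤ s₁ j) (hs₂ : ∀ j, 0 ≤ s₂ j) (hy₁ : ∀ j, 0 ≤ y₁ j)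
    (hy₂ : ∀ j, 0 ≤ y₂ j) (hA0 : ∀ j, 0 ≤ A j) (hA : ∀ j, a₁ j ^ p + a₂ j ^ p ≤ A j ^ p)
    (hAD : Tendsto A atTop (𝓝 D)) (hE : Tendsto E atTop (𝓝 0)) (hF : Tendsto F atTop (𝓝 0))
    (hS : ∀ j, s₁ j ^ s + s₂ j ^ s ≤ 1) (hY : ∀ j, 1 ≤ y₁ j ^ q + y₂ j ^ q + F j ^ q)
    (hY' : ∀ j, y₁ j ^ q + y₂ j ^ q ≤ 1)
    (h₁ : ∀ j, G * y₁ j ≤ (a₁ j + E j) ^ θ * s₁ j ^ (1 - θ))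
    (h₂ : ∀ j, G * y₂ j ≤ (a₂ j + E j) ^ θ * s₂ j ^ (1 - θ)) {c₁ c₂ : ℝ} (hc₁ : 0 < c₁)
    (hc₂ : 0 < c₂) (hyc₁ : ∀ᶠ j in atTop, c₁ ≤ y₁ j) (hyc₂ : ∀ᶠ j in atTop, c₂ ≤ y₂ j) :
    False := by
  have hp := h.p_pos
  have hs := h.s_pos
  have hq := h.q_pos
  obtain ⟨hθ0, hθ1⟩ := h.theta_mem
  obtain ⟨M, hM⟩ := hAD.bddAbove_range
  have hAM : ∀ j, A j ≤ M := fun j => hM ⟨j, rfl⟩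
  have hb1 := fun j => le_of_rpow_add_rpow_le hp (ha₁ j) (ha₂ j) (hA0 j) (hA j)
  have hb2 := fun j => le_of_rpow_add_rpow_le hs (hs₁ j) (hs₂ j) zero_le_one
    ((hS j).trans_eq (Real.one_rpow s).symm)
  have hb3 := fun j => le_of_rpow_add_rpow_le hq (hy₁ j) (hy₂ j) zero_le_one
    ((hY' j).trans_eq (Real.one_rpow q).symm)
  let z : ℕ → Fin 6 → ℝ := fun j => ![a₁ j, a₂ j, s₁ j, s₂ j, y₁ j, y₂ j]
  have hz : ∀ j, z j ∈ Set.Icc (0 : Fin 6 → ℝ) (fun _ => max M 1) := by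
    intro j
    have hM1 : M ≤ max M 1 := le_max_left _ _
    have h11 : 1 ≤ max M 1 := le_max_right _ _
    have := hAM j
    constructor
    · intro i
      fin_cases i <;> simp [z, ha₁ j, ha₂ j, hs₁ j, hs₂ j, hy₁ j, hy₂ j]
    · intro i
      fin_cases i <;> simp only [z] <;>
        [exact ((hb1 j).1.trans this).trans hM1; exact ((hb1 j).2.trans this).trans hM1;
          exact (hb2 j).1.trans h11; exact (hb2 j).2.trans h11; exact (hb3 j).1.trans h11;
          exact (hb3 j).2.trans h11]
  obtain ⟨w, -, σ, hσ, hlim⟩ := isCompact_Icc.tendsto_subseq hz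
  rw [tendsto_pi_nhds] at hlim
  have l0 : Tendsto (fun j => a₁ (σ j)) atTop (𝓝 (w 0)) := hlim 0
  have l1 : Tendsto (fun j => a₂ (σ j)) atTop (𝓝 (w 1)) := hlim 1
  have l2 : Tendsto (fun j => s₁ (σ j)) atTop (𝓝 (w 2)) := hlim 2
  have l3 : Tendsto (fun j => s₂ (σ j)) atTop (𝓝 (w 3)) := hlim 3
  have l4 : Tendsto (fun j => y₁ (σ j)) atTop (𝓝 (w 4)) := hlim 4
  have l5 : Tendsto (fun j => y₂ (σ j)) atTop (𝓝 (w 5)) := hlim 5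
  have hσt := hσ.tendsto_atTop
  have lE := hE.comp hσt
  have lF := hF.comp hσt
  have lA := hAD.comp hσt
  have rp : ∀ {f : ℕ → ℝ} {x r : ℝ}, 0 < r → Tendsto f atTop (𝓝 x) →
      Tendsto (fun j => f j ^ r) atTop (𝓝 (x ^ r)) := fun hr hf =>
    hf.rpow_const (Or.inr hr.le)
  have hθ' : 0 < 1 - θ := by linarith
  have c1 : c₁ ≤ w 4 := ge_of_tendsto l4 (hσt.eventually hyc₁)
  have c2 : c₂ ≤ w 5 := ge_of_tendsto l5 (hσt.eventually hyc₂)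
  have := eq_zero_or_eq_zero_of_split h hG hD hDG
    (ge_of_tendsto' l0 fun j => ha₁ _) (ge_of_tendsto' l1 fun j => ha₂ _)
    (ge_of_tendsto' l2 fun j => hs₁ _) (ge_of_tendsto' l3 fun j => hs₂ _)
    (ge_of_tendsto' l4 fun j => hy₁ _) (ge_of_tendsto' l5 fun j => hy₂ _)
    (le_of_tendsto_of_tendsto' ((rp hp l0).add (rp hp l1)) (rp hp lA) fun j => hA _)
    (le_of_tendsto' ((rp hs l2).add (rp hs l3)) fun j => hS _)
    (by
      have := ge_of_tendsto' (((rp hq l4).add (rp hq l5)).add (rp hq lF)) fun j => hY (σ j)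
      rwa [Real.zero_rpow hq.ne', add_zero] at this)
    (by
      have := le_of_tendsto_of_tendsto' (l4.const_mul G) ((rp hθ0 (l0.add lE)).mul (rp hθ' l2))
        fun j => h₁ (σ j)
      rwa [add_zero] at this)
    (by
      have := le_of_tendsto_of_tendsto' (l5.const_mul G) ((rp hθ0 (l1.add lE)).mul (rp hθ' l3))
        fun j => h₂ (σ j)
      rwa [add_zero] at this)
  rcases this with h | h <;> linarith

/-- A minimizing sequence with a nontrivial local limit loses no `L^q` mass at infinity. -/
theorem IsMinimizing.tight (h : Admissible n p s q θ) (hm : IsMinimizing p s q θ D φ)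
    (hG : 0 < sharpConst n p s q θ) (hups : MemLp u (ENNReal.ofReal (n * p / (n - p))))
    (huq : MemLp u (ENNReal.ofReal q)) (hu0 : ¬ u =ᵐ[volume] 0)
    (hlocp : ∀ R : ℕ, Tendsto (fun k => eLpNorm (fun x => φ k x - u x) (ENNReal.ofReal p)
        (volume.restrict (Metric.closedBall 0 R))) atTop (𝓝 0))
    (hlocq : ∀ R : ℕ, Tendsto (fun k => eLpNorm (fun x => φ k x - u x) (ENNReal.ofReal q)
        (volume.restrict (Metric.closedBall 0 R))) atTop (𝓝 0)) :
    ∀ ε : ℝ≥0∞, 0 < ε → ∃ R : ℕ, ∀ᶠ k in atTop,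
      eLpNorm (φ k) (ENNReal.ofReal q) (volume.restrict (tailSet n R)) ≤ ε := by
  intro ε hε
  by_contra! H
  have hq1 := ENNReal.one_le_ofReal.2 h.one_lt_q.le
  obtain ⟨C, hC, hCR⟩ := exists_eLpNorm_smul_gradient_cutoff_le_tail h.one_lt_p h.p_lt_n
  obtain ⟨R₀, hR₀⟩ := exists_ball_eLpNorm_ne_zero (r := ENNReal.ofReal q) (zero_lt_one.trans_le hq1).ne'
    huq.1 hu0
  set c := eLpNorm u (ENNReal.ofReal q) (volume.restrict (Metric.closedBall 0 R₀)) with hc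
  have hct : c ≠ ⊤ := ((eLpNorm_mono_measure _ Measure.restrict_le_self).trans_lt huq.2).ne
  have hhalf := eventually_half_le_eLpNorm hq1
    (fun k => (hm.isTest k).aestronglyMeasurable.restrict) huq.1.restrict hct hR₀ (hlocq R₀)
  have hδ : ∀ j : ℕ, 0 < ((j + 1 : ℕ) : ℝ≥0∞)⁻¹ := fun j => by simp
  have hδ0 : Tendsto (fun j : ℕ => ((j + 1 : ℕ) : ℝ≥0∞)⁻¹) atTop (𝓝 0) :=
    ENNReal.tendsto_inv_nat_nhds_zero.comp (tendsto_add_atTop_nat 1)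
  have hsel : ∀ j : ℕ, ∃ k, j ≤ k ∧
      (eLpNorm (fun x => φ k x • gradient (cutoff (j + 1 : ℕ)) x) (ENNReal.ofReal p) volume ≤
        C * eLpNorm u (ENNReal.ofReal (n * p / (n - p))) (volume.restrict (tailSet n (j + 1 : ℕ)))
          + ((j + 1 : ℕ) : ℝ≥0∞)⁻¹ ∧
      eLpNorm (φ k) (ENNReal.ofReal q) (volume.restrict (annulus n (j + 1 : ℕ))) ≤
        eLpNorm u (ENNReal.ofReal q) (volume.restrict (tailSet n (j + 1 : ℕ)))
          + ((j + 1 : ℕ) : ℝ≥0∞)⁻¹) ∧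
      ε < eLpNorm (φ k) (ENNReal.ofReal q)
        (volume.restrict (tailSet n ((2 * (j + 1) : ℕ) : ℝ))) ∧
      c / 2 ≤ eLpNorm (φ k) (ENNReal.ofReal q) (volume.restrict (Metric.closedBall 0 R₀)) := by
    intro j
    obtain ⟨k, hk1, hk2, hk3, hk4⟩ := ((H (2 * (j + 1))).and_eventually
      ((eventually_ge_atTop j).and ((eventually_annulus_le h hm.isTest huq.1 hCR hlocp hlocq
        (Nat.succ_pos j) (hδ j)).and hhalf))).exists
    exact ⟨k, hk2, hk3, hk1, hk4⟩
  choose k hkj hk1 hk2 hk3 using hsel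
  have hεt : ε ≠ ⊤ := (lt_top_of_lt (hk2 0)).ne
  have hEt : ∀ j : ℕ, C * eLpNorm u (ENNReal.ofReal (n * p / (n - p)))
      (volume.restrict (tailSet n (j + 1 : ℕ))) + ((j + 1 : ℕ) : ℝ≥0∞)⁻¹ ≠ ⊤ := fun j =>
    ENNReal.add_ne_top.2 ⟨ENNReal.mul_ne_top hC
      ((eLpNorm_mono_measure _ Measure.restrict_le_self).trans_lt hups.2).ne, by simp⟩
  have hFt : ∀ j : ℕ, eLpNorm u (ENNReal.ofReal q)
      (volume.restrict (tailSet n (j + 1 : ℕ))) + ((j + 1 : ℕ) : ℝ≥0∞)⁻¹ ≠ ⊤ := fun j =>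
    ENNReal.add_ne_top.2
      ⟨((eLpNorm_mono_measure _ Measure.restrict_le_self).trans_lt huq.2).ne, by simp⟩
  choose a₁ a₂ s₁ s₂ y₁ y₂ ha₁ ha₂ hs₁ hs₂ hy₁ hy₂ hA hS hY hY' h₁ h₂ hin hout using fun j : ℕ =>
    split_inequalities h (hm.isTest (k j)) (hm.lNorm_s _) (hm.lNorm_q _)
      (by positivity : (0 : ℝ) < ((j + 1 : ℕ) : ℝ)) (hEt j) (hFt j) (hk1 j).1 (hk1 j).2
  have hps : 0 < n * p / (n - p) := h.q_pos.trans h.q_lt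
  have hkt : Tendsto k atTop atTop := tendsto_atTop_mono hkj tendsto_id
  have hE0 : Tendsto (fun j : ℕ => (C * eLpNorm u (ENNReal.ofReal (n * p / (n - p)))
      (volume.restrict (tailSet n (j + 1 : ℕ))) + ((j + 1 : ℕ) : ℝ≥0∞)⁻¹).toReal) atTop (𝓝 0) := by
    have t1 := (ENNReal.Tendsto.const_mul (a := C) ((tendsto_eLpNorm_tail hps hups).comp
      (tendsto_add_atTop_nat 1)) (Or.inr hC)).add hδ0
    rw [mul_zero, add_zero] at t1
    have t2 := (ENNReal.tendsto_toReal ENNReal.zero_ne_top).comp t1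
    rwa [ENNReal.toReal_zero] at t2
  have hF0 : Tendsto (fun j : ℕ => (eLpNorm u (ENNReal.ofReal q)
      (volume.restrict (tailSet n (j + 1 : ℕ))) + ((j + 1 : ℕ) : ℝ≥0∞)⁻¹).toReal) atTop (𝓝 0) := by
    have t1 := ((tendsto_eLpNorm_tail h.q_pos huq).comp (tendsto_add_atTop_nat 1)).add hδ0
    rw [add_zero] at t1
    have t2 := (ENNReal.tendsto_toReal ENNReal.zero_ne_top).comp t1
    rwa [ENNReal.toReal_zero] at t2
  refine not_split_sequence h hG (hm.pos h.theta_mem.1 hG) hm.rpow_eq ha₁ ha₂ hs₁ hs₂ hy₁ hy₂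
    (fun j => lNorm_nonneg _) hA (hm.tendsto.comp hkt) hE0 hF0 hS hY hY' h₁ h₂
    (c₁ := (c / 2).toReal) (c₂ := ε.toReal)
    (ENNReal.toReal_pos (ENNReal.half_pos hR₀).ne' (ENNReal.div_ne_top hct (by simp)))
    (ENNReal.toReal_pos hε.ne' hεt) ?_ (Eventually.of_forall fun j => ?_)
  · filter_upwards [eventually_ge_atTop R₀] with j hj
    refine ENNReal.toReal_le_of_le_ofReal (hy₁ j) (le_trans ?_ (hin j))
    refine (hk3 j).trans (eLpNorm_restrict_mono
      (Metric.closedBall_subset_closedBall ?_) _ _)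
    exact_mod_cast hj.trans (Nat.le_succ j)
  · refine ENNReal.toReal_le_of_le_ofReal (hy₂ j) ((hk2 j).le.trans ((hout j).trans' ?_))
    push_cast
    exact le_rfl

end Minimizing

/-! ### The limit of a minimizing sequence is optimal -/

section Limit

variable {n : ℕ} {p s q θ D : ℝ} {φ : ℕ → Eucl n → ℝ} {u : Eucl n → ℝ}

/-- Local convergence and tightness give convergence in `L^q`. -/
theorem IsMinimizing.tendsto_eLpNorm (h : Admissible n p s q θ) (hm : IsMinimizing p s q θ D φ)
    (hG : 0 < sharpConst n p s q θ) (hups : MemLp u (ENNReal.ofReal (n * p / (n - p))))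
    (huq : MemLp u (ENNReal.ofReal q)) (hu0 : ¬ u =ᵐ[volume] 0)
    (hlocp : ∀ R : ℕ, Tendsto (fun k => eLpNorm (fun x => φ k x - u x) (ENNReal.ofReal p)
        (volume.restrict (Metric.closedBall 0 R))) atTop (𝓝 0))
    (hlocq : ∀ R : ℕ, Tendsto (fun k => eLpNorm (fun x => φ k x - u x) (ENNReal.ofReal q)
        (volume.restrict (Metric.closedBall 0 R))) atTop (𝓝 0)) :
    Tendsto (fun k => eLpNorm (fun x => φ k x - u x) (ENNReal.ofReal q) volume) atTop (𝓝 0) := by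
  have hq1 := ENNReal.one_le_ofReal.2 h.one_lt_q.le
  rw [ENNReal.tendsto_nhds_zero]
  intro ε hε
  have hε3 : 0 < ε / 3 := ENNReal.div_pos hε.ne' (by simp)
  obtain ⟨R₁, hR₁⟩ := hm.tight h hG hups huq hu0 hlocp hlocq (ε / 3) hε3
  obtain ⟨R₂, hR₂⟩ := eventually_atTop.1
    ((ENNReal.tendsto_nhds_zero.1 (tendsto_eLpNorm_tail h.q_pos huq)) (ε / 3) hε3)
  have hanti : ∀ {a b : ℕ}, a ≤ b → tailSet n (b : ℝ) ⊆ tailSet n (a : ℝ) := fun hab x hx =>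
    le_trans (by exact_mod_cast hab) (show ((_ : ℕ) : ℝ) ≤ ‖x‖ from hx)
  filter_upwards [hR₁, (ENNReal.tendsto_nhds_zero.1 (hlocq (max R₁ R₂))) (ε / 3) hε3]
    with k hk1 hk2
  have hmk := (hm.isTest k).aestronglyMeasurable
  calc _ ≤ _ := eLpNorm_le_ball_add_tail hq1 (hmk.sub huq.1) (max R₁ R₂ : ℕ)
    _ ≤ ε / 3 + (ε / 3 + ε / 3) := by
        refine add_le_add hk2 ((eLpNorm_sub_le hmk.restrict huq.1.restrict hq1).trans
          (add_le_add ?_ ?_))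
        · exact (eLpNorm_restrict_mono (hanti (le_max_left _ _)) _ _).trans hk1
        · exact hR₂ _ (le_max_right _ _)
    _ = ε := by
        rw [← add_assoc]
        exact ENNReal.add_thirds ε

theorem IsMinimizing.lNorm_limit (h : Admissible n p s q θ) (hm : IsMinimizing p s q θ D φ)
    (huq : MemLp u (ENNReal.ofReal q))
    (hlim : Tendsto (fun k => eLpNorm (fun x => φ k x - u x) (ENNReal.ofReal q) volume)
      atTop (𝓝 0)) : lNorm q u = 1 := by
  have h1 := tendsto_lNorm_of_tendsto_eLpNorm h.one_lt_q.le
    (fun k => (hm.isTest k).memLp _) huq hlim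
  simp only [hm.lNorm_q] at h1
  exact tendsto_nhds_unique h1 tendsto_const_nhds

/-- Midpoints of a minimizing sequence that converges in `L^q` are almost minimizing, so that their
gradient norms do not drop. -/
theorem IsMinimizing.midpoint_norms (h : Admissible n p s q θ) (hm : IsMinimizing p s q θ D φ)
    (hG : 0 < sharpConst n p s q θ) (huq : MemLp u (ENNReal.ofReal q))
    (hlim : Tendsto (fun k => eLpNorm (fun x => φ k x - u x) (ENNReal.ofReal q) volume)
      atTop (𝓝 0)) :
    ∀ ε > 0, ∃ N, ∀ m ≥ N, ∀ k ≥ N, D ^ p - ε ≤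
      ∫ x, ‖(2⁻¹ : ℝ) • (gradient (φ m) x + gradient (φ k) x)‖ ^ p := by
  intro ε hε
  obtain ⟨hθ0, hθ1⟩ := h.theta_mem
  have hp := h.p_pos
  have hD := hm.pos hθ0 hG
  have hq1 := h.one_lt_q.le
  have hQu := hm.lNorm_limit h huq hlim
  -- the lower bound `(D (1 - δ) ^ (1 / θ)) ^ p` tends to `D ^ p`
  have hcont : Tendsto (fun δ : ℝ => (D * (1 - δ) ^ (1 / θ)) ^ p) (𝓝 0) (𝓝 (D ^ p)) := by
    have h1 : Tendsto (fun δ : ℝ => 1 - δ) (𝓝 0) (𝓝 1) := by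
      simpa using (tendsto_const_nhds (x := (1 : ℝ))).sub (tendsto_id (α := ℝ) (x := 𝓝 0))
    have h2 := ((h1.rpow_const (p := 1 / θ) (Or.inl one_ne_zero)).const_mul D).rpow_const
      (p := p) (Or.inr hp.le)
    simpa using h2
  have hev : ∀ᶠ δ : ℝ in 𝓝 0, D ^ p - ε ≤ (D * (1 - δ) ^ (1 / θ)) ^ p :=
    hcont.eventually (eventually_ge_nhds (by linarith))
  obtain ⟨r, hr, hrδ⟩ := Metric.eventually_nhds_iff.1 hev
  set δ := min (r / 2) 1 with hδ
  have hδ0 : 0 < δ := by positivity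
  have hδ1 : δ ≤ 1 := min_le_right _ _
  have hδε : D ^ p - ε ≤ (D * (1 - δ) ^ (1 / θ)) ^ p := by
    refine hrδ ?_
    rw [Real.dist_eq, sub_zero, abs_of_pos hδ0]
    exact (min_le_left _ _).trans_lt (by linarith)
  have hreal : Tendsto (fun k => lNorm q (fun x => φ k x - u x)) atTop (𝓝 0) := by
    have := (ENNReal.tendsto_toReal ENNReal.zero_ne_top).comp hlim
    rwa [ENNReal.toReal_zero] at this
  obtain ⟨N, hN⟩ := eventually_atTop.1 (hreal.eventually (eventually_le_nhds hδ0))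
  refine ⟨N, fun m hm' k hk => ?_⟩
  have t : IsTest (fun x => (2⁻¹ : ℝ) * (φ m x + φ k x)) :=
    ((hm.isTest m).add (hm.isTest k)).const_mul _
  have hgrad : (gradient fun x => (2⁻¹ : ℝ) * (φ m x + φ k x)) =
      fun x => (2⁻¹ : ℝ) • (gradient (φ m) x + gradient (φ k) x) := by
    ext1 x
    rw [gradient_fun_const_mul ((hm.isTest m).add (hm.isTest k)),
      gradient_fun_add (hm.isTest m) (hm.isTest k)]
  have hs : lNorm s (fun x => (2⁻¹ : ℝ) * (φ m x + φ k x)) ≤ 1 := by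
    have h1 := lNorm_add_le h.one_le_s ((hm.isTest m).memLp _) ((hm.isTest k).memLp _)
    rw [hm.lNorm_s, hm.lNorm_s] at h1
    rw [lNorm_const_mul, abs_of_pos (by norm_num)]
    linarith
  have hq : 1 - δ ≤ lNorm q (fun x => (2⁻¹ : ℝ) * (φ m x + φ k x)) := by
    have m1 : MemLp (fun x => φ m x - u x) (ENNReal.ofReal q) := ((hm.isTest m).memLp _).sub huq
    have m2 : MemLp (fun x => φ k x - u x) (ENNReal.ofReal q) := ((hm.isTest k).memLp _).sub huq
    have h1 := lNorm_add_le hq1 m1 m2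
    have h2 := abs_lNorm_sub_lNorm_le hq1 (t.memLp _) huq
    have e : lNorm q (fun x => (2⁻¹ : ℝ) * (φ m x + φ k x) - u x) =
        2⁻¹ * lNorm q (fun x => (φ m x - u x) + (φ k x - u x)) := by
      rw [← abs_of_pos (by norm_num : (0 : ℝ) < 2⁻¹), ← lNorm_const_mul,
        abs_of_pos (by norm_num : (0 : ℝ) < 2⁻¹)]
      congr 1
      ext x
      ring
    rw [e, hQu] at h2
    have h3 := (abs_le.1 h2).1
    have := hN m hm'
    have := hN k hk
    linarith
  have hGN := t.sharpConst_mul_lNorm_le (q := q) (θ := θ) h.one_lt_p.le h.one_le_s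
  rw [hgrad] at hGN
  have mg : MemLp (fun x => (2⁻¹ : ℝ) • (gradient (φ m) x + gradient (φ k) x))
      (ENNReal.ofReal p) := by
    rw [← hgrad]
    exact t.memLp_gradient _
  rw [integral_norm_rpow_eq_lNorm hp mg]
  refine hδε.trans (Real.rpow_le_rpow (mul_nonneg hD.le (Real.rpow_nonneg (by linarith) _)) ?_ hp.le)
  set A := lNorm p (fun x => (2⁻¹ : ℝ) • (gradient (φ m) x + gradient (φ k) x)) with hA
  have hA0 : 0 ≤ A := lNorm_nonneg _
  have h1 : sharpConst n p s q θ * (1 - δ) ≤ A ^ θ := by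
    calc _ ≤ sharpConst n p s q θ * lNorm q (fun x => (2⁻¹ : ℝ) * (φ m x + φ k x)) := by gcongr
      _ ≤ _ := hGN
      _ ≤ A ^ θ * 1 := by
          gcongr
          exact Real.rpow_le_one (lNorm_nonneg _) hs (by linarith)
      _ = _ := mul_one _
  rw [← hm.rpow_eq] at h1
  have h2 := Real.rpow_le_rpow (mul_nonneg (by positivity) (by linarith)) h1
    (by positivity : 0 ≤ 1 / θ)
  rwa [Real.mul_rpow (by positivity) (by linarith), ← Real.rpow_mul hD.le,
    ← Real.rpow_mul hA0, mul_one_div_cancel hθ0.ne', Real.rpow_one, Real.rpow_one] at h2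

/-- The gradients of a minimizing sequence that converges in `L^q` converge strongly in `L^p`. -/
theorem IsMinimizing.exists_gradient_limit (h : Admissible n p s q θ)
    (hm : IsMinimizing p s q θ D φ) (hG : 0 < sharpConst n p s q θ)
    (huq : MemLp u (ENNReal.ofReal q))
    (hlim : Tendsto (fun k => eLpNorm (fun x => φ k x - u x) (ENNReal.ofReal q) volume)
      atTop (𝓝 0)) :
    ∃ V : Eucl n → Eucl n, MemLp V (ENNReal.ofReal p) ∧
      Tendsto (fun k => eLpNorm (fun x => gradient (φ k) x - V x) (ENNReal.ofReal p) volume)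
        atTop (𝓝 0) := by
  have hp := h.p_pos
  have hp1 := ENNReal.one_le_ofReal.2 h.one_lt_p.le
  have hmem := fun k => (hm.isTest k).memLp_gradient (ENNReal.ofReal p)
  have hc := cauchy_of_midpoint_norms h.one_lt_p hmem (D := D ^ p) (by
    refine (hm.tendsto.rpow_const (Or.inr hp.le)).congr fun k => ?_
    rw [integral_norm_rpow_eq_lNorm hp (hmem k)]) (hm.midpoint_norms h hG huq hlim)
  have : Fact (1 ≤ ENNReal.ofReal p) := ⟨hp1⟩
  have hcs : CauchySeq fun k => (hmem k).toLp (gradient (φ k)) := by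
    rw [Metric.cauchySeq_iff]
    intro ε hε
    obtain ⟨N, hN⟩ := hc ((ε / 2) ^ p) (by positivity)
    refine ⟨N, fun m hm' k hk => ?_⟩
    rw [Lp.dist_edist, Lp.edist_toLp_toLp]
    have h1 := hN m hm' k hk
    have e : ∫ x, ‖gradient (φ m) x - gradient (φ k) x‖ ^ p =
        lNorm p (gradient (φ m) - gradient (φ k)) ^ p :=
      integral_norm_rpow_eq_lNorm hp ((hmem m).sub (hmem k))
    rw [e, Real.rpow_le_rpow_iff (lNorm_nonneg _) (by positivity) hp] at h1
    exact h1.trans_lt (by linarith)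
  obtain ⟨V, hV⟩ := cauchySeq_tendsto_of_complete hcs
  refine ⟨V, Lp.memLp V, ?_⟩
  rw [Lp.tendsto_Lp_iff_tendsto_eLpNorm'] at hV
  refine hV.congr fun k => eLpNorm_congr_ae ?_
  filter_upwards [(hmem k).coeFn_toLp] with x hx
  simp [hx]

/-- Membership of the limit in `D^{p,s}`: the cut functions `η_R φ_k`, with `k` large depending on
`R`, approximate it. -/
theorem memD_of_local_limit (h : Admissible n p s q θ) (hφ : ∀ k, IsTest (φ k))
    (hus : MemLp u (ENNReal.ofReal s)) (hups : MemLp u (ENNReal.ofReal (n * p / (n - p))))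
    {V : Eucl n → Eucl n} (hV : MemLp V (ENNReal.ofReal p))
    (hφV : Tendsto (fun k => eLpNorm (fun x => gradient (φ k) x - V x) (ENNReal.ofReal p) volume)
        atTop (𝓝 0))
    (hlocp : ∀ R : ℕ, Tendsto (fun k => eLpNorm (fun x => φ k x - u x) (ENNReal.ofReal p)
        (volume.restrict (Metric.closedBall 0 R))) atTop (𝓝 0))
    (hlocq : ∀ R : ℕ, Tendsto (fun k => eLpNorm (fun x => φ k x - u x) (ENNReal.ofReal q)
        (volume.restrict (Metric.closedBall 0 R))) atTop (𝓝 0)) :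
    MemD p s u ∧ weakGrad u =ᵐ[volume] V := by
  have hp := h.p_pos
  have hs := h.s_pos
  have hp1 := ENNReal.one_le_ofReal.2 h.one_lt_p.le
  have hs1 := ENNReal.one_le_ofReal.2 h.one_le_s
  have hps : 0 < n * p / (n - p) := h.q_pos.trans h.q_lt
  obtain ⟨C, hC, hCR⟩ := exists_eLpNorm_smul_gradient_cutoff_le_tail h.one_lt_p h.p_lt_n
  have hlocs : ∀ R : ℕ, Tendsto (fun k => eLpNorm (fun x => φ k x - u x) (ENNReal.ofReal s)
      (volume.restrict (Metric.closedBall 0 R))) atTop (𝓝 0) := by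
    intro R
    have hv : volume (Metric.closedBall (0 : Eucl n) R) ^ (1 / s - 1 / q) ≠ ⊤ :=
      ENNReal.rpow_ne_top_of_nonneg (sub_nonneg.2 (one_div_le_one_div_of_le hs h.s_lt_q.le))
        measure_closedBall_lt_top.ne
    have h1 := ENNReal.Tendsto.mul_const (hlocq R) (Or.inr hv)
    rw [zero_mul] at h1
    refine tendsto_of_tendsto_of_tendsto_of_le_of_le tendsto_const_nhds h1
      (fun _ => bot_le) fun k => ?_
    have h2 := eLpNorm_le_eLpNorm_mul_rpow_measure_univ (ENNReal.ofReal_le_ofReal h.s_lt_q.le)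
      (((hφ k).aestronglyMeasurable.sub hus.1).restrict (s := Metric.closedBall 0 (R : ℝ)))
    rwa [ENNReal.toReal_ofReal hs.le, ENNReal.toReal_ofReal h.q_pos.le,
      Measure.restrict_apply_univ] at h2
  have hδ : ∀ j : ℕ, 0 < ((j + 1 : ℕ) : ℝ≥0∞)⁻¹ := fun j => by simp
  have hδ0 : Tendsto (fun j : ℕ => ((j + 1 : ℕ) : ℝ≥0∞)⁻¹) atTop (𝓝 0) :=
    ENNReal.tendsto_inv_nat_nhds_zero.comp (tendsto_add_atTop_nat 1)
  have hsel : ∀ j : ℕ, ∃ k,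
      eLpNorm (fun x => φ k x • gradient (cutoff (j + 1 : ℕ)) x) (ENNReal.ofReal p) volume ≤
        C * eLpNorm u (ENNReal.ofReal (n * p / (n - p))) (volume.restrict (tailSet n (j + 1 : ℕ)))
          + ((j + 1 : ℕ) : ℝ≥0∞)⁻¹ ∧
      eLpNorm (fun x => gradient (φ k) x - V x) (ENNReal.ofReal p) volume
        ≤ ((j + 1 : ℕ) : ℝ≥0∞)⁻¹ ∧
      eLpNorm (fun x => φ k x - u x) (ENNReal.ofReal s)
        (volume.restrict (Metric.closedBall 0 ((2 * (j + 1) : ℕ) : ℝ)))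
        ≤ ((j + 1 : ℕ) : ℝ≥0∞)⁻¹ := by
    intro j
    obtain ⟨k, hk1, hk2, hk3⟩ := ((eventually_annulus_le h hφ hus.1 hCR hlocp hlocq
        (Nat.succ_pos j) (hδ j)).and (((ENNReal.tendsto_nhds_zero.1 hφV) _ (hδ j)).and
        ((ENNReal.tendsto_nhds_zero.1 (hlocs (2 * (j + 1)))) _ (hδ j)))).exists
    exact ⟨k, hk1.1, hk2, hk3⟩
  choose k hk1 hk2 hk3 using hsel
  have hR : ∀ j : ℕ, (0 : ℝ) < ((j + 1 : ℕ) : ℝ) := fun j => by positivity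
  refine MemD.of_tendsto h.one_lt_p.le h.one_le_s hus hV
    (φ := fun j x => cutoff (j + 1 : ℕ) x * φ (k j) x)
    (fun j => (hφ _).mul_left (isTest_cutoff (hR j)).1) ?_ ?_
  · have t1 : Tendsto (fun j : ℕ => ((j + 1 : ℕ) : ℝ≥0∞)⁻¹ + eLpNorm V (ENNReal.ofReal p)
        (volume.restrict (tailSet n (j + 1 : ℕ))) + (C * eLpNorm u
        (ENNReal.ofReal (n * p / (n - p))) (volume.restrict (tailSet n (j + 1 : ℕ)))
          + ((j + 1 : ℕ) : ℝ≥0∞)⁻¹)) atTop (𝓝 0) := by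
      have := (hδ0.add ((tendsto_eLpNorm_tail hp hV).comp (tendsto_add_atTop_nat 1))).add
        ((ENNReal.Tendsto.const_mul (a := C) ((tendsto_eLpNorm_tail hps hups).comp
        (tendsto_add_atTop_nat 1)) (Or.inr hC)).add hδ0)
      simp only [mul_zero, add_zero] at this
      exact this
    refine tendsto_of_tendsto_of_tendsto_of_le_of_le tendsto_const_nhds t1
      (fun _ => bot_le) fun j => ?_
    have hη := isTest_cutoff (n := n) (hR j)
    have e : (fun x => gradient (fun x => cutoff (j + 1 : ℕ) x * φ (k j) x) x - V x) =
        ((fun x => cutoff (j + 1 : ℕ) x • (gradient (φ (k j)) x - V x)) -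
          fun x => (1 - cutoff (j + 1 : ℕ) x) • V x) +
          fun x => φ (k j) x • gradient (cutoff (j + 1 : ℕ)) x := by
      ext1 x
      simp only [Pi.add_apply, Pi.sub_apply]
      rw [gradient_cutoff_mul (hR j) (hφ _), smul_sub, sub_smul, one_smul]
      abel
    have m1 : AEStronglyMeasurable (fun x => cutoff (j + 1 : ℕ) x • (gradient (φ (k j)) x - V x))
        volume := hη.aestronglyMeasurable.smul (((hφ _).memLp_gradient 1).1.sub hV.1)
    have m2 : AEStronglyMeasurable (fun x => (1 - cutoff (j + 1 : ℕ) x) • V x) volume :=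
      (continuous_const.sub hη.continuous).aestronglyMeasurable.smul hV.1
    have m3 : AEStronglyMeasurable (fun x => φ (k j) x • gradient (cutoff (j + 1 : ℕ)) x) volume :=
      (hφ _).aestronglyMeasurable.smul (hη.memLp_gradient 1).1
    rw [e]
    refine (eLpNorm_add_le (m1.sub m2) m3 hp1).trans (add_le_add
      ((eLpNorm_sub_le m1 m2 hp1).trans (add_le_add ?_ ?_)) (hk1 j))
    · refine (eLpNorm_mono fun x => ?_).trans (hk2 j)
      rw [norm_smul, Real.norm_of_nonneg (cutoff_nonneg _ _)]
      exact mul_le_of_le_one_left (norm_nonneg _) (cutoff_le_one _ _)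
    · rw [← eLpNorm_indicator_eq_eLpNorm_restrict (measurableSet_tailSet _)]
      refine eLpNorm_mono fun x => ?_
      by_cases hx : x ∈ tailSet n ((j + 1 : ℕ) : ℝ)
      · rw [Set.indicator_of_mem hx, norm_smul,
          Real.norm_of_nonneg (sub_nonneg.2 (cutoff_le_one _ _))]
        exact mul_le_of_le_one_left (norm_nonneg _) (by linarith [cutoff_nonneg ((j + 1 : ℕ) : ℝ) x])
      · rw [cutoff_eq_one (hR j) (le_of_lt (not_le.1 hx)), sub_self, zero_smul, norm_zero]
        exact norm_nonneg _
  · have t1 : Tendsto (fun j : ℕ => ((j + 1 : ℕ) : ℝ≥0∞)⁻¹ + eLpNorm u (ENNReal.ofReal s)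
        (volume.restrict (tailSet n (j + 1 : ℕ)))) atTop (𝓝 0) := by
      have := hδ0.add ((tendsto_eLpNorm_tail hs hus).comp (tendsto_add_atTop_nat 1))
      rw [add_zero] at this
      exact this
    refine tendsto_of_tendsto_of_tendsto_of_le_of_le tendsto_const_nhds t1
      (fun _ => bot_le) fun j => ?_
    have hη := isTest_cutoff (n := n) (hR j)
    have e : (fun x => cutoff (j + 1 : ℕ) x * φ (k j) x - u x) =
        (fun x => cutoff (j + 1 : ℕ) x * (φ (k j) x - u x)) -
          fun x => (1 - cutoff (j + 1 : ℕ) x) * u x := by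
      ext1 x
      simp only [Pi.sub_apply]
      ring
    have m1 : AEStronglyMeasurable (fun x => cutoff (j + 1 : ℕ) x * (φ (k j) x - u x)) volume :=
      hη.aestronglyMeasurable.mul ((hφ _).aestronglyMeasurable.sub hus.1)
    have m2 : AEStronglyMeasurable (fun x => (1 - cutoff (j + 1 : ℕ) x) * u x) volume :=
      (continuous_const.sub hη.continuous).aestronglyMeasurable.mul hus.1
    rw [e]
    refine (eLpNorm_sub_le m1 m2 hs1).trans (add_le_add ?_ ?_)
    · refine le_trans ?_ (hk3 j)
      rw [← eLpNorm_indicator_eq_eLpNorm_restrict Metric.isClosed_closedBall.measurableSet]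
      refine eLpNorm_mono fun x => ?_
      by_cases hx : x ∈ Metric.closedBall (0 : Eucl n) ((2 * (j + 1) : ℕ) : ℝ)
      · rw [Set.indicator_of_mem hx, norm_mul, Real.norm_of_nonneg (cutoff_nonneg _ _)]
        exact mul_le_of_le_one_left (norm_nonneg _) (cutoff_le_one _ _)
      · rw [cutoff_eq_zero (hR j), zero_mul, norm_zero]
        · exact norm_nonneg _
        · rw [mem_closedBall_zero_iff, not_le] at hx
          push_cast at hx ⊢
          exact hx.le
    · rw [← eLpNorm_indicator_eq_eLpNorm_restrict (measurableSet_tailSet _)]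
      refine eLpNorm_mono fun x => ?_
      by_cases hx : x ∈ tailSet n ((j + 1 : ℕ) : ℝ)
      · rw [Set.indicator_of_mem hx, norm_mul,
          Real.norm_of_nonneg (sub_nonneg.2 (cutoff_le_one _ _))]
        exact mul_le_of_le_one_left (norm_nonneg _) (by linarith [cutoff_nonneg ((j + 1 : ℕ) : ℝ) x])
      · rw [cutoff_eq_one (hR j) (le_of_lt (not_le.1 hx)), sub_self, zero_mul, norm_zero]
        exact norm_nonneg _

/-- A minimizing sequence with a nontrivial almost everywhere and local limit converges in `L^q`,
and the limit is optimal. -/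
theorem IsMinimizing.isOptimal_limit (h : Admissible n p s q θ) (hm : IsMinimizing p s q θ D φ)
    (hG : 0 < sharpConst n p s q θ) (hus : MemLp u (ENNReal.ofReal s)) (hus1 : lNorm s u ≤ 1)
    (hups : MemLp u (ENNReal.ofReal (n * p / (n - p))))
    (huq : MemLp u (ENNReal.ofReal q)) (hu0 : ¬ u =ᵐ[volume] 0)
    (hlocp : ∀ R : ℕ, Tendsto (fun k => eLpNorm (fun x => φ k x - u x) (ENNReal.ofReal p)
        (volume.restrict (Metric.closedBall 0 R))) atTop (𝓝 0))
    (hlocq : ∀ R : ℕ, Tendsto (fun k => eLpNorm (fun x => φ k x - u x) (ENNReal.ofReal q)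
        (volume.restrict (Metric.closedBall 0 R))) atTop (𝓝 0)) :
    IsOptimal p s q θ u ∧
      Tendsto (fun k => eLpNorm (fun x => φ k x - u x) (ENNReal.ofReal q) volume) atTop (𝓝 0) := by
  have hlim := hm.tendsto_eLpNorm h hG hups huq hu0 hlocp hlocq
  obtain ⟨V, hV, hφV⟩ := hm.exists_gradient_limit h hG huq hlim
  obtain ⟨hD, hgV⟩ := memD_of_local_limit h hm.isTest hus hups hV hφV hlocp hlocq
  refine ⟨⟨⟨hD, hu0⟩, le_antisymm (sharpConst_mul_lNorm_le hD) ?_⟩, hlim⟩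
  have hQu := hm.lNorm_limit h huq hlim
  have hAV : lNorm p V = D :=
    tendsto_nhds_unique (tendsto_lNorm_of_tendsto_eLpNorm h.one_lt_p.le
      (fun k => (hm.isTest k).memLp_gradient _) hV hφV) hm.tendsto
  rw [lNorm_congr_ae hgV, hAV, hQu, hm.rpow_eq]
  exact mul_le_mul_of_nonneg_left (Real.rpow_le_one (lNorm_nonneg _) hus1
    (by linarith [h.theta_mem.2])) hG.le

end Limit

/-! ### Affine changes of variables -/

section Affine

variable {n : ℕ} {F : Type*} [NormedAddCommGroup F]

theorem map_affine_volume {b : ℝ} (hb : 0 < b) (y : Eucl n) :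
    Measure.map (fun x : Eucl n => b • x + y) volume
      = ENNReal.ofReal ((b ^ n)⁻¹) • (volume : Measure (Eucl n)) := by
  have h1 : (fun x : Eucl n => b • x + y) = (fun x => x + y) ∘ fun x => b • x := rfl
  rw [h1, ← Measure.map_map (measurable_add_const y) (measurable_const_smul b),
    Measure.map_addHaar_smul _ hb.ne', finrank_euclideanSpace_fin, abs_of_pos (by positivity),
    Measure.map_smul, map_add_right_eq_self]

theorem eLpNorm_comp_affine {b : ℝ} (hb : 0 < b) (y : Eucl n) {r : ℝ} (hr : 0 < r)
    (f : Eucl n → F) :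
    eLpNorm (fun x => f (b • x + y)) (ENNReal.ofReal r) volume
      = ENNReal.ofReal (b ^ (-(n / r))) * eLpNorm f (ENNReal.ofReal r) volume := by
  have hT : MeasurableEmbedding fun x : Eucl n => b • x + y :=
    ((Homeomorph.smulOfNeZero b hb.ne').trans (Homeomorph.addRight y)).measurableEmbedding
  have h1 := hT.eLpNorm_map_measure (μ := volume) (g := f) (p := ENNReal.ofReal r)
  rw [map_affine_volume hb, eLpNorm_smul_measure_of_ne_top (by simp)] at h1
  change eLpNorm (f ∘ fun x : Eucl n => b • x + y) _ _ = _
  rw [← h1, smul_eq_mul, ENNReal.ofReal_rpow_of_nonneg (by positivity) (by positivity)]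
  congr 2
  rw [ENNReal.toReal_div, ENNReal.toReal_ofReal hr.le, ENNReal.toReal_one, Real.rpow_neg hb.le,
    Real.inv_rpow (by positivity), ← Real.rpow_natCast, ← Real.rpow_mul hb.le, mul_one_div]

theorem lNorm_comp_affine {b : ℝ} (hb : 0 < b) (y : Eucl n) {r : ℝ} (hr : 0 < r)
    (f : Eucl n → F) :
    lNorm r (fun x => f (b • x + y)) = b ^ (-(n / r)) * lNorm r f := by
  rw [lNorm, eLpNorm_comp_affine hb y hr, ENNReal.toReal_mul, ENNReal.toReal_ofReal (by positivity),
    lNorm]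

theorem MemLp.comp_affine {b : ℝ} (hb : 0 < b) (y : Eucl n) {r : ℝ} (hr : 0 < r)
    {f : Eucl n → F} (hf : MemLp f (ENNReal.ofReal r)) :
    MemLp (fun x => f (b • x + y)) (ENNReal.ofReal r) := by
  refine ⟨?_, ?_⟩
  · have hq : Measure.QuasiMeasurePreserving (fun x : Eucl n => b • x + y) volume volume :=
      ⟨by fun_prop, by
        rw [map_affine_volume hb]
        exact Measure.smul_absolutelyContinuous⟩
    exact hf.1.comp_quasiMeasurePreserving hq
  · rw [eLpNorm_comp_affine hb y hr]
    exact ENNReal.mul_lt_top ENNReal.ofReal_lt_top hf.2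

/-- The balance of the exponents is the invariance of the inequality under dilations. -/
theorem Admissible.product_comp_affine {p s q θ : ℝ} (h : Admissible n p s q θ) {a b : ℝ}
    (ha : 0 < a) (hb : 0 < b) (y : Eucl n) (V : Eucl n → Eucl n) (f : Eucl n → ℝ) :
    lNorm p (fun x => (a * b) • V (b • x + y)) ^ θ * lNorm s (fun x => a * f (b • x + y)) ^ (1 - θ)
      = a * b ^ (-(n / q)) * (lNorm p V ^ θ * lNorm s f ^ (1 - θ)) := by
  have hp := h.p_pos
  have hn := h.n_pos
  have hnp : 0 < (n : ℝ) - p := by linarith [h.p_lt_n]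
  have he : (1 + -(n / p)) * θ + -(n / s) * (1 - θ) = -(n / q) := by
    have h1 : (n : ℝ) / q = n * (θ / (n * p / (n - p)) + (1 - θ) / s) := by
      rw [h.balance]
      ring
    rw [h1]
    have h2 : (n : ℝ) * (θ / (n * p / (n - p))) = -((1 + -(n / p)) * θ) := by
      field_simp
      ring
    rw [mul_add, h2]
    ring
  have haa : a ^ θ * a ^ (1 - θ) = a := by
    rw [← Real.rpow_add ha]
    simp
  have hbb : (b * b ^ (-(n / p))) ^ θ * (b ^ (-(n / s))) ^ (1 - θ) = b ^ (-(n / q)) := by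
    rw [← he, Real.rpow_add hb, Real.rpow_mul hb.le, Real.rpow_mul hb.le, Real.rpow_add hb,
      Real.rpow_one]
  rw [lNorm_const_smul, lNorm_const_mul, lNorm_comp_affine hb y hp, lNorm_comp_affine hb y h.s_pos,
    abs_of_pos (by positivity), abs_of_pos ha]
  have e1 : a * b * (b ^ (-(n / p)) * lNorm p V) = a * (b * b ^ (-(n / p))) * lNorm p V := by ring
  have e2 : a * (b ^ (-(n / s)) * lNorm s f) = a * b ^ (-(n / s)) * lNorm s f := by ring
  rw [e1, e2, Real.mul_rpow (x := a * (b * b ^ (-(n / p)))) (by positivity) (lNorm_nonneg _),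
    Real.mul_rpow (x := a) (y := b * b ^ (-(n / p))) ha.le (by positivity),
    Real.mul_rpow (x := a * b ^ (-(n / s))) (by positivity) (lNorm_nonneg _),
    Real.mul_rpow (x := a) (y := b ^ (-(n / s))) ha.le (by positivity)]
  calc _ = (a ^ θ * a ^ (1 - θ)) * ((b * b ^ (-(n / p))) ^ θ * (b ^ (-(n / s))) ^ (1 - θ)) *
        (lNorm p V ^ θ * lNorm s f ^ (1 - θ)) := by ring
    _ = _ := by rw [haa, hbb]

theorem lNorm_const_mul_comp_affine {r : ℝ} (hr : 0 < r) {a b : ℝ} (ha : 0 < a) (hb : 0 < b)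
    (y : Eucl n) (f : Eucl n → ℝ) :
    lNorm r (fun x => a * f (b • x + y)) = a * b ^ (-(n / r)) * lNorm r f := by
  rw [lNorm_const_mul, lNorm_comp_affine hb y hr, abs_of_pos ha, mul_assoc]

theorem gradient_const_mul_comp_affine {φ : Eucl n → ℝ} (hφ : IsTest φ) (a : ℝ) {b : ℝ}
    (hb : b ≠ 0) (y : Eucl n) : (gradient fun x => a * φ (b • x + y)) =
      fun x => (a * b) • gradient φ (b • x + y) := by
  ext1 x
  rw [gradient_fun_const_mul (hφ.comp_affine hb y), gradient_comp_affine hφ, smul_smul]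

/-- `D^{p,s}` is invariant under affine changes of variables. -/
theorem MemD.comp_affine {p s : ℝ} (hp : 1 ≤ p) (hs : 1 ≤ s) {u : Eucl n → ℝ} (hu : MemD p s u)
    {a b : ℝ} (hb : 0 < b) (y : Eucl n) :
    MemD p s (fun x => a * u (b • x + y)) ∧
      weakGrad (fun x => a * u (b • x + y)) =ᵐ[volume]
        fun x => (a * b) • weakGrad u (b • x + y) := by
  obtain ⟨φ, hφ, h1, h2⟩ := hu.exists_approx
  have hp0 : 0 < p := by linarith
  have hs0 : 0 < s := by linarith
  have scale : ∀ {F : Type} [NormedAddCommGroup F] [NormedSpace ℝ F] (c r : ℝ), 0 < r →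
      ∀ g : ℕ → Eucl n → F, Tendsto (fun k => eLpNorm (g k) (ENNReal.ofReal r) volume) atTop (𝓝 0) →
      Tendsto (fun k => eLpNorm (fun x => c • g k (b • x + y)) (ENNReal.ofReal r) volume) atTop
        (𝓝 0) := by
    intro F _ _ c r hr g hg
    have e : ∀ k, eLpNorm (fun x => c • g k (b • x + y)) (ENNReal.ofReal r) volume =
        ‖c‖ₑ * ENNReal.ofReal (b ^ (-(n / r))) * eLpNorm (g k) (ENNReal.ofReal r) volume := by
      intro k
      rw [mul_assoc, ← eLpNorm_comp_affine hb y hr (g k)]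
      exact eLpNorm_const_smul c (fun x => g k (b • x + y)) _ _
    simp_rw [e]
    have := ENNReal.Tendsto.const_mul (a := ‖c‖ₑ * ENNReal.ofReal (b ^ (-(n / r)))) hg
      (Or.inr (ENNReal.mul_ne_top (by simp) ENNReal.ofReal_ne_top))
    rwa [mul_zero] at this
  refine MemD.of_tendsto hp hs ((MemLp.comp_affine hb y hs0 hu.1).const_mul a)
    ((MemLp.comp_affine hb y hp0 hu.2.2.1).const_smul (a * b))
    (φ := fun k x => a * φ k (b • x + y)) (fun k => ((hφ k).comp_affine hb.ne' y).const_mul a) ?_ ?_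
  · refine (scale (a * b) p hp0 _ h1).congr fun k => ?_
    congr 1
    ext1 x
    rw [gradient_const_mul_comp_affine (hφ k) a hb.ne', smul_sub]
  · refine (scale a s hs0 _ h2).congr fun k => ?_
    congr 1
    ext1 x
    simp [mul_sub]

/-- Optimality is invariant under affine changes of variables and multiplication by constants. -/
theorem IsOptimal.comp_affine {p s q θ : ℝ} (h : Admissible n p s q θ) {v : Eucl n → ℝ}
    (hv : IsOptimal p s q θ v) {a b : ℝ} (ha : 0 < a) (hb : 0 < b) (y : Eucl n) :
    IsOptimal p s q θ (fun x => a * v (b • x + y)) := by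
  obtain ⟨⟨hD, hv0⟩, hopt⟩ := hv
  obtain ⟨hD', hg⟩ := hD.comp_affine h.one_lt_p.le h.one_le_s (a := a) hb y
  have hs0 : ENNReal.ofReal s ≠ 0 := (ENNReal.ofReal_pos.2 h.s_pos).ne'
  refine ⟨⟨hD', fun h0 => hv0 ?_⟩, ?_⟩
  · have h1 : lNorm s (fun x => a * v (b • x + y)) = 0 := by
      rw [lNorm_congr_ae h0, lNorm]
      simp
    rw [lNorm_const_mul_comp_affine h.s_pos ha hb] at h1
    have h2 : lNorm s v = 0 := by
      have : 0 < a * b ^ (-(n / s)) := by positivity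
      exact (mul_eq_zero.1 h1).resolve_left this.ne'
    rw [lNorm, ENNReal.toReal_eq_zero_iff] at h2
    exact (eLpNorm_eq_zero_iff hD.1.1 hs0).1 (h2.resolve_right hD.1.2.ne)
  · rw [lNorm_congr_ae hg, h.product_comp_affine ha hb, lNorm_const_mul_comp_affine h.q_pos ha hb,
      ← hopt]
    ring

/-- Every nonzero test function can be normalized in `L^s` and in `L^q` by a dilation and a
multiplication by a constant. -/
theorem exists_normalization {p s q θ : ℝ} (h : Admissible n p s q θ) {φ : Eucl n → ℝ}
    (hφ : IsTest φ) (hS : 0 < lNorm s φ) (hQ : 0 < lNorm q φ) :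
    ∃ a b : ℝ, 0 < a ∧ 0 < b ∧ lNorm s (fun x => a * φ (b • x + 0)) = 1 ∧
      lNorm q (fun x => a * φ (b • x + 0)) = 1 ∧
      lNorm p (gradient fun x => a * φ (b • x + 0)) ^ θ =
        lNorm p (gradient φ) ^ θ * lNorm s φ ^ (1 - θ) / lNorm q φ := by
  have hs := h.s_pos
  have hq := h.q_pos
  have hn := h.n_pos
  set κ : ℝ := n / s - n / q with hκ
  have hκ0 : 0 < κ := sub_pos.2 (div_lt_div_of_pos_left hn hs h.s_lt_q)
  set b : ℝ := (lNorm s φ / lNorm q φ) ^ (1 / κ) with hb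
  have hb0 : 0 < b := by positivity
  have hbκ : b ^ κ = lNorm s φ / lNorm q φ := by
    rw [hb, ← Real.rpow_mul (by positivity), one_div_mul_cancel hκ0.ne', Real.rpow_one]
  set a : ℝ := b ^ (n / q) / lNorm q φ with ha
  have ha0 : 0 < a := by positivity
  have eq1 : lNorm q (fun x => a * φ (b • x + 0)) = 1 := by
    rw [lNorm_const_mul_comp_affine hq ha0 hb0, ha, Real.rpow_neg hb0.le]
    field_simp
  have es1 : lNorm s (fun x => a * φ (b • x + 0)) = 1 := by
    rw [lNorm_const_mul_comp_affine hs ha0 hb0, ha]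
    have : b ^ (n / q) / lNorm q φ * b ^ (-(n / s)) * lNorm s φ =
        (b ^ (n / q) * b ^ (-(n / s))) * (lNorm s φ / lNorm q φ) := by ring
    rw [this, ← hbκ, ← Real.rpow_add hb0, ← Real.rpow_add hb0, hκ]
    have : (n : ℝ) / q + -(n / s) + (n / s - n / q) = 0 := by ring
    rw [this, Real.rpow_zero]
  refine ⟨a, b, ha0, hb0, es1, eq1, ?_⟩
  have h1 := h.product_comp_affine ha0 hb0 0 (gradient φ) φ
  rw [es1, Real.one_rpow, mul_one] at h1
  rw [gradient_const_mul_comp_affine hφ a hb0.ne', h1]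
  rw [lNorm_const_mul_comp_affine hq ha0 hb0] at eq1
  rw [eq_div_iff hQ.ne']
  calc _ = (a * b ^ (-(n / q)) * lNorm q φ) * (lNorm p (gradient φ) ^ θ * lNorm s φ ^ (1 - θ)) := by
        ring
    _ = _ := by rw [eq1, one_mul]

end Affine

/-! ### Compactness of minimizing sequences up to translations -/

section Translations

variable {n : ℕ} {p s q θ D : ℝ} {φ : ℕ → Eucl n → ℝ}

/-- The translation that moves the cube with index `k` to the cube with index `0`. -/
theorem cellValue_translate {ε : ℝ} (hε : 0 < ε) (f : Eucl n → ℝ) (k : Fin n → ℤ) :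
    cellValue ε (fun x => f ((1 : ℝ) • x + WithLp.toLp 2 fun i => ε * k i)) 0
      = cellValue ε f k := by
  set y : Eucl n := WithLp.toLp 2 fun i => ε * k i with hy
  have hpre : (fun x : Eucl n => x + y) ⁻¹' cell ε k = cell ε 0 := by
    ext x
    rw [Set.mem_preimage, mem_cell_iff hε, mem_cell_iff hε]
    refine forall_congr' fun i => ?_
    have : (x + y) i = x i + ε * k i := by simp [hy]
    rw [this]
    simp only [Set.mem_Ico, Pi.zero_apply, Int.cast_zero, mul_zero, zero_add, mul_one, mul_add]
    constructor <;> rintro ⟨h1, h2⟩ <;> constructor <;> linarith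
  rw [cellValue, cellValue]
  congr 1
  simp only [one_smul]
  rw [← hpre]
  exact (measurePreserving_add_right volume y).setIntegral_preimage_emb
    (measurableEmbedding_addRight y) f (cell ε k)

theorem IsMinimizing.translate (h : Admissible n p s q θ) (hm : IsMinimizing p s q θ D φ)
    (y : ℕ → Eucl n) : IsMinimizing p s q θ D (fun k x => φ k ((1 : ℝ) • x + y k)) := by
  have hl : ∀ {F : Type} [NormedAddCommGroup F] {r : ℝ}, 0 < r → ∀ (f : Eucl n → F) (z : Eucl n),
      lNorm r (fun x => f ((1 : ℝ) • x + z)) = lNorm r f := by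
    intro F _ r hr f z
    rw [lNorm_comp_affine one_pos z hr, Real.one_rpow, one_mul]
  refine ⟨fun k => (hm.isTest k).comp_affine one_ne_zero _, fun k => ?_, fun k => ?_, ?_,
    hm.rpow_eq⟩
  · rw [hl h.s_pos, hm.lNorm_s]
  · rw [hl h.q_pos, hm.lNorm_q]
  · refine hm.tendsto.congr fun k => ?_
    have e : (gradient fun x => φ k ((1 : ℝ) • x + y k)) =
        fun x => gradient (φ k) ((1 : ℝ) • x + y k) := by
      ext1 x
      rw [gradient_comp_affine (hm.isTest k), one_smul]
    rw [e, hl h.p_pos]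

/-- Up to translations, a minimizing sequence has a subsequence that converges in `L^q` to an
optimal function. -/
theorem IsMinimizing.exists_optimal (h : Admissible n p s q θ) (hm : IsMinimizing p s q θ D φ)
    (hG : 0 < sharpConst n p s q θ) :
    ∃ (σ : ℕ → ℕ) (y : ℕ → Eucl n) (u : Eucl n → ℝ), StrictMono σ ∧ IsOptimal p s q θ u ∧
      MemLp u (ENNReal.ofReal q) ∧ lNorm q u = 1 ∧
      Tendsto (fun k => eLpNorm (fun x => φ (σ k) ((1 : ℝ) • x + y k) - u x)
        (ENNReal.ofReal q) volume) atTop (𝓝 0) := by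
  have hp := h.p_pos
  have hs := h.s_pos
  have hq := h.q_pos
  have hp1 := ENNReal.one_le_ofReal.2 h.one_lt_p.le
  have hps : 0 < n * p / (n - p) := hq.trans h.q_lt
  obtain ⟨B, hB⟩ := hm.tendsto.bddAbove_range
  set M : ℝ≥0∞ := ENNReal.ofReal (max B 1) with hM
  have hMt : M ≠ ⊤ := ENNReal.ofReal_ne_top
  have key : ∀ {ψ : ℕ → Eucl n → ℝ}, IsMinimizing p s q θ D ψ →
      (∀ k, lNorm p (gradient (ψ k)) ≤ B) → ∀ k,
      eLpNorm (gradient (ψ k)) (ENNReal.ofReal p) volume ≤ M ∧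
      eLpNorm (ψ k) (ENNReal.ofReal s) volume ≤ M ∧
      eLpNorm (ψ k) (ENNReal.ofReal s) volume = 1 ∧
      eLpNorm (ψ k) (ENNReal.ofReal q) volume = 1 := by
    intro ψ hψ hψB k
    have h1 : eLpNorm (ψ k) (ENNReal.ofReal s) volume = 1 := by
      rw [← ofReal_lNorm ((hψ.isTest k).memLp _), hψ.lNorm_s, ENNReal.ofReal_one]
    refine ⟨?_, ?_, h1, ?_⟩
    · rw [← ofReal_lNorm ((hψ.isTest k).memLp_gradient _)]
      exact ENNReal.ofReal_le_ofReal ((hψB k).trans (le_max_left _ _))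
    · rw [h1]
      exact ENNReal.one_le_ofReal.2 (le_max_right _ _)
    · rw [← ofReal_lNorm ((hψ.isTest k).memLp _), hψ.lNorm_q, ENNReal.ofReal_one]
  obtain ⟨ε, hε, c, hc, hcell⟩ := exists_cellValue_ge h.one_lt_p h.p_lt_n h.one_le_s h.s_lt_q h.q_lt
    hMt
  have hφk := key hm fun k => hB ⟨k, rfl⟩
  choose i hi using fun k => hcell (φ k) (hm.isTest k) (hφk k).1 (hφk k).2.1 (hφk k).2.2.2
  set y : ℕ → Eucl n := fun k => WithLp.toLp 2 fun j => ε * i k j with hy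
  set ψ : ℕ → Eucl n → ℝ := fun k x => φ k ((1 : ℝ) • x + y k) with hψ
  have hmψ : IsMinimizing p s q θ D ψ := hm.translate h y
  have hψB : ∀ k, lNorm p (gradient (ψ k)) ≤ B := by
    intro k
    have e : gradient (ψ k) = fun x => gradient (φ k) ((1 : ℝ) • x + y k) := by
      ext1 x
      rw [hψ, gradient_comp_affine (hm.isTest k), one_smul]
    rw [e, lNorm_comp_affine one_pos _ hp, Real.one_rpow, one_mul]
    exact hB ⟨k, rfl⟩
  have hψk := key hmψ hψB
  have hψc : ∀ k, c ≤ |cellValue ε (ψ k) 0| := fun k => by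
    rw [hψ, hy, cellValue_translate hε]
    exact hi k
  obtain ⟨u, σ, hum, hσ, hae, hlocp⟩ := exists_subseq_tendsto_local h.one_lt_p.le h.one_le_s hMt
    hmψ.isTest (fun k => (hψk k).1) (fun k => (hψk k).2.1)
  have humeas := hum.aestronglyMeasurable (μ := (volume : Measure (Eucl n)))
  have hmσ := hmψ.comp hσ
  have hmeas := fun k => (hmσ.isTest k).aestronglyMeasurable
  obtain ⟨C, hC⟩ := exists_sobolev_const h.one_lt_p h.p_lt_n
  have hsob : ∀ k, eLpNorm (ψ (σ k)) (ENNReal.ofReal (n * p / (n - p))) volume ≤ C * M := fun k =>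
    (hC _ (hmψ.isTest _)).trans (by gcongr; exact (hψk _).1)
  have hCM : C * M ≠ ⊤ := ENNReal.mul_ne_top (by simp) hMt
  have hus : eLpNorm u (ENNReal.ofReal s) volume ≤ 1 :=
    Lp.eLpNorm_le_of_ae_tendsto (Eventually.of_forall fun k => (hψk (σ k)).2.2.1.le) hmeas hae
  have huq : eLpNorm u (ENNReal.ofReal q) volume ≤ 1 :=
    Lp.eLpNorm_le_of_ae_tendsto (Eventually.of_forall fun k => (hψk (σ k)).2.2.2.le) hmeas hae
  have hups : eLpNorm u (ENNReal.ofReal (n * p / (n - p))) volume ≤ C * M :=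
    Lp.eLpNorm_le_of_ae_tendsto (Eventually.of_forall hsob) hmeas hae
  have musq : MemLp u (ENNReal.ofReal q) := ⟨humeas, huq.trans_lt (by simp)⟩
  have hps1 : 1 < n * p / (n - p) := h.one_lt_q.trans h.q_lt
  -- local convergence in `L^q`: from `L^p` to `L^1` on balls, then interpolate with `L^{p*}`
  have hlocq : ∀ R : ℕ, Tendsto (fun k => eLpNorm (fun x => ψ (σ k) x - u x) (ENNReal.ofReal q)
        (volume.restrict (Metric.closedBall 0 R))) atTop (𝓝 0) := by
    intro R
    have hl1 : Tendsto (fun k => eLpNorm (fun x => ψ (σ k) x - u x) (ENNReal.ofReal 1)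
        (volume.restrict (Metric.closedBall 0 R))) atTop (𝓝 0) := by
      have hv : volume (Metric.closedBall (0 : Eucl n) R) ^ (1 / 1 - 1 / p) ≠ ⊤ :=
        ENNReal.rpow_ne_top_of_nonneg (sub_nonneg.2 (one_div_le_one_div_of_le one_pos
          h.one_lt_p.le)) measure_closedBall_lt_top.ne
      have h1 := ENNReal.Tendsto.mul_const (hlocp R) (Or.inr hv)
      rw [zero_mul] at h1
      refine tendsto_of_tendsto_of_tendsto_of_le_of_le tendsto_const_nhds h1
        (fun _ => bot_le) fun k => ?_
      have h2 := eLpNorm_le_eLpNorm_mul_rpow_measure_univ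
        (ENNReal.ofReal_le_ofReal h.one_lt_p.le)
        (((hmeas k).sub humeas).restrict (s := Metric.closedBall 0 (R : ℝ)))
      rwa [ENNReal.toReal_ofReal hp.le, ENNReal.toReal_ofReal zero_le_one,
        Measure.restrict_apply_univ] at h2
    obtain ⟨t, ht0, ht1, ht⟩ := exists_interpolation_weight one_pos h.one_lt_q h.q_lt
    refine tendsto_eLpNorm_interpolation one_pos hps hq ht0.le ht1 ht
      (fun k => ((hmeas k).sub humeas).restrict) hl1
      (ENNReal.add_ne_top.2 ⟨hCM, hCM⟩) (Eventually.of_forall fun k => ?_)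
    refine (eLpNorm_mono_measure _ Measure.restrict_le_self).trans
      ((eLpNorm_sub_le (hmeas k) humeas (ENNReal.one_le_ofReal.2 hps1.le)).trans
        (add_le_add (hsob k) hups))
  -- the average over the fixed cube passes to the limit
  have hu0 : ¬ u =ᵐ[volume] 0 := by
    intro hu0
    obtain ⟨R, hR⟩ := exists_nat_ge ((n : ℝ) * ε)
    have hsub : cell (n := n) ε 0 ⊆ Metric.closedBall 0 R := by
      intro x hx
      have h0 : cellIndex (n := n) ε 0 = 0 := by
        ext j
        simp [cellIndex]
      have h1 := dist_le_of_cellIndex_eq hε (x := 0) (y := x) (h0.trans (Eq.symm hx))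
      rw [sub_zero] at h1
      simpa using h1.trans hR
    have hv : 0 < ε ^ n := by positivity
    have hvt : (ENNReal.ofReal (ε ^ n))⁻¹ ≠ ⊤ := ENNReal.inv_ne_top.2 (ENNReal.ofReal_pos.2 hv).ne'
    have hle : ∀ k, ENNReal.ofReal c ^ p ≤ (ENNReal.ofReal (ε ^ n))⁻¹ *
        eLpNorm (fun x => ψ (σ k) x - u x) (ENNReal.ofReal p)
          (volume.restrict (Metric.closedBall 0 R)) ^ p := by
      intro k
      have e : eLpNorm (fun x => ψ (σ k) x - u x) (ENNReal.ofReal p)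
          (volume.restrict (Metric.closedBall 0 R)) = eLpNorm (ψ (σ k)) (ENNReal.ofReal p)
          (volume.restrict (Metric.closedBall 0 R)) := by
        refine eLpNorm_congr_ae (ae_restrict_of_ae ?_)
        filter_upwards [hu0] with x hx
        rw [hx]
        simp
      rw [e, eLpNorm_ofReal_rpow hp]
      calc ENNReal.ofReal c ^ p ≤ ‖cellValue ε (ψ (σ k)) 0‖ₑ ^ p := by
            gcongr
            rw [← ofReal_norm]
            exact ENNReal.ofReal_le_ofReal (hψc _)
        _ ≤ _ := enorm_cellValue_rpow_le hε h.one_lt_p.le (hmeas k) 0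
        _ ≤ _ := mul_le_mul' le_rfl (lintegral_mono_set hsub)
    have hlim := ENNReal.Tendsto.const_mul (a := (ENNReal.ofReal (ε ^ n))⁻¹)
      ((hlocp R).ennrpow_const p) (Or.inr hvt)
    rw [ENNReal.zero_rpow_of_pos hp, mul_zero] at hlim
    have := ge_of_tendsto' hlim hle
    rw [nonpos_iff_eq_zero, ENNReal.rpow_eq_zero_iff_of_pos hp, ENNReal.ofReal_eq_zero] at this
    linarith
  obtain ⟨hopt, hlim⟩ := hmσ.isOptimal_limit h hG ⟨humeas, hus.trans_lt (by simp)⟩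
    (ENNReal.toReal_le_of_le_ofReal zero_le_one (by simpa using hus))
    ⟨humeas, hups.trans_lt hCM.lt_top⟩ musq hu0 hlocp hlocq
  exact ⟨σ, fun k => y (σ k), u, hσ, hopt, musq, hmσ.lNorm_limit h musq hlim, hlim⟩

end Translations

/-! ### From the deficit to the asymmetry -/

section Stability

variable {n : ℕ} {p s q θ : ℝ}

/-- The nonzero elements of `D^{p,s}` have finite positive norms in `L^s` and in `L^q`. -/
theorem MemDNonzero.norms (h : Admissible n p s q θ) {w : Eucl n → ℝ} (hw : MemDNonzero p s w) :
    0 < lNorm s w ∧ MemLp w (ENNReal.ofReal q) ∧ 0 < lNorm q w := by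
  obtain ⟨hD, hw0⟩ := hw
  obtain ⟨φ, hφ, h1, h2⟩ := hD.exists_approx
  have hmq := (tendsto_eLpNorm_intermediate_of_approx h.one_lt_p h.p_lt_n h.one_le_s h.s_lt_q h.q_lt
    hD.1 hD.2.2.1 hφ h1 h2).1
  have pos : ∀ {r : ℝ}, 0 < r → MemLp w (ENNReal.ofReal r) → 0 < lNorm r w := fun hr hm =>
    ENNReal.toReal_pos (fun h0 => hw0 ((eLpNorm_eq_zero_iff hm.1
      (ENNReal.ofReal_pos.2 hr).ne').1 h0)) hm.2.ne
  exact ⟨pos h.s_pos hD.1, hmq, pos h.q_pos hmq⟩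

/-- Test functions approximate a nonzero element of `D^{p,s}` in `L^q`, with almost the same
quotient. -/
theorem MemDNonzero.exists_test (h : Admissible n p s q θ) {w : Eucl n → ℝ}
    (hw : MemDNonzero p s w) {ε : ℝ} (hε : 0 < ε) :
    ∃ φ : Eucl n → ℝ, IsTest φ ∧ 0 < lNorm s φ ∧ 0 < lNorm q φ ∧
      lNorm p (gradient φ) ^ θ * lNorm s φ ^ (1 - θ) / lNorm q φ ≤
        lNorm p (weakGrad w) ^ θ * lNorm s w ^ (1 - θ) / lNorm q w + ε ∧
      lNorm q (fun x => φ x - w x) ≤ ε * lNorm q w := by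
  obtain ⟨hs0, hmq, hq0⟩ := hw.norms h
  obtain ⟨φ, hφ, h1, h2⟩ := hw.1.exists_approx
  have h3 := (tendsto_eLpNorm_intermediate_of_approx h.one_lt_p h.p_lt_n h.one_le_s h.s_lt_q h.q_lt
    hw.1.1 hw.1.2.2.1 hφ h1 h2).2
  have hs := tendsto_lNorm_of_tendsto_eLpNorm h.one_le_s (fun k => (hφ k).memLp _) hw.1.1 h2
  have hq := tendsto_lNorm_of_tendsto_eLpNorm h.one_lt_q.le (fun k => (hφ k).memLp _) hmq h3
  have hp := tendsto_lNorm_of_tendsto_eLpNorm h.one_lt_p.le (fun k => (hφ k).memLp_gradient _)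
    hw.1.2.2.1 h1
  have hJ := ((hp.rpow_const (Or.inr h.theta_mem.1.le)).mul
    (hs.rpow_const (Or.inr (sub_nonneg.2 h.theta_mem.2.le)))).div hq hq0.ne'
  have h4 : Tendsto (fun k => lNorm q (fun x => φ k x - w x)) atTop (𝓝 0) := by
    have := (ENNReal.tendsto_toReal ENNReal.zero_ne_top).comp h3
    rwa [ENNReal.toReal_zero] at this
  obtain ⟨k, a1, a2, a3, a4⟩ := ((hs.eventually_const_lt hs0).and ((hq.eventually_const_lt hq0).and
    ((hJ.eventually_lt_const (lt_add_of_pos_right _ hε)).and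
      (h4.eventually_lt_const (mul_pos hε hq0))))).exists
  exact ⟨φ k, hφ k, a1, a2, a3.le, a4.le⟩

/-- An optimal function close to the normalization of a test function `φ` yields, by undoing the
normalization and rescaling, a competitor in the asymmetry of every `w` close to `φ`. -/
theorem asymmetry_le (h : Admissible n p s q θ) {w φ u : Eucl n → ℝ} {a b ε : ℝ} {y : Eucl n}
    (hmw : MemLp w (ENNReal.ofReal q)) (hw : 0 < lNorm q w) (hφ : IsTest φ) (ha : 0 < a)
    (hb : 0 < b) (hφ1 : lNorm q (fun x => a * φ (b • x + 0)) = 1) (hε1 : ε ≤ 1)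
    (hφw : lNorm q (fun x => φ x - w x) ≤ ε * lNorm q w) (hu : IsOptimal p s q θ u)
    (hmu : MemLp u (ENNReal.ofReal q)) (hu1 : lNorm q u = 1) :
    asymmetry p s q θ w ≤ ENNReal.ofReal
      (2 * ε + 2 * lNorm q (fun x => a * φ (b • ((1 : ℝ) • x + y) + 0) - u x)) ^ q := by
  have hq := h.q_pos
  have hq1 := h.one_lt_q.le
  set e := lNorm q (fun x => a * φ (b • ((1 : ℝ) • x + y) + 0) - u x) with he
  have he0 : 0 ≤ e := lNorm_nonneg _
  set Q := lNorm q w with hQ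
  set R := lNorm q φ with hR
  have hmφ : MemLp φ (ENNReal.ofReal q) := hφ.memLp _
  rw [lNorm_const_mul_comp_affine hq ha hb] at hφ1
  have hb' : 0 < b⁻¹ := inv_pos.2 hb
  have ha' : 0 < a⁻¹ := inv_pos.2 ha
  have hscale : a⁻¹ * b⁻¹ ^ (-(n / q)) = R := by
    have h1 : b ^ (-(n / q)) ≠ 0 := (Real.rpow_pos_of_pos hb _).ne'
    rw [Real.inv_rpow hb.le, ← mul_inv]
    exact inv_eq_of_mul_eq_one_right hφ1
  have hR0 : 0 < R := by
    rw [← hscale]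
    positivity
  set u₀ : Eucl n → ℝ := fun z => a⁻¹ * u (b⁻¹ • z + -y) with hu₀
  have hmu₀ : MemLp u₀ (ENNReal.ofReal q) := (MemLp.comp_affine hb' (-y) hq hmu).const_mul _
  have hu₀R : lNorm q u₀ = R := by
    rw [hu₀, lNorm_const_mul_comp_affine hq ha' hb', hscale, hu1, mul_one]
  have hφu₀ : lNorm q (fun z => φ z - u₀ z) = R * e := by
    rw [he, ← hscale, ← lNorm_const_mul_comp_affine hq ha' hb' (-y)]
    congr 1
    ext1 z
    have : b • ((1 : ℝ) • (b⁻¹ • z + -y) + y) + 0 = z := by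
      rw [one_smul, neg_add_cancel_right, add_zero, smul_inv_smul₀ hb.ne']
    rw [this, mul_sub, inv_mul_cancel_left₀ ha.ne']
  set v : Eucl n → ℝ := fun z => Q / R * a⁻¹ * u (b⁻¹ • z + -y) with hv
  have hvu : v = fun z => Q / R * u₀ z := by
    ext1 z
    exact mul_assoc _ _ _
  have hmv : MemLp v (ENNReal.ofReal q) := by
    rw [hvu]
    exact hmu₀.const_mul _
  have hvopt : IsOptimal p s q θ v := hu.comp_affine h (by positivity) hb' (-y)
  have hvQ : lNorm q v = Q := by
    rw [hvu, lNorm_const_mul, hu₀R, abs_of_pos (by positivity), div_mul_cancel₀ _ hR0.ne']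
  have hRQ : |R - Q| ≤ ε * Q := (abs_lNorm_sub_lNorm_le hq1 hmφ hmw).trans hφw
  have hu₀v : lNorm q (fun z => u₀ z - v z) ≤ ε * Q := by
    have : (fun z => u₀ z - v z) = fun z => (1 - Q / R) * u₀ z := by
      ext1 z
      rw [hvu]
      ring
    rw [this, lNorm_const_mul, hu₀R]
    calc |1 - Q / R| * R = |(1 - Q / R) * R| := by rw [abs_mul, abs_of_pos hR0]
      _ = |R - Q| := by rw [sub_mul, one_mul, div_mul_cancel₀ _ hR0.ne']
      _ ≤ _ := hRQ
  have hwv : lNorm q (fun z => w z - v z) ≤ (2 * ε + 2 * e) * Q := by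
    have h1 : lNorm q (fun z => w z - v z) ≤
        lNorm q (fun z => w z - φ z) + (R * e + ε * Q) := by
      have e1 : (fun z => w z - v z) =
          fun z => (w z - φ z) + ((φ z - u₀ z) + (u₀ z - v z)) := by
        ext1 z
        ring
      rw [e1]
      refine (lNorm_add_le hq1 (hmw.sub hmφ) ((hmφ.sub hmu₀).add (hmu₀.sub hmv))).trans ?_
      refine add_le_add le_rfl ((lNorm_add_le hq1 (hmφ.sub hmu₀) (hmu₀.sub hmv)).trans ?_)
      exact add_le_add hφu₀.le hu₀v
    rw [lNorm_sub_comm w φ] at h1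
    have h2 : R ≤ 2 * Q := by
      have := (abs_le.1 hRQ).2
      nlinarith
    nlinarith [mul_le_mul_of_nonneg_right h2 he0]
  rw [asymmetry]
  refine le_trans (iInf₂_le_of_le v hvopt (iInf_le _ ?_)) ?_
  · rw [← ofReal_lNorm hmv, ← ofReal_lNorm hmw, hvQ]
  · have hwv' : MemLp (fun z => w z - v z) (ENNReal.ofReal q) := hmw.sub hmv
    rw [← ENNReal.div_rpow_of_nonneg _ _ hq.le, ← ofReal_lNorm hwv', ← ofReal_lNorm hmw,
      ← ENNReal.ofReal_div_of_pos hw]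
    exact ENNReal.rpow_le_rpow (ENNReal.ofReal_le_ofReal ((div_le_iff₀ hw).2 hwv)) hq.le

/-- A sequence whose quotients tend to the sharp constant has a subsequence along which the
asymmetry tends to zero. -/
theorem exists_subseq_tendsto_asymmetry (h : Admissible n p s q θ)
    (hG : 0 < sharpConst n p s q θ) {w : ℕ → Eucl n → ℝ} (hw : ∀ k, MemDNonzero p s (w k))
    (hJ : Tendsto (fun k => lNorm p (weakGrad (w k)) ^ θ * lNorm s (w k) ^ (1 - θ) / lNorm q (w k))
      atTop (𝓝 (sharpConst n p s q θ))) :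
    ∃ σ : ℕ → ℕ, Tendsto (fun k => asymmetry p s q θ (w (σ k))) atTop (𝓝 0) := by
  have hθ := h.theta_mem.1
  have hε : ∀ k : ℕ, (0 : ℝ) < 1 / ((k : ℝ) + 1) := fun k => by positivity
  choose φ hφ hφs hφq hφJ hφw using fun k => (hw k).exists_test h (hε k)
  choose a b ha hb hsn hqn hgn using fun k => exists_normalization h (hφ k) (hφs k) (hφq k)
  set ψ : ℕ → Eucl n → ℝ := fun k x => a k * φ k (b k • x + 0) with hψ
  have hlim : Tendsto (fun k => lNorm p (gradient (φ k)) ^ θ * lNorm s (φ k) ^ (1 - θ) /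
      lNorm q (φ k)) atTop (𝓝 (sharpConst n p s q θ)) := by
    have h1 := hJ.add tendsto_one_div_add_atTop_nhds_zero_nat
    rw [add_zero] at h1
    refine tendsto_of_tendsto_of_tendsto_of_le_of_le tendsto_const_nhds h1 (fun k => ?_) hφJ
    exact (le_div_iff₀ (hφq k)).2
      ((hφ k).sharpConst_mul_lNorm_le h.one_lt_p.le h.one_le_s)
  have hm : IsMinimizing p s q θ (sharpConst n p s q θ ^ θ⁻¹) ψ := by
    refine ⟨fun k => ((hφ k).comp_affine (hb k).ne' 0).const_mul _, hsn, hqn, ?_,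
      Real.rpow_inv_rpow hG.le hθ.ne'⟩
    refine (hlim.rpow_const (Or.inr (inv_nonneg.2 hθ.le))).congr fun k => ?_
    rw [← hgn, Real.rpow_rpow_inv (lNorm_nonneg _) hθ.ne']
  obtain ⟨σ, y, u, hσ, hopt, hmu, hu1, hconv⟩ := hm.exists_optimal h hG
  refine ⟨σ, ?_⟩
  have hconv' : Tendsto (fun k => lNorm q (fun x => ψ (σ k) ((1 : ℝ) • x + y k) - u x)) atTop
      (𝓝 0) := by
    have := (ENNReal.tendsto_toReal ENNReal.zero_ne_top).comp hconv
    rwa [ENNReal.toReal_zero] at this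
  have hε0 : Tendsto (fun k => 1 / ((σ k : ℝ) + 1)) atTop (𝓝 0) :=
    tendsto_one_div_add_atTop_nhds_zero_nat.comp hσ.tendsto_atTop
  have hbound := (ENNReal.tendsto_ofReal ((hε0.const_mul 2).add (hconv'.const_mul 2))).ennrpow_const q
  rw [mul_zero, add_zero, ENNReal.ofReal_zero, ENNReal.zero_rpow_of_pos h.q_pos] at hbound
  refine tendsto_of_tendsto_of_tendsto_of_le_of_le tendsto_const_nhds hbound (fun _ => bot_le)
    fun k => ?_
  obtain ⟨-, hmw, hw0⟩ := (hw (σ k)).norms h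
  have hε1 : 1 / ((σ k : ℝ) + 1) ≤ 1 := by
    rw [div_le_one (by positivity)]
    linarith [(σ k).cast_nonneg (α := ℝ)]
  exact asymmetry_le h hmw hw0 (hφ _) (ha _) (hb _) (hqn _) hε1 (hφw _) hopt hmu hu1

end Stability

end GNS

theorem corollary2p4 (n : ℕ) (hn : 2 ≤ n) (p s q θ : ℝ)
    (hp : 1 < p) (hpn : p < n) (hs : 1 ≤ s) (hsq : s < q) (hq : q < n * p / (n - p))
    (hθ : θ / (n * p / (n - p)) + (1 - θ) / s = 1 / q)
    (u : ℕ → EuclideanSpace ℝ (Fin n) → ℝ) (hu : ∀ h, GNS.MemDNonzero p s (u h))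
    (hδ : Tendsto (fun h => GNS.deficit p s q θ (u h)) atTop (𝓝 0)) :
    Tendsto (fun h => GNS.asymmetry p s q θ (u h)) atTop (𝓝 0) := by
  have h : GNS.Admissible n p s q θ := ⟨hp, hpn, hs, hsq, hq, hθ⟩
  -- if the sharp constant vanished, the convention `x / 0 = 0` would make every deficit `-1`
  have hG : 0 < GNS.sharpConst n p s q θ := by
    refine GNS.sharpConst_nonneg.lt_of_ne fun h0 => ?_
    simp only [GNS.deficit, ← h0, zero_mul, div_zero, zero_sub] at hδ
    have := tendsto_nhds_unique hδ tendsto_const_nhds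
    norm_num at this
  refine tendsto_of_subseq_tendsto fun ns hns =>
    GNS.exists_subseq_tendsto_asymmetry h hG (w := fun k => u (ns k)) (fun k => hu (ns k)) ?_
  have h1 := ((hδ.comp hns).add_const 1).const_mul (GNS.sharpConst n p s q θ)
  rw [zero_add, mul_one] at h1
  refine h1.congr fun k => ?_
  have hQ := ((hu (ns k)).norms h).2.2
  rw [Function.comp_apply, GNS.deficit, sub_add_cancel, mul_div_assoc', mul_div_mul_left _ _ hG.ne']
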